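/- **Setting.** Let $G$ be a countable discrete group acting by homeomorphisms on a second countable, locally compact, Hausdorff space $X$, let $Y\subset X$ be clopen with $GY=X$, and let $N\colon G\to(0,+\infty)$ be a homomorphism. Let $C_0(X)\rtimes_r G$ be the reduced crossed product, generated by the elements $fu_g$ ($f\in C_0(X)$, $g\in G$), let $E\colon C_0(X)\rtimes_r G\to C_0(X)$ be the conditional expectation with $E(fu_g)=f$ if $g=e$ and $E(fu_g)=0$ otherwise, and let $$C^*_r(G\boxtimes Y)=\mathbf 1_Y\,(C_0(X)\rtimes_r G)\,\mathbf 1_Y$$ be the reduced C$^*$-algebra of the groupoid $G\boxtimes Y=\{(g,x)\mid x\in Y,\ gx\in Y\}$, with the dynamics $\sigma$ determined by $\sigma_t(f)(g,x)=N(g)^{it}f(g,x)$, that is, $\sigma_t(fu_g)=N(g)^{it}fu_g$. For $\beta\in\mathbb R$, a $\sigma$-KMS$_\beta$-state is a $\sigma$-invariant state $\varphi$ such that $\varphi(ab)=\varphi(b\,\sigma_{i\beta}(a))$ for all $a,b$ in a set of $\sigma$-analytic elements with dense linear span. For a measure $\mu$ with $\mu(Y)=1$ we write $\mu_*\circ E$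 for the functional $a\mapsto\int_Y E(a)\,d\mu$ on $C^*_r(G\boxtimes Y)$. For $S\subset G$ put $\zeta_S(\beta)=\sum_{s\in S}N(s)^{-\beta}\in[0,+\infty]$. Suppose there are Borel sets $Y_n\subset Y$ and elements $g_n\in G$ ($n\ge1$) such that $\bigcup_nY_n$ contains all points of $Y$ with nontrivial isotropy, and $N(g_n)\ne1$ and $g_nY_n=Y_n$ for all $n$. **Proposition 1.2.** Let $\beta\ne0$, let $S\subset G$, and let $Y_0\subset Y$ be a nonempty Borel set such that (i) $gY_0\cap Y_0=\emptyset$ for all $g\in G\setminus\{e\}$; (ii) $SY_0\subset Y$; (iii) if $gY_0\cap Y\neq\emptyset$ then $g\in S$; (iv) $Y\setminus SU\subset\bigcup_nY_n$ for every open set $U$ containing $Y_0$; (v) $\zeta_S(\beta)<\infty$. Then: (1) Every $\sigma$-KMS$_\beta$-state $\varphi$ on $C^*_r(G\boxtimes Y)$ is of the form $\varphi=\mu_*\circ E$ for a unique Radon measure $\mu$ on $X$ such that $\mu(Y)=1$ and $\mu(gZ)=N(g)^{-\beta}\mu(Z)$ for all $g\in G$ and Borel $Z\subset X$. The map $\varphi=\mu_*\circ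 E\mapsto\zeta_S(\beta)\,\mu|_{Y_0}$ is well defined and is an affine isomorphism (an affine bijection) between the $\sigma$-KMS$_\beta$-states on $C^*_r(G\boxtimes Y)$ and the Borel probability measures on $Y_0$. The inverse map is $\nu\mapsto\mu_*\circ E$, where the measure $\mu$ on $Y$ is defined by $$\mu(Z)=\zeta_S(\beta)^{-1}\sum_{s\in S}N(s)^{-\beta}\,\nu(s^{-1}Z\cap Y_0)\qquad(Z\subset Y\text{ Borel}).\tag{$*$}$$ (2) Let $\nu$ be a Borel probability measure on $Y_0$, let $\mu$ be the measure on $Y$ defined by $(*)$, and let $H_S\subset L^2(Y,d\mu)$ be the subspace of (classes of) functions $f$ such that $f(sy)=f(y)$ for $y\in Y_0$ and $s\in S$. Then for $f\in H_S$ $$\|f\|_2^2=\zeta_S(\beta)\int_{Y_0}|f(y)|^2\,d\mu(y).$$ Furthermore, the orthogonal projection $P\colon L^2(Y,d\mu)\to H_S$ exists and is given, for $f\in L^2(Y,d\mu)$ and $\nu$-almost every $y\in Y_0$, by $$(Pf)(ty)=\zeta_S(\beta)^{-1}\sum_{s\in S}N(s)^{-\beta}f(sy)\qquad\text{for all }t\in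 S,$$ where the series converges absolutely. -/

import Mathlib

open MeasureTheory Set
open scoped ENNReal Pointwise ZeroAtInfty

noncomputable section

namespace PhaseTransition

/-- The complex Hilbert space `ℓ²(I)`. -/
abbrev ellTwo (I : Type*) : Type _ := lp (fun _ : I => ℂ) 2

theorem weightedComp_bound {I : Type*} (w : I → ℂ) (C : ℝ) (hw : ∀ i, ‖w i‖ ≤ C)
    (τ : Equiv.Perm I) (ξ : ellTwo I) (i : I) :
    ‖w i * ξ (τ i)‖ ^ (2 : ENNReal).toReal ≤ C ^ 2 * ‖ξ (τ i)‖ ^ (2 : ENNReal).toReal := by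
  have h : ‖w i * ξ (τ i)‖ ≤ C * ‖ξ (τ i)‖ := by
    rw [norm_mul]; exact mul_le_mul_of_nonneg_right (hw i) (norm_nonneg _)
  have := pow_le_pow_left₀ (norm_nonneg _) h 2
  rw [mul_pow] at this
  simpa using this

theorem weightedComp_summable {I : Type*} (C : ℝ) (τ : Equiv.Perm I) (ξ : ellTwo I) :
    Summable fun i => C ^ 2 * ‖ξ (τ i)‖ ^ (2 : ENNReal).toReal :=
  ((τ.summable_iff (f := fun i => ‖ξ i‖ ^ (2 : ENNReal).toReal)).2
    ((lp.memℓp ξ).summable (by norm_num))).mul_left _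

/-- The bounded operator `(T ξ)(i) = w i * ξ (τ i)` on `ℓ²(I)`, for a bounded weight `w` and a
permutation `τ` of `I`. -/
def weightedComp {I : Type*} (w : I → ℂ) (C : ℝ) (hw : ∀ i, ‖w i‖ ≤ C)
    (τ : Equiv.Perm I) : ellTwo I →L[ℂ] ellTwo I :=
  LinearMap.mkContinuous
    { toFun := fun ξ => ⟨fun i => w i * ξ (τ i), memℓp_gen <|
        Summable.of_nonneg_of_le (fun _ => by positivity) (weightedComp_bound w C hw τ ξ)
          (weightedComp_summable C τ ξ)⟩
      map_add' := fun ξ η => by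
        ext i
        change w i * (ξ (τ i) + η (τ i)) = w i * ξ (τ i) + w i * η (τ i)
        ring
      map_smul' := fun c ξ => by
        ext i
        change w i * (c * ξ (τ i)) = c * (w i * ξ (τ i))
        ring }
    |C| fun ξ => by
      refine lp.norm_le_of_tsum_le (by norm_num) (by positivity) ?_
      refine ((Summable.of_nonneg_of_le (fun _ => by positivity) (weightedComp_bound w C hw τ ξ)
        (weightedComp_summable C τ ξ)).tsum_le_tsum (weightedComp_bound w C hw τ ξ)
          (weightedComp_summable C τ ξ)).trans ?_
      rw [tsum_mul_left, τ.tsum_eq (fun i => ‖ξ i‖ ^ (2 : ENNReal).toReal),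
        ← lp.norm_rpow_eq_tsum (by norm_num)]
      simp [mul_pow]

@[simp] theorem weightedComp_apply {I : Type*} (w : I → ℂ) (C : ℝ) (hw : ∀ i, ‖w i‖ ≤ C)
    (τ : Equiv.Perm I) (ξ : ellTwo I) (i : I) :
    weightedComp w C hw τ ξ i = w i * ξ (τ i) := rfl

theorem weightedComp_adjoint {I : Type*} (w : I → ℂ) (C : ℝ) (hw : ∀ i, ‖w i‖ ≤ C)
    (v : I → ℂ) (hv : ∀ i, ‖v i‖ ≤ C) (h : ∀ i, v i = star (w i)) :
    star (weightedComp w C hw (Equiv.refl I)) = weightedComp v C hv (Equiv.refl I) := by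
  rw [ContinuousLinearMap.star_eq_adjoint]
  refine ((ContinuousLinearMap.eq_adjoint_iff _ _).2 fun ξ η => ?_).symm
  rw [lp.inner_eq_tsum, lp.inner_eq_tsum]
  refine tsum_congr fun i => ?_
  simp [h]
  ring

/-! ### The reduced crossed product and its corner -/

section Algebra

set_option linter.unusedSectionVars false

variable {G X : Type*} [Group G] [TopologicalSpace X] [MulAction G X]

/-- The element `f u_g` of the reduced crossed product, in the regular representation on
`ℓ²(G × X)` induced by the (faithful) atomic representation of `C₀(X)` on `ℓ²(X)`:
`(f u_g ξ)(k, x) = f (k x) ξ (g⁻¹ k, x)`. It is the operator of convolution by the function on the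
transformation groupoid `G × X` given by `(h, x) ↦ f (h x)` if `h = g`, and `0` otherwise. -/
def monomial (f : C₀(X, ℂ)) (g : G) : ellTwo (G × X) →L[ℂ] ellTwo (G × X) :=
  weightedComp (fun p => f (p.1 • p.2)) ‖f‖
    (fun p => BoundedContinuousFunction.norm_coe_le_norm f.toBCF (p.1 • p.2))
    ((Equiv.mulLeft g⁻¹).prodCongr (Equiv.refl X))

theorem monomial_apply (f : C₀(X, ℂ)) (g : G) (ξ : ellTwo (G × X)) (k : G) (x : X) :
    monomial f g ξ (k, x) = f (k • x) * ξ (g⁻¹ * k, x) := rfl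

variable (G X) in
/-- The reduced crossed product `C₀(X) ⋊ᵣ G` (the reduced C⋆-algebra of the transformation groupoid
`G × X`): the C⋆-algebra generated by the operators `f u_g`. -/
def reducedCrossedProduct :
    NonUnitalStarSubalgebra ℂ (ellTwo (G × X) →L[ℂ] ellTwo (G × X)) :=
  (NonUnitalStarAlgebra.adjoin ℂ
    {T | ∃ (f : C₀(X, ℂ)) (g : G), T = monomial f g}).topologicalClosure

open Classical in
variable (G) in
/-- The operator by which the characteristic function of `Y` acts:
`(1_Y ξ)(k, x) = 1_Y (k x) ξ (k, x)`. -/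
def indicatorOp (Y : Set X) : ellTwo (G × X) →L[ℂ] ellTwo (G × X) :=
  weightedComp (fun p => if p.1 • p.2 ∈ Y then 1 else 0) 1
    (fun p => by split_ifs <;> simp) (Equiv.refl _)

theorem star_indicatorOp (Y : Set X) : star (indicatorOp G Y) = indicatorOp G Y :=
  weightedComp_adjoint _ _ _ _ _ fun i => by split_ifs <;> simp

variable (G) in
/-- The reduced C⋆-algebra of the groupoid `{(g, x) | x ∈ Y, g x ∈ Y}`, that is, the corner
`1_Y (C₀(X) ⋊ᵣ G) 1_Y`; since `1_Y` is idempotent (and, `Y` being clopen, a multiplier), it consists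
of the elements `a` of `C₀(X) ⋊ᵣ G` with `1_Y a = a = a 1_Y`. -/
def cornerAlgebra (Y : Set X) :
    NonUnitalStarSubalgebra ℂ (ellTwo (G × X) →L[ℂ] ellTwo (G × X)) where
  carrier := {a | a ∈ reducedCrossedProduct G X ∧ indicatorOp G Y * a = a ∧
    a * indicatorOp G Y = a}
  add_mem' := fun {a b} ha hb => ⟨add_mem ha.1 hb.1, by rw [mul_add, ha.2.1, hb.2.1],
    by rw [add_mul, ha.2.2, hb.2.2]⟩
  zero_mem' := ⟨zero_mem _, mul_zero _, zero_mul _⟩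
  mul_mem' := fun {a b} ha hb => ⟨mul_mem ha.1 hb.1, by rw [← mul_assoc, ha.2.1],
    by rw [mul_assoc, hb.2.2]⟩
  smul_mem' := fun c a ha => ⟨SMulMemClass.smul_mem c ha.1, by rw [mul_smul_comm, ha.2.1],
    by rw [smul_mul_assoc, ha.2.2]⟩
  star_mem' := fun {a} ha => ⟨star_mem ha.1,
    by simpa [star_mul, star_indicatorOp] using congrArg star ha.2.2,
    by simpa [star_mul, star_indicatorOp] using congrArg star ha.2.1⟩

open Classical in
/-- The conditional expectation onto `C₀(X)`, `E(f u_g) = f` if `g = 1` and `0` otherwise, as a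
function on `X`: `E(a)(x)` is the diagonal matrix coefficient of `a` at `(1, x)`. -/
def condExpect (a : ellTwo (G × X) →L[ℂ] ellTwo (G × X)) (x : X) : ℂ :=
  a (lp.single 2 ((1 : G), x) (1 : ℂ)) (1, x)

open Classical in
theorem condExpect_monomial (f : C₀(X, ℂ)) (g : G) (x : X) :
    condExpect (monomial f g) x = if g = 1 then f x else 0 := by
  rw [condExpect, monomial_apply, lp.single_apply]
  by_cases h : g = 1
  · subst h; simp
  · simp [h]

/-! ### The dynamics and KMS states -/

/-- The unitary `(U_t ξ)(k, x) = N(k)^{it} ξ(k, x)`. -/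
def dynUnitaryOp (N : G →* {r : ℝ // 0 < r}) (t : ℝ) :
    ellTwo (G × X) →L[ℂ] ellTwo (G × X) :=
  weightedComp (fun p => ((N p.1 : ℝ) : ℂ) ^ (t * Complex.I)) 1
    (fun p => by rw [Complex.norm_cpow_eq_rpow_re_of_pos (N p.1).2]; simp) (Equiv.refl _)

theorem dynUnitaryOp_mul_neg (N : G →* {r : ℝ // 0 < r}) (t : ℝ) :
    (dynUnitaryOp N t : ellTwo (G × X) →L[ℂ] ellTwo (G × X)) * dynUnitaryOp N (-t) = 1 := by
  ext ξ p
  change ((N p.1 : ℝ) : ℂ) ^ ((t : ℂ) * Complex.I) *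
    (((N p.1 : ℝ) : ℂ) ^ (((-t : ℝ) : ℂ) * Complex.I) * ξ p) = ξ p
  have h : ((N p.1 : ℝ) : ℂ) ≠ 0 := by exact_mod_cast (N p.1).2.ne'
  rw [← mul_assoc, ← Complex.cpow_add _ _ h]
  simp

theorem star_dynUnitaryOp (N : G →* {r : ℝ // 0 < r}) (t : ℝ) :
    star (dynUnitaryOp N t : ellTwo (G × X) →L[ℂ] ellTwo (G × X)) = dynUnitaryOp N (-t) := by
  refine weightedComp_adjoint _ _ _ _ _ fun p => ?_
  have h : Complex.arg ((N p.1 : ℝ) : ℂ) ≠ Real.pi := by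
    rw [Complex.arg_ofReal_of_nonneg (N p.1).2.le]; exact Real.pi_pos.ne
  have := Complex.cpow_conj ((N p.1 : ℝ) : ℂ) ((t : ℂ) * Complex.I) h
  simp only [Complex.conj_ofReal, map_mul, Complex.conj_I] at this
  simp [← this]

/-- `U_t` as an element of the unitary group. -/
def dynUnitary (N : G →* {r : ℝ // 0 < r}) (t : ℝ) :
    unitary (ellTwo (G × X) →L[ℂ] ellTwo (G × X)) :=
  ⟨dynUnitaryOp N t, Unitary.mem_iff.2 ⟨by
    rw [star_dynUnitaryOp]; simpa using dynUnitaryOp_mul_neg (X := X) N (-t),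
    by rw [star_dynUnitaryOp, dynUnitaryOp_mul_neg]⟩⟩

/-- The automorphism `a ↦ U_t a U_t⋆` of the algebra of all bounded operators. -/
def ambientDynamics (N : G →* {r : ℝ // 0 < r}) (t : ℝ) :
    (ellTwo (G × X) →L[ℂ] ellTwo (G × X)) ≃⋆ₐ[ℂ] (ellTwo (G × X) →L[ℂ] ellTwo (G × X)) :=
  Unitary.conjStarAlgAut ℂ _ (dynUnitary N t)

theorem ambientDynamics_apply (N : G →* {r : ℝ // 0 < r}) (t : ℝ)
    (a : ellTwo (G × X) →L[ℂ] ellTwo (G × X)) :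
    ambientDynamics N t a = dynUnitaryOp N t * a * dynUnitaryOp N (-t) := by
  rw [← star_dynUnitaryOp]; rfl

/-- `σ_t(f u_g) = N(g)^{it} f u_g`. -/
theorem ambientDynamics_monomial (N : G →* {r : ℝ // 0 < r}) (t : ℝ) (f : C₀(X, ℂ)) (g : G) :
    ambientDynamics N t (monomial f g) =
      (((N g : ℝ) : ℂ) ^ (t * Complex.I)) • monomial f g := by
  rw [ambientDynamics_apply]
  ext ξ ⟨k, x⟩
  change ((N k : ℝ) : ℂ) ^ ((t : ℂ) * Complex.I) * (f (k • x) *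
    (((N (g⁻¹ * k) : ℝ) : ℂ) ^ (((-t : ℝ) : ℂ) * Complex.I) * ξ (g⁻¹ * k, x))) =
    ((N g : ℝ) : ℂ) ^ ((t : ℂ) * Complex.I) * (f (k • x) * ξ (g⁻¹ * k, x))
  have hk : ((N k : ℝ) : ℂ) = ((N g : ℝ) : ℂ) * ((N (g⁻¹ * k) : ℝ) : ℂ) := by
    rw [← Complex.ofReal_mul]
    congr 1
    have : N k = N g * N (g⁻¹ * k) := by rw [← map_mul]; simp
    rw [this]; rfl
  have h : ((N (g⁻¹ * k) : ℝ) : ℂ) ≠ 0 := by exact_mod_cast (N (g⁻¹ * k)).2.ne'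
  rw [hk, Complex.mul_cpow_ofReal_nonneg (N g).2.le (N (g⁻¹ * k)).2.le]
  have h2 : ((N (g⁻¹ * k) : ℝ) : ℂ) ^ ((t : ℂ) * Complex.I) *
      ((N (g⁻¹ * k) : ℝ) : ℂ) ^ (((-t : ℝ) : ℂ) * Complex.I) = 1 := by
    rw [← Complex.cpow_add _ _ h]; simp
  linear_combination (((N g : ℝ) : ℂ) ^ ((t : ℂ) * Complex.I) * f (k • x) * ξ (g⁻¹ * k, x)) * h2

theorem dynUnitaryOp_comm_indicatorOp (N : G →* {r : ℝ // 0 < r}) (t : ℝ) (Y : Set X) :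
    dynUnitaryOp N t * indicatorOp G Y = indicatorOp G Y * dynUnitaryOp N t := by
  ext ξ p
  exact mul_left_comm _ _ _

theorem ambientDynamics_mem (N : G →* {r : ℝ // 0 < r}) (t : ℝ) {Y : Set X}
    {a : ellTwo (G × X) →L[ℂ] ellTwo (G × X)} (ha : a ∈ cornerAlgebra G Y) :
    ambientDynamics N t a ∈ cornerAlgebra G Y := by
  obtain ⟨h0, h1, h2⟩ := ha
  refine ⟨?_, ?_, ?_⟩
  · have hle : reducedCrossedProduct G X ≤
        (reducedCrossedProduct G X).comap (ambientDynamics (X := X) N t) := by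
      refine NonUnitalStarSubalgebra.topologicalClosure_minimal _
        (NonUnitalStarAlgebra.adjoin_le ?_) ?_
      · rintro _ ⟨f, g, rfl⟩
        change ambientDynamics N t (monomial f g) ∈ reducedCrossedProduct G X
        rw [ambientDynamics_monomial]
        exact SMulMemClass.smul_mem _ (NonUnitalStarSubalgebra.le_topologicalClosure _
          (NonUnitalStarAlgebra.subset_adjoin ℂ _ ⟨f, g, rfl⟩))
      · have hc : Continuous fun b : ellTwo (G × X) →L[ℂ] ellTwo (G × X) =>
            ambientDynamics N t b := by
          simp only [ambientDynamics_apply]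
          fun_prop
        exact (NonUnitalStarSubalgebra.isClosed_topologicalClosure _).preimage hc
    exact hle h0
  · rw [ambientDynamics_apply, ← mul_assoc, ← mul_assoc, ← dynUnitaryOp_comm_indicatorOp,
      mul_assoc _ _ a, h1]
  · rw [ambientDynamics_apply, mul_assoc, dynUnitaryOp_comm_indicatorOp, ← mul_assoc,
      mul_assoc _ a, h2]

theorem isClosed_cornerAlgebra (Y : Set X) :
    IsClosed (cornerAlgebra G Y : Set (ellTwo (G × X) →L[ℂ] ellTwo (G × X))) := by
  refine (NonUnitalStarSubalgebra.isClosed_topologicalClosure _).inter (IsClosed.inter ?_ ?_)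
  · exact isClosed_eq (by fun_prop) continuous_id
  · exact isClosed_eq (by fun_prop) continuous_id

variable (G) in
/-- The C⋆-algebra `C⋆ᵣ(G ⊠ Y) = 1_Y (C₀(X) ⋊ᵣ G) 1_Y` as a type; for `a` in it, `a.1` is the
underlying operator on `ℓ²(G × X)`. -/
def GroupoidAlgebra (Y : Set X) : Type _ := cornerAlgebra G Y

instance (Y : Set X) : NonUnitalCStarAlgebra (GroupoidAlgebra G Y) :=
  NonUnitalStarSubalgebra.nonUnitalCStarAlgebra (cornerAlgebra G Y)
    (h_closed := isClosed_cornerAlgebra Y)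

/-- The dynamics `σ` on `C⋆ᵣ(G ⊠ Y)`, determined by `σ_t(f)(g, x) = N(g)^{it} f(g, x)`. -/
def dynamics (N : G →* {r : ℝ // 0 < r}) (Y : Set X) (t : ℝ) (a : GroupoidAlgebra G Y) :
    GroupoidAlgebra G Y :=
  ⟨ambientDynamics N t a.1, ambientDynamics_mem N t a.2⟩

/-- A state of a (not necessarily unital) C⋆-algebra: a positive linear functional of norm one. -/
def IsState {A : Type*} [NonUnitalCStarAlgebra A] (φ : A →L[ℂ] ℂ) : Prop :=
  ‖φ‖ = 1 ∧ ∀ a, 0 ≤ (φ (star a * a)).re ∧ (φ (star a * a)).im = 0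

/-- `F` is an entire extension of the orbit `t ↦ σ_t(a)`. The element `a` is `σ`-analytic if it has
one; it is then unique, and `F z = σ_z(a)`. -/
def IsEntireOrbit (N : G →* {r : ℝ // 0 < r}) {Y : Set X} (a : GroupoidAlgebra G Y)
    (F : ℂ → GroupoidAlgebra G Y) : Prop :=
  Differentiable ℂ F ∧ ∀ t : ℝ, F t = dynamics N Y t a

/-- `σ`-KMS`_β`-states: `σ`-invariant states `φ` with `φ(ab) = φ(b σ_{iβ}(a))` for all `a`, `b` in a
set of `σ`-analytic elements with dense linear span. -/
def IsKMSState (N : G →* {r : ℝ // 0 < r}) (β : ℝ) {Y : Set X}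
    (φ : GroupoidAlgebra G Y →L[ℂ] ℂ) : Prop :=
  IsState φ ∧ (∀ (t : ℝ) (a : GroupoidAlgebra G Y), φ (dynamics N Y t a) = φ a) ∧
    ∃ D : Set (GroupoidAlgebra G Y), Dense (Submodule.span ℂ D : Set (GroupoidAlgebra G Y)) ∧
      ∀ a ∈ D, ∃ F : ℂ → GroupoidAlgebra G Y, IsEntireOrbit N a F ∧
        ∀ b ∈ D, φ (a * b) = φ (b * F (β * Complex.I))

/-- The set of `σ`-KMS`_β`-states on `C⋆ᵣ(G ⊠ Y)`. -/
abbrev KMSState (N : G →* {r : ℝ // 0 < r}) (β : ℝ) (Y : Set X) : Type _ :=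
  {φ : GroupoidAlgebra G Y →L[ℂ] ℂ // IsKMSState N β φ}

/-- `φ = (μ_* ∘ E)` on `C⋆ᵣ(G ⊠ Y)`: `φ(a) = ∫_Y E(a) dμ` for all `a`. -/
def IsRepresentedBy [MeasurableSpace X] {Y : Set X} (φ : GroupoidAlgebra G Y →L[ℂ] ℂ)
    (μ : Measure X) : Prop :=
  ∀ a : GroupoidAlgebra G Y, φ a = ∫ x in Y, condExpect a.1 x ∂μ

end Algebra

/-! ### Measures -/

section Measures

variable {G X : Type*} [Group G] [TopologicalSpace X] [MulAction G X]

/-- `ζ_S(β) = ∑_{s ∈ S} N(s)^{-β}`, with values in `[0, ∞]`. -/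
def zeta (N : G →* {r : ℝ // 0 < r}) (S : Set G) (β : ℝ) : ℝ≥0∞ :=
  ∑' s : S, ENNReal.ofReal ((N s : ℝ) ^ (-β))

/-- Radon measures `μ` on `X` with `μ(Y) = 1` and `μ(gZ) = N(g)^{-β} μ(Z)` for Borel `Z`. -/
def IsScalingMeasure [MeasurableSpace X] (N : G →* {r : ℝ // 0 < r}) (β : ℝ) (Y : Set X)
    (μ : Measure X) : Prop :=
  μ.Regular ∧ μ Y = 1 ∧ ∀ (g : G) (Z : Set X), MeasurableSet Z →
    μ (g • Z) = ENNReal.ofReal ((N g : ℝ) ^ (-β)) * μ Z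

/-- The map `y ↦ s y` from `Y₀` to `Y`, for `s ∈ S`, when `S Y₀ ⊆ Y`. -/
def orbitMap {S : Set G} {Y₀ Y : Set X} (h : S • Y₀ ⊆ Y) (s : S) (y : Y₀) : Y :=
  ⟨(s : G) • (y : X), h (smul_mem_smul s.2 y.2)⟩

/-- The measure `Z ↦ ζ_S(β)⁻¹ ∑_{s ∈ S} N(s)^{-β} ν(s⁻¹ Z ∩ Y₀)` on `Y`; the set `s⁻¹ Z ∩ Y₀` is
the preimage of `Z` under `y ↦ s y`. -/
def extendMeasure [MeasurableSpace X] (N : G →* {r : ℝ // 0 < r}) (β : ℝ) {S : Set G}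
    {Y₀ Y : Set X} (h : S • Y₀ ⊆ Y) (ν : Measure Y₀) : Measure Y :=
  (zeta N S β)⁻¹ • Measure.sum fun s : S =>
    ENNReal.ofReal ((N s : ℝ) ^ (-β)) • ν.map (orbitMap h s)

theorem extendMeasure_apply [MeasurableSpace X] [BorelSpace X] [ContinuousConstSMul G X]
    (N : G →* {r : ℝ // 0 < r}) (β : ℝ) {S : Set G}
    {Y₀ Y : Set X} (h : S • Y₀ ⊆ Y) (ν : Measure Y₀) {Z : Set Y} (hZ : MeasurableSet Z) :
    extendMeasure N β h ν Z = (zeta N S β)⁻¹ * ∑' s : S, ENNReal.ofReal ((N s : ℝ) ^ (-β)) *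
      ν {y : Y₀ | orbitMap h s y ∈ Z} := by
  have hm : ∀ s : S, Measurable (orbitMap h s) := fun s =>
    ((continuous_subtype_val.const_smul (s : G)).subtype_mk _).measurable
  simp only [extendMeasure, Measure.smul_apply, Measure.sum_apply _ hZ, Measure.map_apply (hm _) hZ,
    smul_eq_mul]
  rfl

/-- The subspace `H_S` of `L²(Y, μ)` of (classes of) functions `f` such that `f(s y) = f(y)` for
`y ∈ Y₀` and `s ∈ S`. -/
def invariantSubspace [MeasurableSpace X] {S : Set G} {Y₀ Y : Set X} (h : S • Y₀ ⊆ Y)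
    (h₀ : Y₀ ⊆ Y) (μ : Measure Y) : Submodule ℂ (Lp ℂ 2 μ) where
  carrier := {f | ∃ f' : Y → ℂ, f =ᵐ[μ] f' ∧
    ∀ (s : S) (y : Y₀), f' (orbitMap h s y) = f' (inclusion h₀ y)}
  add_mem' := by
    rintro f g ⟨f', hf, hf'⟩ ⟨g', hg, hg'⟩
    refine ⟨f' + g', (Lp.coeFn_add f g).trans (hf.add hg), fun s y => ?_⟩
    simp [hf', hg']
  zero_mem' := ⟨0, Lp.coeFn_zero _ _ _, fun _ _ => rfl⟩
  smul_mem' := by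
    rintro c f ⟨f', hf, hf'⟩
    refine ⟨c • f', (Lp.coeFn_smul c f).trans (hf.const_smul c), fun s y => ?_⟩
    simp [hf']

end Measures

end PhaseTransition

end

open PhaseTransition

/-!
Why the classification holds. Write `f u_g` for the monomials of `C⋆ᵣ(G ⊠ Y)`, with `f` supported in
`Y ∩ gY`; those with `f` of compact support span a dense subspace (`dense_span_compactMonomials`).

*From a KMS state to a measure.* The set of analytic elements in the definition of a KMS state `φ`
need not contain the monomials, but these are eigenvectors of the dynamics, and for an eigenvector
the KMS condition follows by approximation: for a nearby analytic `a` the function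
`z ↦ φ(b σ_z(a))`, corrected by the eigenvalue, is nearly constant on both boundary lines of a strip, and
Cauchy's theorem for long rectangles shows that the two constants nearly agree
(`IsKMSState.map_mul_eigenvector`). By the Riesz theorem `φ(f u_e) = ∫ f dm` for a finite measure
`m` on `Y` (`exists_measure_of_positive`), and the KMS condition for `b = r u_{g⁻¹}` and
`a = (r ∘ g⁻¹) u_g` says that `m (g Z) = N(g)^{-β} m Z` as long as `Z` and `g Z` lie in `Y`
(`IsKMSState.measure_smul`). As `N(g_n)^{-β} ≠ 1`, the invariant sets `Y_n`, and with them all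
points with nontrivial isotropy, are null. The elements `f u_e` lie in the centralizer of `φ`, so
`φ(f w u_g) = φ(f (w ∘ g⁻¹) u_g)` for continuous `w`; since `m`-almost no point is fixed by `g ≠ e`,
the Cauchy–Schwarz inequality and dominated convergence give `φ(f u_g) = 0`
(`IsKMSState.map_cornerMonomial_eq_zero`). Thus `φ = m_* ∘ E`.

*From the measure to `Y₀`.* Outer regularity, the covering hypothesis on `S U` and `ζ_S(β) < ∞` show
that `m` is concentrated on `S Y₀` (`measure_diff_smul_eq_zero`). The translates `s Y₀` are
disjoint, so scaling forces `m` to be the extension of `ζ_S(β) m|_{Y₀}` (`map_extendMeasure_comap`).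
Conversely, the extension of a probability measure `ν` on `Y₀` is the restriction to `Y` of
`ζ_S(β)⁻¹ ∑_{g ∈ G} N(g)^{-β} g_* ν`, a Radon measure on `X` that scales by `N^{-β}`
(`isScalingMeasure_globalMeasure`), and such a measure defines a KMS state
(`IsScalingMeasure.isKMSState`).

*The invariant functions.* The extension `μ` of `ν` is the image of the product of `ν` with the
probability measure on `S` of weights `ζ_S(β)⁻¹ N(s)^{-β}` under the injection `(y, s) ↦ s y`
(`extendMeasure_eq_map_prod`). In these coordinates the elements of `H_S` are the functions of `y`
alone, so the projection onto `H_S` is integration over `s` (`exists_projection_invariantSubspace`).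
-/

namespace PhaseTransition

/-- Functions of compact support are dense in `C₀(X)`; the approximation does not enlarge the
set where the function is nonzero. -/
theorem exists_hasCompactSupport_norm_sub_le {X : Type*} [TopologicalSpace X]
    [LocallyCompactSpace X] [T2Space X] (f : C₀(X, ℂ)) {ε : ℝ} (hε : 0 < ε) :
    ∃ f' : C₀(X, ℂ), HasCompactSupport f' ∧ ‖f - f'‖ ≤ ε ∧ ∀ x, f' x ≠ 0 → f x ≠ 0 := by
  have h := (zero_at_infty f).norm
  rw [norm_zero] at h
  obtain ⟨K, hK, hKf⟩ := Filter.mem_cocompact.1 (h (Iio_mem_nhds hε))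
  obtain ⟨e, he1, -, hec, he01⟩ := exists_continuous_one_zero_of_isCompact hK isClosed_empty
    (disjoint_empty _)
  have hs : HasCompactSupport fun x => f x * (e x : ℂ) :=
    HasCompactSupport.mul_left (hec.comp_left (g := fun r : ℝ => (r : ℂ)) Complex.ofReal_zero)
  refine ⟨⟨⟨fun x => f x * (e x : ℂ), by fun_prop⟩, hs.is_zero_at_infty⟩, hs, ?_, ?_⟩
  · rw [← ZeroAtInftyContinuousMap.norm_toBCF_eq_norm]
    refine (BoundedContinuousFunction.norm_le hε.le).2 fun x => ?_
    change ‖f x - f x * (e x : ℂ)‖ ≤ ε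
    by_cases hx : x ∈ K
    · simp [he1 hx, hε.le]
    · have h1 : ‖f x‖ < ε := hKf hx
      have h2 : ‖(1 : ℂ) - (e x : ℂ)‖ ≤ 1 := by
        rw [← Complex.ofReal_one, ← Complex.ofReal_sub, Complex.norm_real, Real.norm_eq_abs,
          abs_le]
        constructor <;> linarith [(he01 x).1, (he01 x).2]
      calc ‖f x - f x * (e x : ℂ)‖ = ‖f x‖ * ‖(1 : ℂ) - (e x : ℂ)‖ := by
            rw [← norm_mul, mul_sub, mul_one]
        _ ≤ ε * 1 := by gcongr
        _ = ε := mul_one _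
  · intro x hx h0
    apply hx
    change f x * _ = 0
    rw [h0, zero_mul]

/-! ### Monomials in the crossed product and in its corner -/

section Corner

variable {G X : Type*} [Group G] [TopologicalSpace X] [MulAction G X]

theorem norm_monomial_le (f : C₀(X, ℂ)) (g : G) : ‖monomial f g‖ ≤ ‖f‖ := by
  unfold monomial weightedComp
  exact (LinearMap.mkContinuous_norm_le _ (abs_nonneg _) _).trans (abs_of_nonneg (norm_nonneg f)).le

theorem monomial_add (f f' : C₀(X, ℂ)) (g : G) :
    monomial (f + f') g = monomial f g + monomial f' g := by
  ext ξ ⟨k, x⟩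
  change (f (k • x) + f' (k • x)) * ξ (g⁻¹ * k, x) =
    f (k • x) * ξ (g⁻¹ * k, x) + f' (k • x) * ξ (g⁻¹ * k, x)
  ring

theorem monomial_smul (c : ℂ) (f : C₀(X, ℂ)) (g : G) :
    monomial (c • f) g = c • monomial f g := by
  ext ξ ⟨k, x⟩
  change (c * f (k • x)) * ξ (g⁻¹ * k, x) = c * (f (k • x) * ξ (g⁻¹ * k, x))
  ring

/-- The translate `x ↦ f (g⁻¹ x)` of a function vanishing at infinity. -/
noncomputable def translate [ContinuousConstSMul G X] (g : G) (f : C₀(X, ℂ)) : C₀(X, ℂ) where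
  toFun x := f (g⁻¹ • x)
  continuous_toFun := f.continuous.comp (continuous_const_smul _)
  zero_at_infty' :=
    (zero_at_infty f).comp (Homeomorph.smul g⁻¹).isClosedEmbedding.tendsto_cocompact

@[simp] theorem translate_apply [ContinuousConstSMul G X] (g : G) (f : C₀(X, ℂ)) (x : X) :
    translate g f x = f (g⁻¹ • x) := rfl

/-- The product of a function vanishing at infinity with the characteristic function of a clopen
set. -/
noncomputable def cutoff {W : Set X} (hW : IsClopen W) (f : C₀(X, ℂ)) : C₀(X, ℂ) where
  toFun x := W.indicator f x
  continuous_toFun := by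
    refine f.continuous.indicator fun x hx => ?_
    simp [hW.frontier_eq] at hx
  zero_at_infty' := by
    refine squeeze_zero_norm (fun x => norm_indicator_le_norm_self f x) ?_
    simpa using (zero_at_infty f).norm

theorem monomial_mul [ContinuousConstSMul G X] (f f' : C₀(X, ℂ)) (g g' : G) :
    monomial f g * monomial f' g' = monomial (f * translate g f') (g * g') := by
  ext ξ ⟨k, x⟩
  change f (k • x) * (f' ((g⁻¹ * k) • x) * ξ (g'⁻¹ * (g⁻¹ * k), x)) =
    (f (k • x) * f' (g⁻¹ • k • x)) * ξ ((g * g')⁻¹ * k, x)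
  rw [mul_smul, mul_inv_rev, mul_assoc, mul_assoc]

theorem star_monomial [ContinuousConstSMul G X] (f : C₀(X, ℂ)) (g : G) :
    star (monomial f g) = monomial (star (translate g⁻¹ f)) g⁻¹ := by
  rw [ContinuousLinearMap.star_eq_adjoint]
  refine ((ContinuousLinearMap.eq_adjoint_iff _ _).2 fun ξ η => ?_).symm
  rw [lp.inner_eq_tsum, lp.inner_eq_tsum,
    ← ((Equiv.mulLeft g⁻¹).prodCongr (Equiv.refl X)).tsum_eq]
  refine tsum_congr fun ⟨k, x⟩ => ?_
  change inner ℂ ((starRingEnd ℂ) (f (g⁻¹⁻¹ • (g⁻¹ * k) • x)) * ξ (g⁻¹⁻¹ * (g⁻¹ * k), x))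
    (η (g⁻¹ * k, x)) = inner ℂ (ξ (k, x)) (f (k • x) * η (g⁻¹ * k, x))
  simp [← mul_smul]
  ring

/-- `f` is supported in `Y ∩ gY`, so that `f u_g` lies in the corner defined by `Y`. -/
def SupportedInCorner (Y : Set X) (g : G) (f : X → ℂ) : Prop :=
  ∀ x, f x ≠ 0 → x ∈ Y ∧ g⁻¹ • x ∈ Y

open Classical in
theorem indicatorOp_mul_monomial_mul [ContinuousConstSMul G X] {Y : Set X} (hY : IsClopen Y)
    (f : C₀(X, ℂ)) (g : G) :
    indicatorOp G Y * monomial f g * indicatorOp G Y =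
      monomial (cutoff (hY.inter (hY.preimage (continuous_const_smul g⁻¹))) f) g := by
  ext ξ ⟨k, x⟩
  change (if k • x ∈ Y then (1 : ℂ) else 0) * (f (k • x) *
    ((if (g⁻¹ * k) • x ∈ Y then (1 : ℂ) else 0) * ξ (g⁻¹ * k, x))) =
    (Y ∩ (fun x => g⁻¹ • x) ⁻¹' Y).indicator f (k • x) * ξ (g⁻¹ * k, x)
  by_cases h1 : k • x ∈ Y <;> by_cases h2 : (g⁻¹ * k) • x ∈ Y <;>
    simp [h1, h2, indicator, ← mul_smul]

open Classical in
theorem monomial_mem_cornerAlgebra {Y : Set X} {f : C₀(X, ℂ)} {g : G}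
    (h : SupportedInCorner Y g f) : monomial f g ∈ cornerAlgebra G Y := by
  refine ⟨NonUnitalStarSubalgebra.le_topologicalClosure _
    (NonUnitalStarAlgebra.subset_adjoin ℂ _ ⟨f, g, rfl⟩), ?_, ?_⟩
  · ext ξ ⟨k, x⟩
    change (if k • x ∈ Y then (1 : ℂ) else 0) * (f (k • x) * ξ (g⁻¹ * k, x)) =
      f (k • x) * ξ (g⁻¹ * k, x)
    by_cases hf : f (k • x) = 0
    · simp [hf]
    · simp [(h _ hf).1]
  · ext ξ ⟨k, x⟩
    change f (k • x) * ((if (g⁻¹ * k) • x ∈ Y then (1 : ℂ) else 0) * ξ (g⁻¹ * k, x)) =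
      f (k • x) * ξ (g⁻¹ * k, x)
    by_cases hf : f (k • x) = 0
    · simp [hf]
    · have := (h _ hf).2
      rw [← mul_smul] at this
      simp [this]

/-- The element `f u_g` of `C⋆ᵣ(G ⊠ Y)`, for `f` supported in `Y ∩ gY`. -/
noncomputable def cornerMonomial {Y : Set X} (f : C₀(X, ℂ)) (g : G) (h : SupportedInCorner Y g f) :
    GroupoidAlgebra G Y :=
  ⟨monomial f g, monomial_mem_cornerAlgebra h⟩

variable (G) in
/-- The inclusion of `C⋆ᵣ(G ⊠ Y)` into the bounded operators on `ℓ²(G × X)`. -/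
noncomputable def inclusionL (Y : Set X) :
    GroupoidAlgebra G Y →L[ℂ] (ellTwo (G × X) →L[ℂ] ellTwo (G × X)) :=
  LinearMap.mkContinuous
    { toFun := fun a => a.1
      map_add' := fun _ _ => rfl
      map_smul' := fun _ _ => rfl } 1 fun a => (one_mul ‖a‖).ge

theorem GroupoidAlgebra.ext {Y : Set X} {a b : GroupoidAlgebra G Y} (h : a.1 = b.1) : a = b :=
  Subtype.ext h

theorem isometry_inclusionL (Y : Set X) : Isometry (inclusionL G (X := X) Y) :=
  fun _ _ => rfl

variable (G) in
/-- The elements `f u_g` of `C⋆ᵣ(G ⊠ Y)` with `f` of compact support. -/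
def compactMonomials (Y : Set X) : Set (GroupoidAlgebra G Y) :=
  {a | ∃ (f : C₀(X, ℂ)) (g : G) (h : SupportedInCorner Y g f),
    HasCompactSupport f ∧ a = cornerMonomial f g h}

theorem adjoin_monomials_le_span [ContinuousConstSMul G X]
    {T : ellTwo (G × X) →L[ℂ] ellTwo (G × X)}
    (hT : T ∈ NonUnitalStarAlgebra.adjoin ℂ
      {T | ∃ (f : C₀(X, ℂ)) (g : G), T = monomial f g}) :
    T ∈ Submodule.span ℂ {T | ∃ (f : C₀(X, ℂ)) (g : G), T = monomial f g} := by
  induction hT using NonUnitalStarAlgebra.adjoin_induction with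
  | mem x hx => exact Submodule.subset_span hx
  | add x y _ _ hx hy => exact add_mem hx hy
  | zero => exact zero_mem _
  | mul x y _ _ hx hy =>
    refine Submodule.span_induction₂ (p := fun x y _ _ => x * y ∈ Submodule.span ℂ _)
      ?_ ?_ ?_ ?_ ?_ ?_ ?_ hx hy
    · rintro _ _ ⟨f, g, rfl⟩ ⟨f', g', rfl⟩
      rw [monomial_mul]
      exact Submodule.subset_span ⟨_, _, rfl⟩
    · intro y _; simp
    · intro x _; simp
    · intro x y z _ _ _ h1 h2; rw [add_mul]; exact add_mem h1 h2
    · intro x y z _ _ _ h1 h2; rw [mul_add]; exact add_mem h1 h2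
    · intro r x y _ _ h; rw [smul_mul_assoc]; exact Submodule.smul_mem _ _ h
    · intro r x y _ _ h; rw [mul_smul_comm]; exact Submodule.smul_mem _ _ h
  | smul r x _ hx => exact Submodule.smul_mem _ _ hx
  | star x _ hx =>
    refine Submodule.span_induction (p := fun x _ => star x ∈ Submodule.span ℂ _) ?_ ?_ ?_ ?_ hx
    · rintro _ ⟨f, g, rfl⟩
      rw [star_monomial]
      exact Submodule.subset_span ⟨_, _, rfl⟩
    · simp
    · intro x y _ _ h1 h2; rw [star_add]; exact add_mem h1 h2
    · intro r x _ h; rw [star_smul]; exact Submodule.smul_mem _ _ h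

theorem dense_span_compactMonomials [ContinuousConstSMul G X] [LocallyCompactSpace X] [T2Space X]
    {Y : Set X} (hY : IsClopen Y) :
    Dense (Submodule.span ℂ (compactMonomials G Y) : Set (GroupoidAlgebra G Y)) := by
  set V := ((Submodule.span ℂ (compactMonomials G Y)).map (inclusionL G Y).toLinearMap)
    with hV
  have hcm : ∀ (f : C₀(X, ℂ)) (g : G), SupportedInCorner Y g f →
      monomial f g ∈ V.topologicalClosure := by
    intro f g h
    refine Metric.mem_closure_iff.2 fun ε hε => ?_
    obtain ⟨f', hf'c, hf', hf'0⟩ := exists_hasCompactSupport_norm_sub_le f (half_pos hε)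
    have h' : SupportedInCorner Y g f' := fun x hx => h x (hf'0 x hx)
    refine ⟨monomial f' g, ⟨cornerMonomial f' g h', Submodule.subset_span ⟨f', g, h', hf'c, rfl⟩,
      rfl⟩, ?_⟩
    have : monomial f g - monomial f' g = monomial (f - f') g := by
      rw [sub_eq_iff_eq_add, ← monomial_add, sub_add_cancel]
    rw [dist_eq_norm, this]
    exact ((norm_monomial_le _ _).trans hf').trans_lt (half_lt_self hε)
  have hspan : ∀ T ∈ Submodule.span ℂ {T | ∃ (f : C₀(X, ℂ)) (g : G), T = monomial f g},
      indicatorOp G Y * T * indicatorOp G Y ∈ V.topologicalClosure := by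
    intro T hT
    induction hT using Submodule.span_induction with
    | mem x hx =>
      obtain ⟨f, g, rfl⟩ := hx
      rw [indicatorOp_mul_monomial_mul hY]
      refine hcm _ _ fun x hx => ?_
      exact mem_of_indicator_ne_zero (s := Y ∩ (fun x => g⁻¹ • x) ⁻¹' Y) (f := f) hx
    | zero => simp
    | add x y _ _ h1 h2 => rw [mul_add, add_mul]; exact add_mem h1 h2
    | smul r x _ h => rw [mul_smul_comm, smul_mul_assoc]; exact Submodule.smul_mem _ _ h
  intro a
  rw [(isometry_inclusionL Y).isEmbedding.isInducing.closure_eq_preimage_closure_image]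
  change a.1 ∈ (V.topologicalClosure : Set _)
  have ha : indicatorOp G Y * a.1 * indicatorOp G Y = a.1 := by rw [a.2.2.1, a.2.2.2]
  rw [← ha]
  have hcl : IsClosed {T : ellTwo (G × X) →L[ℂ] ellTwo (G × X) |
      indicatorOp G Y * T * indicatorOp G Y ∈ V.topologicalClosure} :=
    V.isClosed_topologicalClosure.preimage
      (f := fun T => indicatorOp G Y * T * indicatorOp G Y) (by fun_prop)
  refine closure_minimal (fun T hT => hspan T ?_) hcl a.2.1
  exact adjoin_monomials_le_span hT

end Corner

/-! ### Entire functions -/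

section Analytic

open Filter Topology

/-- An entire function with values in a Banach space is determined by its values on the real
line. -/
theorem eq_of_differentiable_of_eq_ofReal {E : Type*} [NormedAddCommGroup E] [NormedSpace ℂ E]
    [CompleteSpace E] {F H : ℂ → E} (hF : Differentiable ℂ F) (hH : Differentiable ℂ H)
    (h : ∀ t : ℝ, F t = H t) : F = H := by
  have aF : AnalyticOnNhd ℂ F univ := hF.differentiableOn.analyticOnNhd isOpen_univ
  have aH : AnalyticOnNhd ℂ H univ := hH.differentiableOn.analyticOnNhd isOpen_univ
  refine aF.eq_of_frequently_eq (z₀ := 0) aH ?_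
  have ht : Tendsto (fun t : ℝ => (t : ℂ)) (𝓝[≠] 0) (𝓝[≠] 0) := by
    refine tendsto_nhdsWithin_iff.2 ⟨?_, ?_⟩
    · exact (Complex.continuous_ofReal.tendsto' 0 0 Complex.ofReal_zero).mono_left
        nhdsWithin_le_nhds
    · filter_upwards [self_mem_nhdsWithin] with t ht
      simpa using ht
  exact ht.frequently (Eventually.of_forall (fun t => h t) : ∀ᶠ t : ℝ in 𝓝[≠] 0, _).frequently

/-- If an entire function is bounded on a horizontal strip and nearly constant on each of the two
boundary lines, then the two constants are nearly equal: the averages over long segments of the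
boundary lines differ by little, by Cauchy's theorem for rectangles. -/
theorem norm_sub_le_of_strip {f : ℂ → ℂ} (hf : Differentiable ℂ f) {β ε M : ℝ} {c₀ c₁ : ℂ}
    (h₀ : ∀ t : ℝ, ‖f t - c₀‖ ≤ ε) (h₁ : ∀ t : ℝ, ‖f (t + β * Complex.I) - c₁‖ ≤ ε)
    (hM : ∀ t : ℝ, ∀ s ∈ uIcc 0 β, ‖f (t + s * Complex.I)‖ ≤ M) :
    ‖c₀ - c₁‖ ≤ 2 * ε := by
  have key : ∀ T : ℝ, 0 < T → ‖c₀ - c₁‖ ≤ 2 * ε + 2 * M * |β| / T := by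
    intro T hT
    have hC := Complex.integral_boundary_rect_eq_zero_of_differentiableOn f 0 (T + β * Complex.I)
      hf.differentiableOn
    simp only [Complex.zero_re, Complex.zero_im, Complex.add_re, Complex.ofReal_re, Complex.mul_re,
      Complex.I_re, mul_zero, Complex.ofReal_im, Complex.I_im, mul_one, sub_self, add_zero,
      Complex.add_im, Complex.mul_im, zero_add, Complex.ofReal_zero, zero_mul, smul_eq_mul] at hC
    have i0 : IntervalIntegrable (fun x : ℝ => f x) volume 0 T :=
      (hf.continuous.comp Complex.continuous_ofReal).intervalIntegrable _ _
    have i1 : IntervalIntegrable (fun x : ℝ => f (x + β * Complex.I)) volume 0 T :=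
      (hf.continuous.comp (by fun_prop : Continuous fun x : ℝ => (x : ℂ) + β * Complex.I)
        ).intervalIntegrable _ _
    have b0 : ‖∫ x in (0 : ℝ)..T, (f x - c₀)‖ ≤ ε * |T - 0| :=
      intervalIntegral.norm_integral_le_of_norm_le_const fun x _ => h₀ x
    have b1 : ‖∫ x in (0 : ℝ)..T, (f (x + β * Complex.I) - c₁)‖ ≤ ε * |T - 0| :=
      intervalIntegral.norm_integral_le_of_norm_le_const fun x _ => h₁ x
    have s0 : ‖∫ y in (0 : ℝ)..β, f (y * Complex.I)‖ ≤ M * |β - 0| :=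
      intervalIntegral.norm_integral_le_of_norm_le_const fun y hy => by
        simpa using hM 0 y (uIoc_subset_uIcc hy)
    have s1 : ‖∫ y in (0 : ℝ)..β, f (T + y * Complex.I)‖ ≤ M * |β - 0| :=
      intervalIntegral.norm_integral_le_of_norm_le_const fun y hy =>
        hM T y (uIoc_subset_uIcc hy)
    rw [intervalIntegral.integral_sub i0 intervalIntegrable_const,
      intervalIntegral.integral_const] at b0
    rw [intervalIntegral.integral_sub i1 intervalIntegrable_const,
      intervalIntegral.integral_const] at b1
    simp only [sub_zero, abs_of_pos hT, Complex.real_smul] at b0 b1 s0 s1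
    set A := ∫ x in (0 : ℝ)..T, f x
    set B := ∫ x in (0 : ℝ)..T, f (x + β * Complex.I)
    set C := ∫ y in (0 : ℝ)..β, f (y * Complex.I)
    set D := ∫ y in (0 : ℝ)..β, f (T + y * Complex.I)
    have e : (T : ℂ) * (c₀ - c₁) =
        (B - T * c₁) - (A - T * c₀) - (Complex.I * D - Complex.I * C) := by
      linear_combination hC
    have hn : T * ‖c₀ - c₁‖ ≤ 2 * ε * T + 2 * M * |β| := by
      calc T * ‖c₀ - c₁‖ = ‖(T : ℂ) * (c₀ - c₁)‖ := by
            rw [norm_mul, Complex.norm_real, Real.norm_of_nonneg hT.le]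
        _ ≤ (‖B - T * c₁‖ + ‖A - T * c₀‖) + (‖Complex.I * D‖ + ‖Complex.I * C‖) := by
            rw [e]
            exact (norm_sub_le _ _).trans (add_le_add (norm_sub_le _ _) (norm_sub_le _ _))
        _ ≤ (ε * T + ε * T) + (M * |β| + M * |β|) := by
            have n1 : ‖Complex.I * D‖ = ‖D‖ := by simp
            have n2 : ‖Complex.I * C‖ = ‖C‖ := by simp
            rw [n1, n2]
            gcongr
        _ = _ := by ring
    rw [← sub_nonneg] at hn ⊢
    have : 2 * ε + 2 * M * |β| / T - ‖c₀ - c₁‖ =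
        (2 * ε * T + 2 * M * |β| - T * ‖c₀ - c₁‖) / T := by
      field_simp
    rw [this]
    positivity
  have hlim : Tendsto (fun T : ℝ => 2 * ε + 2 * M * |β| / T) atTop (𝓝 (2 * ε + 0)) :=
    tendsto_const_nhds.add (tendsto_const_nhds.div_atTop tendsto_id)
  rw [add_zero] at hlim
  exact ge_of_tendsto hlim ((eventually_gt_atTop 0).mono key)

end Analytic

/-! ### The dynamics and the KMS condition for eigenvectors -/

section Unitary

variable {G X : Type*} [Group G] (N : G →* {r : ℝ // 0 < r})

theorem norm_dynUnitaryOp_le (t : ℝ) :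
    ‖(dynUnitaryOp N t : ellTwo (G × X) →L[ℂ] ellTwo (G × X))‖ ≤ 1 := by
  unfold dynUnitaryOp weightedComp
  exact (LinearMap.mkContinuous_norm_le _ (abs_nonneg _) _).trans abs_one.le

theorem dynUnitaryOp_mul (s t : ℝ) :
    (dynUnitaryOp N s : ellTwo (G × X) →L[ℂ] ellTwo (G × X)) * dynUnitaryOp N t =
      dynUnitaryOp N (s + t) := by
  ext ξ p
  change ((N p.1 : ℝ) : ℂ) ^ ((s : ℂ) * Complex.I) *
    (((N p.1 : ℝ) : ℂ) ^ ((t : ℂ) * Complex.I) * ξ p) =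
    ((N p.1 : ℝ) : ℂ) ^ (((s + t : ℝ) : ℂ) * Complex.I) * ξ p
  have h : ((N p.1 : ℝ) : ℂ) ≠ 0 := by exact_mod_cast (N p.1).2.ne'
  rw [← mul_assoc, ← Complex.cpow_add _ _ h]
  push_cast
  rw [add_mul]

end Unitary

section Dynamics

variable {G X : Type*} [Group G] [TopologicalSpace X] [MulAction G X]
  (N : G →* {r : ℝ // 0 < r}) {Y : Set X}

theorem norm_dynamics_le (t : ℝ) (a : GroupoidAlgebra G Y) : ‖dynamics N Y t a‖ ≤ ‖a‖ := by
  change ‖ambientDynamics N t a.1‖ ≤ ‖a.1‖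
  rw [ambientDynamics_apply]
  calc _ ≤ ‖(dynUnitaryOp N t : ellTwo (G × X) →L[ℂ] ellTwo (G × X))‖ * ‖a.1‖ *
        ‖(dynUnitaryOp N (-t) : ellTwo (G × X) →L[ℂ] ellTwo (G × X))‖ :=
        (norm_mul_le _ _).trans (mul_le_mul_of_nonneg_right (norm_mul_le _ _) (norm_nonneg _))
    _ ≤ 1 * ‖a.1‖ * 1 := by
        gcongr
        · exact norm_dynUnitaryOp_le N t
        · exact norm_dynUnitaryOp_le N (-t)
    _ = _ := by ring

/-- The automorphism `σ_t` as a bounded linear operator. -/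
noncomputable def dynamicsL (t : ℝ) : GroupoidAlgebra G Y →L[ℂ] GroupoidAlgebra G Y :=
  LinearMap.mkContinuous
    { toFun := dynamics N Y t
      map_add' := fun a b => GroupoidAlgebra.ext (map_add (ambientDynamics N t) a.1 b.1)
      map_smul' := fun c a => GroupoidAlgebra.ext (map_smul (ambientDynamics N t) c a.1) }
    1 fun a => by rw [one_mul]; exact norm_dynamics_le N t a

@[simp] theorem dynamicsL_apply (t : ℝ) (a : GroupoidAlgebra G Y) :
    dynamicsL N t a = dynamics N Y t a := rfl

theorem dynamics_mul (t : ℝ) (a b : GroupoidAlgebra G Y) :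
    dynamics N Y t (a * b) = dynamics N Y t a * dynamics N Y t b :=
  GroupoidAlgebra.ext (map_mul (ambientDynamics N t) a.1 b.1)

theorem dynamics_dynamics (s t : ℝ) (a : GroupoidAlgebra G Y) :
    dynamics N Y s (dynamics N Y t a) = dynamics N Y (s + t) a := by
  refine GroupoidAlgebra.ext ?_
  change ambientDynamics N s (ambientDynamics N t a.1) = ambientDynamics N (s + t) a.1
  simp only [ambientDynamics_apply]
  rw [← dynUnitaryOp_mul, neg_add_rev, ← dynUnitaryOp_mul]
  simp only [mul_assoc]

theorem dynamics_zero (a : GroupoidAlgebra G Y) : dynamics N Y 0 a = a := by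
  refine GroupoidAlgebra.ext ?_
  change ambientDynamics N 0 a.1 = a.1
  have : (dynUnitaryOp N 0 : ellTwo (G × X) →L[ℂ] ellTwo (G × X)) = 1 := by
    ext ξ p
    change ((N p.1 : ℝ) : ℂ) ^ (((0 : ℝ) : ℂ) * Complex.I) * ξ p = ξ p
    simp
  rw [ambientDynamics_apply, neg_zero, this, one_mul, mul_one]

theorem dynamics_cornerMonomial (t : ℝ) (f : C₀(X, ℂ)) (g : G) (h : SupportedInCorner Y g f) :
    dynamics N Y t (cornerMonomial f g h) =
      Complex.exp (Real.log (N g) * t * Complex.I) • cornerMonomial f g h := by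
  refine GroupoidAlgebra.ext ?_
  change ambientDynamics N t (monomial f g) = Complex.exp _ • monomial f g
  rw [ambientDynamics_monomial, Complex.cpow_def_of_ne_zero (by exact_mod_cast (N g).2.ne'),
    Complex.ofReal_log (N g).2.le, mul_assoc]

variable {N}

theorem IsEntireOrbit.shift {a : GroupoidAlgebra G Y} {F : ℂ → GroupoidAlgebra G Y}
    (hF : IsEntireOrbit N a F) (t : ℝ) (z : ℂ) : F (t + z) = dynamics N Y t (F z) := by
  have h := eq_of_differentiable_of_eq_ofReal (F := fun z => F (t + z))
    (H := fun z => dynamicsL N t (F z)) (hF.1.comp (differentiable_id.const_add _))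
    ((dynamicsL N t).differentiable.comp hF.1) fun s => by
      change F (t + s) = dynamics N Y t (F s)
      rw [← Complex.ofReal_add, hF.2, hF.2, dynamics_dynamics]
  exact congrFun h z

/-- The KMS condition extends, in its first argument, to the linear span of the given set of
analytic elements and, in its second argument, to all elements. -/
theorem IsKMSState.exists_orbit {β : ℝ} {φ : GroupoidAlgebra G Y →L[ℂ] ℂ}
    (hφ : IsKMSState N β φ) : ∃ V : Submodule ℂ (GroupoidAlgebra G Y),
      Dense (V : Set (GroupoidAlgebra G Y)) ∧ ∀ a ∈ V, ∃ F : ℂ → GroupoidAlgebra G Y,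
        IsEntireOrbit N a F ∧ ∀ b, φ (a * b) = φ (b * F (β * Complex.I)) := by
  obtain ⟨-, -, D, hD, h⟩ := hφ
  refine ⟨_, hD, fun a ha => ?_⟩
  induction ha using Submodule.span_induction with
  | mem a ha =>
    obtain ⟨F, hF, hb⟩ := h a ha
    refine ⟨F, hF, fun b => ?_⟩
    have hc : IsClosed {b | φ (a * b) = φ (b * F (β * Complex.I))} :=
      isClosed_eq (φ.continuous.comp (continuous_const.mul continuous_id))
        (φ.continuous.comp (continuous_id.mul continuous_const))
    refine closure_minimal (fun b hb' => ?_) hc (hD b)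
    change φ (a * b) = φ (b * F (β * Complex.I))
    induction hb' using Submodule.span_induction with
    | mem b hb' => exact hb b hb'
    | zero => rw [mul_zero, zero_mul]
    | add b c _ _ h1 h2 => rw [mul_add, add_mul, map_add, map_add, h1, h2]
    | smul r b _ h1 => rw [mul_smul_comm, smul_mul_assoc, map_smul, map_smul, h1]
  | zero =>
    refine ⟨0, ⟨differentiable_const _, fun t => ?_⟩, fun b => ?_⟩
    · exact (map_zero (dynamicsL N t)).symm
    · simp
  | add x y _ _ h1 h2 =>
    obtain ⟨F, hF, hb⟩ := h1
    obtain ⟨F', hF', hb'⟩ := h2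
    refine ⟨F + F', ⟨hF.1.add hF'.1, fun t => ?_⟩, fun b => ?_⟩
    · rw [Pi.add_apply, hF.2, hF'.2]
      exact (map_add (dynamicsL N t) x y).symm
    · rw [Pi.add_apply, add_mul, mul_add, map_add, map_add, hb, hb']
  | smul r x _ h1 =>
    obtain ⟨F, hF, hb⟩ := h1
    refine ⟨r • F, ⟨hF.1.const_smul r, fun t => ?_⟩, fun b => ?_⟩
    · rw [Pi.smul_apply, hF.2]
      exact (map_smul (dynamicsL N t) r x).symm
    · rw [Pi.smul_apply, smul_mul_assoc, mul_smul_comm, map_smul, map_smul, hb]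

/-- The KMS condition for an eigenvector of the dynamics. The given set of analytic elements need
not contain the eigenvector, which is approximated by elements `a` of its span; the functions
`z ↦ φ(b σ_z(a))`, corrected by the eigenvalue, are nearly constant on both boundary lines of the
strip `0 ≤ Im z ≤ β`. -/
theorem IsKMSState.map_mul_eigenvector {β : ℝ} {φ : GroupoidAlgebra G Y →L[ℂ] ℂ}
    (hφ : IsKMSState N β φ) {a₀ : GroupoidAlgebra G Y} {l : ℝ}
    (ha₀ : ∀ t : ℝ, dynamics N Y t a₀ = Complex.exp (l * t * Complex.I) • a₀)
    (b : GroupoidAlgebra G Y) :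
    φ (b * a₀) = Complex.exp (l * β) * φ (a₀ * b) := by
  obtain ⟨V, hV, hK⟩ := hφ.exists_orbit
  have hinv := hφ.2.1
  have key : ∀ δ : ℝ, 0 < δ → ‖φ (b * a₀) - Complex.exp (l * β) * φ (a₀ * b)‖ ≤
      2 * ((1 + Real.exp (l * β)) * (‖φ‖ * (‖b‖ * δ))) := by
    intro δ hδ
    obtain ⟨a, had, haV⟩ := Metric.dense_iff.1 hV a₀ δ hδ
    obtain ⟨F, hF, hFb⟩ := hK a haV
    have had' : ‖a - a₀‖ ≤ δ := by rw [← dist_eq_norm]; exact (Metric.mem_ball.1 had).le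
    have hda : ∀ t : ℝ, ‖dynamics N Y t a - Complex.exp (l * t * Complex.I) • a₀‖ ≤ δ := by
      intro t
      rw [← ha₀, ← dynamicsL_apply, ← dynamicsL_apply, ← map_sub]
      exact (norm_dynamics_le N t _).trans had'
    have hexp1 : ∀ t : ℝ, ‖Complex.exp (-(l * t * Complex.I))‖ = 1 := by
      intro t; simp [Complex.norm_exp]
    obtain ⟨M, hM⟩ := isCompact_uIcc.exists_bound_of_continuousOn (s := uIcc 0 β)
      (f := fun s : ℝ => F (s * Complex.I))
      (hF.1.continuous.comp (by fun_prop : Continuous fun s : ℝ => (s : ℂ) * Complex.I)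
        ).continuousOn
    obtain ⟨M', hM'⟩ := isCompact_uIcc.exists_bound_of_continuousOn (s := uIcc 0 β)
      (f := fun s : ℝ => Real.exp (l * s)) (by fun_prop)
    refine norm_sub_le_of_strip (β := β) (M := ‖φ‖ * (‖b‖ * M) * M')
      (f := fun z => φ (b * F z) * Complex.exp (-(l * z * Complex.I))) ?_ ?_ ?_ ?_
    · refine Differentiable.mul ?_ (by fun_prop)
      exact φ.differentiable.comp ((ContinuousLinearMap.mul ℂ _ b).differentiable.comp hF.1)
    · intro t
      have e : φ (b * F t) * Complex.exp (-(l * t * Complex.I)) - φ (b * a₀) =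
          φ (b * (dynamics N Y t a - Complex.exp (l * t * Complex.I) • a₀)) *
            Complex.exp (-(l * t * Complex.I)) := by
        have h1 : Complex.exp (l * t * Complex.I) * Complex.exp (-(l * t * Complex.I)) = 1 := by
          rw [← Complex.exp_add]; simp
        rw [hF.2, mul_sub, mul_smul_comm, map_sub, map_smul, smul_eq_mul]
        linear_combination φ (b * a₀) * h1
      rw [e, norm_mul, hexp1, mul_one]
      calc _ ≤ ‖φ‖ * (‖b‖ * δ) := (φ.le_opNorm _).trans <| by
            gcongr; exact (norm_mul_le _ _).trans (by gcongr; exact hda t)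
        _ ≤ _ := le_mul_of_one_le_left (by positivity) (by linarith [Real.exp_pos (l * β)])
    · intro t
      have h2 : φ (b * F (t + β * Complex.I)) = φ (dynamics N Y t a * b) := by
        rw [hF.shift, ← hinv (-t), dynamics_mul, dynamics_dynamics, neg_add_cancel, dynamics_zero,
          ← hFb, ← hinv t, dynamics_mul, dynamics_dynamics, add_neg_cancel, dynamics_zero]
      have h3 : Complex.exp (-(l * (t + β * Complex.I) * Complex.I)) =
          Complex.exp (l * β) * Complex.exp (-(l * t * Complex.I)) := by
        rw [← Complex.exp_add]
        congr 1
        linear_combination (-(l : ℂ) * β) * Complex.I_sq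
      have e : φ (b * F (t + β * Complex.I)) *
            Complex.exp (-(l * (t + β * Complex.I) * Complex.I)) -
            Complex.exp (l * β) * φ (a₀ * b) =
          Complex.exp (l * β) * (φ ((dynamics N Y t a - Complex.exp (l * t * Complex.I) • a₀) * b) *
            Complex.exp (-(l * t * Complex.I))) := by
        have h1 : Complex.exp (l * t * Complex.I) * Complex.exp (-(l * t * Complex.I)) = 1 := by
          rw [← Complex.exp_add]; simp
        rw [h2, h3, sub_mul, smul_mul_assoc, map_sub, map_smul, smul_eq_mul]
        linear_combination (φ (a₀ * b) * Complex.exp (l * β)) * h1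
      have hexp2 : ‖Complex.exp (l * β)‖ = Real.exp (l * β) := by
        rw [← Complex.ofReal_mul, ← Complex.ofReal_exp, Complex.norm_real,
          Real.norm_of_nonneg (Real.exp_pos _).le]
      rw [e, norm_mul, norm_mul, hexp1, mul_one, hexp2]
      have : ‖φ ((dynamics N Y t a - Complex.exp (l * t * Complex.I) • a₀) * b)‖ ≤
          ‖φ‖ * (‖b‖ * δ) := (φ.le_opNorm _).trans <| by
            gcongr
            rw [mul_comm ‖b‖]
            exact (norm_mul_le _ _).trans (by gcongr; exact hda t)
      have h0 : 0 ≤ ‖φ‖ * (‖b‖ * δ) := by positivity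
      have h1 := mul_le_mul_of_nonneg_left this (Real.exp_pos (l * β)).le
      linarith
    · intro t s hs
      have hexp3 : ‖Complex.exp (-(l * (t + s * Complex.I) * Complex.I))‖ = Real.exp (l * s) := by
        rw [Complex.norm_exp]; simp
      rw [norm_mul, hexp3, hF.shift]
      have hM1 : ‖dynamics N Y t (F (s * Complex.I))‖ ≤ M :=
        (norm_dynamics_le N t _).trans (hM s hs)
      have hM2 : Real.exp (l * s) ≤ M' := (le_abs_self _).trans (hM' s hs)
      have hM0 : 0 ≤ M := (norm_nonneg _).trans hM1
      gcongr
      exact (φ.le_opNorm _).trans (by gcongr; exact (norm_mul_le _ _).trans (by gcongr))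
  have hle : ‖φ (b * a₀) - Complex.exp (l * β) * φ (a₀ * b)‖ ≤ 0 := by
    have hlim : Filter.Tendsto (fun δ : ℝ =>
        2 * ((1 + Real.exp (l * β)) * (‖φ‖ * (‖b‖ * δ)))) (nhdsWithin 0 (Ioi 0)) (nhds 0) := by
      refine Filter.Tendsto.mono_left ?_ nhdsWithin_le_nhds
      exact Continuous.tendsto' (by fun_prop) _ _ (by simp)
    refine ge_of_tendsto hlim ?_
    filter_upwards [self_mem_nhdsWithin] with δ hδ using key δ hδ
  exact sub_eq_zero.1 (norm_le_zero_iff.1 hle)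

end Dynamics

/-! ### The conditional expectation -/

section Expectation

variable {G X : Type*} [Group G]

theorem norm_condExpect_le (a : ellTwo (G × X) →L[ℂ] ellTwo (G × X)) (x : X) :
    ‖condExpect a x‖ ≤ ‖a‖ := by
  classical
  refine (lp.norm_apply_le_norm (by norm_num) _ _).trans ((a.le_opNorm _).trans ?_)
  rw [lp.norm_single (by norm_num)]
  simp

theorem condExpect_sub (a b : ellTwo (G × X) →L[ℂ] ellTwo (G × X)) (x : X) :
    condExpect (a - b) x = condExpect a x - condExpect b x := rfl

theorem condExpect_star_mul_self (a : ellTwo (G × X) →L[ℂ] ellTwo (G × X)) (x : X) :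
    ∃ r : ℝ, 0 ≤ r ∧ condExpect (star a * a) x = r := by
  classical
  set δ : ellTwo (G × X) := lp.single 2 ((1 : G), x) (1 : ℂ) with hδ
  refine ⟨‖a δ‖ ^ 2, by positivity, ?_⟩
  have h1 : condExpect (star a * a) x = inner ℂ δ ((star a * a) δ) := by
    rw [hδ, lp.inner_single_left]
    simp [condExpect]
  rw [h1, ContinuousLinearMap.star_eq_adjoint, mul_apply_eq_comp,
    ContinuousLinearMap.adjoint_inner_right, inner_self_eq_norm_sq_to_K]
  norm_num

variable [TopologicalSpace X] [MulAction G X] [ContinuousConstSMul G X]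

theorem continuous_condExpect
    {a : ellTwo (G × X) →L[ℂ] ellTwo (G × X)} (ha : a ∈ reducedCrossedProduct G X) :
    Continuous (condExpect a) := by
  have hcl : IsClosed {a : ellTwo (G × X) →L[ℂ] ellTwo (G × X) | Continuous (condExpect a)} := by
    refine isClosed_of_closure_subset fun a ha => ?_
    refine continuous_of_uniform_approx_of_continuous fun u hu => ?_
    obtain ⟨ε, hε, hεu⟩ := Metric.mem_uniformity_dist.1 hu
    obtain ⟨b, hb, hab⟩ := Metric.mem_closure_iff.1 ha ε hε
    refine ⟨condExpect b, hb, fun x => hεu ?_⟩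
    rw [dist_eq_norm] at hab ⊢
    rw [← condExpect_sub]
    exact (norm_condExpect_le _ _).trans_lt hab
  refine closure_minimal (fun T hT => ?_) hcl ha
  have hT' := adjoin_monomials_le_span hT
  clear hT
  change Continuous (condExpect T)
  induction hT' using Submodule.span_induction with
  | mem x hx =>
    obtain ⟨f, g, rfl⟩ := hx
    by_cases hg : g = 1
    · exact f.continuous.congr fun x => (by rw [condExpect_monomial, if_pos hg]; rfl)
    · exact continuous_const.congr fun x => by rw [condExpect_monomial, if_neg hg]
  | zero => exact continuous_const
  | add x y _ _ h1 h2 => exact h1.add h2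
  | smul r x _ h1 => exact continuous_const.mul h1

theorem eq_of_eqOn_compactMonomials [LocallyCompactSpace X] [T2Space X] {Y : Set X}
    (hY : IsClopen Y) {φ ψ : GroupoidAlgebra G Y →L[ℂ] ℂ}
    (h : EqOn φ ψ (compactMonomials G Y)) : φ = ψ :=
  ContinuousLinearMap.ext_on (dense_span_compactMonomials hY) h

variable [MeasurableSpace X] [BorelSpace X]

theorem integrable_condExpect {Y : Set X} (m : Measure X) [IsFiniteMeasure m]
    (a : GroupoidAlgebra G Y) : Integrable (condExpect a.1) m :=
  Integrable.of_bound (continuous_condExpect a.2.1).aestronglyMeasurable ‖a.1‖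
    (Filter.Eventually.of_forall fun x => norm_condExpect_le _ x)

variable (G) in
/-- The functional `a ↦ ∫ E(a) dm` on `C⋆ᵣ(G ⊠ Y)`, for a finite measure `m`. -/
noncomputable def expectationFunctional (Y : Set X) (m : Measure X) [IsFiniteMeasure m] :
    GroupoidAlgebra G Y →L[ℂ] ℂ :=
  LinearMap.mkContinuous
    { toFun := fun a => ∫ x, condExpect a.1 x ∂m
      map_add' := fun a b =>
        integral_add (integrable_condExpect m a) (integrable_condExpect m b)
      map_smul' := fun c a => integral_const_mul c _ }
    (m.real univ) fun a => by
      rw [mul_comm]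
      exact norm_integral_le_of_norm_le_const
        (Filter.Eventually.of_forall fun x => norm_condExpect_le a.1 x)

theorem norm_expectationFunctional_le (Y : Set X) (m : Measure X) [IsFiniteMeasure m] :
    ‖expectationFunctional G Y m‖ ≤ m.real univ :=
  LinearMap.mkContinuous_norm_le _ measureReal_nonneg _

theorem expectationFunctional_cornerMonomial {Y : Set X} (m : Measure X) [IsFiniteMeasure m]
    (f : C₀(X, ℂ)) (g : G) (h : SupportedInCorner Y g f) [Decidable (g = 1)] :
    expectationFunctional G Y m (cornerMonomial f g h) = if g = 1 then ∫ x, f x ∂m else 0 := by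
  change ∫ x, condExpect (monomial f g) x ∂m = _
  simp only [condExpect_monomial]
  split_ifs <;> simp

end Expectation

/-! ### Positive functionals -/

section Positive

/-- The Cauchy–Schwarz inequality for a positive functional on a C⋆-algebra. -/
theorem norm_sq_le_of_positive {A : Type*} [NonUnitalCStarAlgebra A] {φ : A →L[ℂ] ℂ}
    (hφ : ∀ a, 0 ≤ (φ (star a * a)).re ∧ (φ (star a * a)).im = 0) (x y : A) :
    ‖φ (star y * x)‖ ^ 2 ≤ (φ (star y * y)).re * (φ (star x * x)).re := by
  have hconj : ∀ a b : A, (starRingEnd ℂ) (φ (star b * a)) = φ (star a * b) := by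
    intro a b
    have h1 := (hφ (a + b)).2
    have h2 := (hφ (a + Complex.I • b)).2
    have ha := (hφ a).2
    have hb := (hφ b).2
    simp only [star_add, star_smul, mul_add, add_mul, map_add, smul_mul_assoc, mul_smul_comm,
      map_smul, smul_eq_mul, Complex.add_im, Complex.mul_im, Complex.star_def, Complex.conj_I,
      Complex.I_re, Complex.I_im, Complex.neg_re, Complex.neg_im, Complex.mul_re] at h1 h2
    refine Complex.ext ?_ ?_
    · rw [Complex.conj_re]; linarith
    · rw [Complex.conj_im]; linarith
  let core : PreInnerProductSpace.Core ℂ A :=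
    { inner := fun a b => φ (star a * b)
      conj_inner_symm := hconj
      re_inner_nonneg := fun a => (hφ a).1
      add_left := fun a b c => by
        change φ (star (a + b) * c) = _
        rw [star_add, add_mul, map_add]
      smul_left := fun a b r => by
        change φ (star (r • a) * b) = _
        rw [star_smul, smul_mul_assoc, map_smul]
        rfl }
  have h := InnerProductSpace.Core.inner_mul_inner_self_le (c := core) y x
  change ‖φ (star y * x)‖ * ‖φ (star x * y)‖ ≤ (φ (star y * y)).re * (φ (star x * x)).re at h
  rw [← hconj x y, RCLike.norm_conj] at h
  rwa [sq]

end Positive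

/-! ### Algebraic relations between monomials -/

section CornerMonomials

variable {G X : Type*} [Group G] [TopologicalSpace X] [MulAction G X] {Y : Set X}

theorem norm_cornerMonomial_le {f : C₀(X, ℂ)} {g : G} (h : SupportedInCorner Y g f) {C : ℝ}
    (hC : 0 ≤ C) (hf : ∀ x, ‖f x‖ ≤ C) : ‖cornerMonomial f g h‖ ≤ C :=
  (norm_monomial_le f g).trans <| by
    rw [← ZeroAtInftyContinuousMap.norm_toBCF_eq_norm]
    exact (BoundedContinuousFunction.norm_le hC).2 hf

theorem cornerMonomial_add {f f' F : C₀(X, ℂ)} {g : G} (h : SupportedInCorner Y g f)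
    (h' : SupportedInCorner Y g f') (hF : SupportedInCorner Y g F)
    (hx : ∀ x, F x = f x + f' x) :
    cornerMonomial F g hF = cornerMonomial f g h + cornerMonomial f' g h' := by
  have e : F = f + f' := ZeroAtInftyContinuousMap.ext hx
  exact GroupoidAlgebra.ext ((congrArg (monomial · g) e).trans (monomial_add f f' g))

theorem cornerMonomial_smul {f F : C₀(X, ℂ)} {g : G} (c : ℂ) (h : SupportedInCorner Y g f)
    (hF : SupportedInCorner Y g F) (hx : ∀ x, F x = c * f x) :
    cornerMonomial F g hF = c • cornerMonomial f g h := by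
  have e : F = c • f := ZeroAtInftyContinuousMap.ext hx
  exact GroupoidAlgebra.ext ((congrArg (monomial · g) e).trans (monomial_smul c f g))

theorem cornerMonomial_mul [ContinuousConstSMul G X] {f f' F : C₀(X, ℂ)} {g g' k : G}
    (h : SupportedInCorner Y g f) (h' : SupportedInCorner Y g' f') (hF : SupportedInCorner Y k F)
    (hk : k = g * g') (hx : ∀ x, F x = f x * f' (g⁻¹ • x)) :
    cornerMonomial f g h * cornerMonomial f' g' h' = cornerMonomial F k hF := by
  subst hk
  have e : F = f * translate g f' := ZeroAtInftyContinuousMap.ext hx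
  exact GroupoidAlgebra.ext ((monomial_mul f f' g g').trans (congrArg (monomial · (g * g')) e.symm))

theorem star_cornerMonomial [ContinuousConstSMul G X] {f F : C₀(X, ℂ)} {g k : G}
    (h : SupportedInCorner Y g f) (hF : SupportedInCorner Y k F) (hk : k = g⁻¹)
    (hx : ∀ x, F x = star (f (g • x))) :
    star (cornerMonomial f g h) = cornerMonomial F k hF := by
  subst hk
  have e : F = star (translate g⁻¹ f) := ZeroAtInftyContinuousMap.ext fun x => by
    rw [hx, ZeroAtInftyContinuousMap.star_apply, translate_apply, inv_inv]
  exact GroupoidAlgebra.ext ((star_monomial f g).trans (congrArg (monomial · g⁻¹) e.symm))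

end CornerMonomials

/-! ### The measure of a positive functional -/

section Riesz

open CompactlySupported

variable {G X : Type*} [Group G] [TopologicalSpace X] [MulAction G X] {Y : Set X}

/-- A continuous function of compact support, as a function vanishing at infinity. -/
def ofCompactSupport (f : X → ℂ) (hf : Continuous f) (hc : HasCompactSupport f) : C₀(X, ℂ) :=
  ⟨⟨f, hf⟩, hc.is_zero_at_infty⟩

/-- The complex-valued function `1_Y f`. -/
noncomputable def restrictReal (hY : IsClopen Y) (f : C_c(X, ℝ)) : C₀(X, ℂ) :=
  cutoff hY (ofCompactSupport (fun x => (f x : ℂ)) (Complex.continuous_ofReal.comp f.continuous)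
    (f.hasCompactSupport.comp_left (g := fun r : ℝ => (r : ℂ)) Complex.ofReal_zero))

theorem restrictReal_apply (hY : IsClopen Y) (f : C_c(X, ℝ)) (x : X) :
    restrictReal hY f x = Y.indicator (fun x => (f x : ℂ)) x := rfl

variable (G) in
theorem supportedInCorner_restrictReal (hY : IsClopen Y) (f : C_c(X, ℝ)) :
    SupportedInCorner Y (1 : G) (restrictReal hY f) := fun x hx => by
  have hxY : x ∈ Y := mem_of_indicator_ne_zero (s := Y) (f := fun x => (f x : ℂ)) hx
  simpa using hxY

variable (G) in
/-- The element `1_Y f u_e` of `C⋆ᵣ(G ⊠ Y)`. -/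
noncomputable def diagonalElement (hY : IsClopen Y) (f : C_c(X, ℝ)) : GroupoidAlgebra G Y :=
  cornerMonomial (restrictReal hY f) 1 (supportedInCorner_restrictReal G hY f)

theorem diagonalElement_add (hY : IsClopen Y) (f f' : C_c(X, ℝ)) :
    diagonalElement G hY (f + f') = diagonalElement G hY f + diagonalElement G hY f' :=
  cornerMonomial_add _ _ _ fun x => by
    by_cases hx : x ∈ Y <;> simp [restrictReal_apply, hx]

theorem diagonalElement_smul (hY : IsClopen Y) (c : ℝ) (f : C_c(X, ℝ)) :
    diagonalElement G hY (c • f) = (c : ℂ) • diagonalElement G hY f :=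
  cornerMonomial_smul _ _ _ fun x => by
    by_cases hx : x ∈ Y <;> simp [restrictReal_apply, hx]

theorem diagonalElement_eq_star_mul_self [ContinuousConstSMul G X] (hY : IsClopen Y) {f : C_c(X, ℝ)}
    (hf : 0 ≤ f) : ∃ b : GroupoidAlgebra G Y, diagonalElement G hY f = star b * b := by
  have hf' : ∀ x, 0 ≤ f x := hf
  let r : C_c(X, ℝ) := ⟨⟨fun x => Real.sqrt (f x), by fun_prop⟩,
    f.hasCompactSupport.comp_left (g := Real.sqrt) Real.sqrt_zero⟩
  have hr : ∀ x, r x = Real.sqrt (f x) := fun _ => rfl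
  refine ⟨diagonalElement G hY r, ?_⟩
  have hstar : star (diagonalElement G hY r) = diagonalElement G hY r :=
    star_cornerMonomial _ _ (by simp) fun x => by
      by_cases hx : x ∈ Y <;> simp [restrictReal_apply, hx]
  rw [hstar]
  refine (cornerMonomial_mul _ _ _ (by simp) fun x => ?_).symm
  by_cases hx : x ∈ Y
  · simp only [restrictReal_apply, inv_one, one_smul, indicator_of_mem hx]
    rw [hr, ← Complex.ofReal_mul, Real.mul_self_sqrt (hf' x)]
  · simp [restrictReal_apply, hx]

variable [LocallyCompactSpace X] [T2Space X] [MeasurableSpace X] [BorelSpace X]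
  [ContinuousConstSMul G X]

/-- The restriction of a positive functional on `C⋆ᵣ(G ⊠ Y)` to the functions of compact support
in `Y` is the integral with respect to a finite measure. -/
theorem exists_measure_of_positive (hY : IsClopen Y)
    {φ : GroupoidAlgebra G Y →L[ℂ] ℂ}
    (hφ : ∀ a, 0 ≤ (φ (star a * a)).re ∧ (φ (star a * a)).im = 0) :
    ∃ m : Measure X, IsFiniteMeasure m ∧ m.real univ ≤ ‖φ‖ ∧ m Yᶜ = 0 ∧
      ∀ (f : C₀(X, ℂ)) (h : SupportedInCorner Y (1 : G) f), HasCompactSupport f →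
        φ (cornerMonomial f 1 h) = ∫ x, f x ∂m := by
  let L : C_c(X, ℝ) →ₗ[ℝ] ℝ :=
    { toFun := fun f => (φ (diagonalElement G hY f)).re
      map_add' := fun f f' => by rw [diagonalElement_add, map_add, Complex.add_re]
      map_smul' := fun c f => by
        rw [diagonalElement_smul, map_smul, smul_eq_mul, Complex.re_ofReal_mul]
        rfl }
  have hL : ∀ f, 0 ≤ f → 0 ≤ L f := fun f hf => by
    obtain ⟨b, hb⟩ := diagonalElement_eq_star_mul_self (G := G) hY hf
    change 0 ≤ (φ (diagonalElement G hY f)).re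
    rw [hb]
    exact (hφ b).1
  let Λ : C_c(X, ℝ) →ₚ[ℝ] ℝ := PositiveLinearMap.mk₀ L hL
  have hΛ : ∀ f, Λ f = (φ (diagonalElement G hY f)).re := fun _ => rfl
  have him : ∀ f : C_c(X, ℝ), (φ (diagonalElement G hY f)).im = 0 := by
    have hpos : ∀ f : C_c(X, ℝ), 0 ≤ f → (φ (diagonalElement G hY f)).im = 0 := fun f hf => by
      obtain ⟨b, hb⟩ := diagonalElement_eq_star_mul_self (G := G) hY hf
      rw [hb]
      exact (hφ b).2
    intro f
    let p : C_c(X, ℝ) := ⟨⟨fun x => |f x|, by fun_prop⟩,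
      f.hasCompactSupport.comp_left (g := fun r : ℝ => |r|) abs_zero⟩
    have h1 := hpos p fun x => abs_nonneg (f x)
    have h2 := hpos (p + (-1 : ℝ) • f) fun x => by
      change 0 ≤ |f x| + (-1) * f x
      linarith [le_abs_self (f x)]
    rw [diagonalElement_add, diagonalElement_smul, map_add, map_smul, Complex.add_im, h1,
      smul_eq_mul, Complex.im_ofReal_mul] at h2
    linarith
  set m := RealRMK.rieszMeasure Λ with hm
  have hmK : ∀ K : Set X, IsCompact K → m K ≤ ENNReal.ofReal ‖φ‖ := by
    intro K hK
    obtain ⟨e, he1, -, hec, he01⟩ := exists_continuous_one_zero_of_isCompact hK isClosed_empty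
      (disjoint_empty _)
    refine (RealRMK.rieszMeasure_le_of_eq_one Λ (f := ⟨e, hec⟩) (fun x => (he01 x).1) hK
      he1).trans (ENNReal.ofReal_le_ofReal ?_)
    rw [hΛ]
    refine (Complex.re_le_norm _).trans ((φ.le_opNorm _).trans
      (mul_le_of_le_one_right (norm_nonneg _) ?_))
    refine norm_cornerMonomial_le _ zero_le_one fun x => ?_
    rw [restrictReal_apply]
    refine (norm_indicator_le_norm_self _ _).trans ?_
    rw [Complex.norm_real]
    exact (Real.norm_of_nonneg (he01 x).1).trans_le (he01 x).2
  have hmu : m univ ≤ ENNReal.ofReal ‖φ‖ := by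
    rw [isOpen_univ.measure_eq_iSup_isCompact]
    exact iSup₂_le fun K _ => iSup_le fun hK => hmK K hK
  have hfin : IsFiniteMeasure m := ⟨hmu.trans_lt ENNReal.ofReal_lt_top⟩
  have hint : ∀ f : C_c(X, ℝ), (∀ x, x ∉ Y → f x = 0) →
      φ (diagonalElement G hY f) = ((∫ x, f x ∂(m.restrict Y) : ℝ) : ℂ) := by
    intro f hf
    rw [setIntegral_eq_integral_of_forall_compl_eq_zero hf, RealRMK.integral_rieszMeasure, hΛ]
    exact Complex.ext rfl (by rw [him, Complex.ofReal_im])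
  refine ⟨m.restrict Y, inferInstance, ?_, ?_, fun f h hc => ?_⟩
  · refine ENNReal.toReal_le_of_le_ofReal (norm_nonneg _) ?_
    rw [Measure.restrict_apply_univ]
    exact (measure_mono (subset_univ Y)).trans hmu
  · rw [Measure.restrict_apply hY.1.measurableSet.compl, compl_inter_self, measure_empty]
  · have h0 : ∀ x, x ∉ Y → f x = 0 := fun x hx => by
      by_contra hne
      exact hx (h x hne).1
    let fr : C_c(X, ℝ) := ⟨⟨fun x => (f x).re, by fun_prop⟩,
      hc.comp_left (g := Complex.re) Complex.zero_re⟩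
    let fi : C_c(X, ℝ) := ⟨⟨fun x => (f x).im, by fun_prop⟩,
      hc.comp_left (g := Complex.im) Complex.zero_im⟩
    have hfr : ∀ x, x ∉ Y → fr x = 0 := fun x hx => by
      change (f x).re = 0
      rw [h0 x hx, Complex.zero_re]
    have hfi : ∀ x, x ∉ Y → fi x = 0 := fun x hx => by
      change (f x).im = 0
      rw [h0 x hx, Complex.zero_im]
    have e : cornerMonomial f 1 h =
        diagonalElement G hY fr + Complex.I • diagonalElement G hY fi := by
      rw [diagonalElement, diagonalElement,
        ← cornerMonomial_smul (F := Complex.I • restrictReal hY fi) Complex.I _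
          (fun x hx => supportedInCorner_restrictReal G hY fi x fun h0 => hx ?_)
        (fun x => rfl)]
      · refine cornerMonomial_add _ _ _ fun x => ?_
        rw [ZeroAtInftyContinuousMap.smul_apply, restrictReal_apply, restrictReal_apply]
        by_cases hx : x ∈ Y
        · rw [indicator_of_mem hx, indicator_of_mem hx, smul_eq_mul, mul_comm]
          exact (Complex.re_add_im (f x)).symm
        · simp [hx, h0 x hx]
      · rw [ZeroAtInftyContinuousMap.smul_apply, h0, smul_zero]
    have hfint : Integrable f (m.restrict Y) :=
      f.continuous.integrable_of_hasCompactSupport hc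
    rw [e, map_add, map_smul, hint fr hfr, hint fi hfi, smul_eq_mul, mul_comm]
    exact integral_re_add_im hfint

end Riesz

/-! ### KMS states on the diagonal and off it -/

section KMSMeasure

open CompactlySupported
open scoped NNReal

variable {G X : Type*} [Group G] [TopologicalSpace X] [MulAction G X] {Y : Set X}
  {N : G →* {r : ℝ // 0 < r}} {β : ℝ} {φ : GroupoidAlgebra G Y →L[ℂ] ℂ}

/-- The product of a function of compact support with a continuous function. -/
noncomputable def mulContinuous (f : C₀(X, ℂ)) (hc : HasCompactSupport f) (u : C(X, ℂ)) :
    C₀(X, ℂ) :=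
  ofCompactSupport (fun x => f x * u x) (by fun_prop) hc.mul_right

theorem SupportedInCorner.mulContinuous {f : C₀(X, ℂ)} {g : G} (h : SupportedInCorner Y g f)
    (hc : HasCompactSupport f) (u : C(X, ℂ)) :
    SupportedInCorner Y g (mulContinuous f hc u) := fun x hx =>
  h x fun h0 => hx (by change f x * u x = 0; rw [h0, zero_mul])

/-- The functional `u ↦ φ(f u u_g)` on the continuous functions, for `f` of compact support. -/
noncomputable def coefficientFunctional (φ : GroupoidAlgebra G Y →L[ℂ] ℂ) {f : C₀(X, ℂ)} {g : G}
    (h : SupportedInCorner Y g f) (hc : HasCompactSupport f) : C(X, ℂ) →ₗ[ℂ] ℂ where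
  toFun u := φ (cornerMonomial (mulContinuous f hc u) g (h.mulContinuous hc u))
  map_add' u v := by
    rw [← map_add]
    exact congrArg φ (cornerMonomial_add _ _ _ fun x => mul_add _ _ _)
  map_smul' c u := by
    rw [← map_smul]
    exact congrArg φ (cornerMonomial_smul c _ _ fun x => mul_left_comm _ _ _)

theorem hasCompactSupport_translate [ContinuousConstSMul G X] (g : G) {f : C₀(X, ℂ)}
    (hc : HasCompactSupport f) : HasCompactSupport (translate g f) :=
  hc.comp_homeomorph (Homeomorph.smul g⁻¹)

/-- The KMS condition for a monomial `a₀ = f u_g`. -/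
theorem IsKMSState.map_mul_cornerMonomial (hφ : IsKMSState N β φ) (f : C₀(X, ℂ)) (g : G)
    (h : SupportedInCorner Y g f) (b : GroupoidAlgebra G Y) :
    φ (b * cornerMonomial f g h) =
      (((N g : ℝ) ^ β : ℝ) : ℂ) * φ (cornerMonomial f g h * b) := by
  rw [hφ.map_mul_eigenvector (l := Real.log (N g)) (fun t => dynamics_cornerMonomial N t f g h),
    Real.rpow_def_of_pos (N g).2]
  push_cast
  rfl

variable [LocallyCompactSpace X] [T2Space X] [ContinuousConstSMul G X]

/-- Monomials `f u_e` lie in the centralizer of a KMS state. Hence `φ(f u w u_g)` does not change if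
the factor `w` is replaced by its translate `w ∘ g⁻¹`. -/
theorem IsKMSState.coefficientFunctional_translate (hY : IsClopen Y) (hφ : IsKMSState N β φ)
    {f : C₀(X, ℂ)} {g : G} (h : SupportedInCorner Y g f) (hc : HasCompactSupport f)
    (u w : C(X, ℂ)) :
    coefficientFunctional φ h hc (u * w) =
      coefficientFunctional φ h hc (u * w.comp (Homeomorph.smul g⁻¹ : X ≃ₜ X)) := by
  set F := mulContinuous f hc u with hF
  have hFs : SupportedInCorner Y g F := h.mulContinuous hc u
  have hFc : HasCompactSupport F := hc.mul_right
  have hK : IsCompact (tsupport F ∪ (fun x => g⁻¹ • x) '' tsupport F) :=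
    hFc.isCompact.union (hFc.isCompact.image (continuous_const_smul g⁻¹))
  obtain ⟨e, he1, -, hec, -⟩ := exists_continuous_one_zero_of_isCompact hK isClosed_empty
    (disjoint_empty _)
  -- `k` is a function of compact support in `Y` that agrees with `w` on the supports of `F` and of
  -- `F ∘ g`
  let k : C₀(X, ℂ) := cutoff hY (ofCompactSupport (fun x => w x * (e x : ℂ)) (by fun_prop)
    (HasCompactSupport.mul_left
      (hec.comp_left (g := fun r : ℝ => (r : ℂ)) Complex.ofReal_zero)))
  have hkY : ∀ x, k x ≠ 0 → x ∈ Y := fun x hx => mem_of_indicator_ne_zero (s := Y)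
    (f := fun x => w x * (e x : ℂ)) hx
  have hk : SupportedInCorner Y (1 : G) k := fun x hx => by simpa using hkY x hx
  have hkw : ∀ x ∈ Y, x ∈ tsupport F ∪ (fun x => g⁻¹ • x) '' tsupport F → k x = w x := by
    intro x hxY hxK
    have h1 : k x = w x * (e x : ℂ) := indicator_of_mem hxY _
    rw [h1, he1 hxK]
    simp
  have h1 := hφ.map_mul_cornerMonomial k 1 hk (cornerMonomial F g hFs)
  rw [map_one] at h1
  simp only [Positive.val_one, Real.one_rpow, Complex.ofReal_one, one_mul] at h1
  have e1 : cornerMonomial k 1 hk * cornerMonomial F g hFs =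
      cornerMonomial (mulContinuous f hc (u * w)) g (h.mulContinuous hc _) := by
    refine cornerMonomial_mul _ _ _ (one_mul g).symm fun x => ?_
    rw [inv_one, one_smul]
    change f x * (u x * w x) = k x * F x
    by_cases hx : F x = 0
    · rw [hx, mul_zero, ← mul_assoc]
      change F x * w x = 0
      rw [hx, zero_mul]
    · rw [hkw x (hFs x hx).1 (Or.inl (subset_tsupport _ hx))]
      change _ = w x * (f x * u x)
      ring
  have e2 : cornerMonomial F g hFs * cornerMonomial k 1 hk =
      cornerMonomial (mulContinuous f hc (u * w.comp (Homeomorph.smul g⁻¹ : X ≃ₜ X))) g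
        (h.mulContinuous hc _) := by
    refine cornerMonomial_mul _ _ _ (mul_one g).symm fun x => ?_
    change f x * (u x * w (g⁻¹ • x)) = F x * k (g⁻¹ • x)
    by_cases hx : F x = 0
    · rw [hx, zero_mul, ← mul_assoc]
      change F x * w _ = 0
      rw [hx, zero_mul]
    · rw [hkw _ (hFs x hx).2 (Or.inr ⟨x, subset_tsupport _ hx, rfl⟩)]
      change _ = (f x * u x) * _
      ring
  rw [e1, e2] at h1
  exact h1.symm

/-- The Cauchy–Schwarz bound for the coefficients of a positive functional `φ`: `φ(f u_g)` is
controlled by `φ(|f|² u_e)`, as `(f u_g) (f u_g)⋆ = |f|² u_e`. -/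
theorem norm_sq_map_cornerMonomial_le [MeasurableSpace X] (hY : IsClopen Y)
    (hφ : ∀ a, 0 ≤ (φ (star a * a)).re ∧ (φ (star a * a)).im = 0) {m : Measure X}
    (hm : ∀ (f : C₀(X, ℂ)) (h : SupportedInCorner Y (1 : G) f), HasCompactSupport f →
      φ (cornerMonomial f 1 h) = ∫ x, f x ∂m) {f : C₀(X, ℂ)} {g : G}
    (h : SupportedInCorner Y g f) (hc : HasCompactSupport f) :
    ‖φ (cornerMonomial f g h)‖ ^ 2 ≤ (∫ x, ‖f x‖ ^ 2 ∂m) * ‖φ‖ := by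
  have hK : IsCompact ((fun x => g⁻¹ • x) '' tsupport f) :=
    hc.isCompact.image (continuous_const_smul g⁻¹)
  obtain ⟨e, he1, -, hec, he01⟩ := exists_continuous_one_zero_of_isCompact hK isClosed_empty
    (disjoint_empty _)
  let k := restrictReal hY ⟨e, hec⟩
  have hk : SupportedInCorner Y (1 : G) k := supportedInCorner_restrictReal G hY ⟨e, hec⟩
  have hk1 : ‖cornerMonomial k 1 hk‖ ≤ 1 := by
    refine norm_cornerMonomial_le _ zero_le_one fun x => ?_
    rw [restrictReal_apply]
    refine (norm_indicator_le_norm_self _ _).trans ?_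
    rw [Complex.norm_real]
    exact (Real.norm_of_nonneg (he01 x).1).trans_le (he01 x).2
  have hs : SupportedInCorner Y g⁻¹ ⇑(star (translate g⁻¹ f)) := fun x hx => by
    have := h (g • x) (by simpa using hx)
    simpa [and_comm] using this
  have hstar : star (cornerMonomial f g h) = cornerMonomial (star (translate g⁻¹ f)) g⁻¹ hs :=
    star_cornerMonomial h hs rfl fun x => by simp
  have hf2 : SupportedInCorner Y (1 : G) ⇑(f * star f : C₀(X, ℂ)) := fun x hx => by
    have := (h x fun h0 => hx (by simp [h0])).1
    simpa using this
  have hCS := norm_sq_le_of_positive hφ (cornerMonomial k 1 hk) (star (cornerMonomial f g h))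
  have e1 : cornerMonomial f g h * cornerMonomial k 1 hk = cornerMonomial f g h := by
    refine cornerMonomial_mul _ _ _ (mul_one g).symm fun x => ?_
    by_cases hx : f x = 0
    · rw [hx, zero_mul]
    · have h1 : k (g⁻¹ • x) = ((e (g⁻¹ • x) : ℝ) : ℂ) := indicator_of_mem (h x hx).2 _
      rw [h1, he1 ⟨x, subset_tsupport _ hx, rfl⟩]
      simp
  have e2 : cornerMonomial f g h * star (cornerMonomial f g h) =
      cornerMonomial (f * star f) 1 hf2 := by
    rw [hstar]
    exact cornerMonomial_mul _ _ _ (by simp) fun x => by simp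
  rw [star_star, e1, e2, hm _ hf2 (HasCompactSupport.mul_right hc)] at hCS
  have e3 : ∀ x, (f * star f : C₀(X, ℂ)) x = ((‖f x‖ ^ 2 : ℝ) : ℂ) := fun x => by
    rw [ZeroAtInftyContinuousMap.mul_apply, ZeroAtInftyContinuousMap.star_apply]
    exact (Complex.mul_conj' (f x)).trans (by push_cast; rfl)
  simp only [e3] at hCS
  rw [integral_complex_ofReal, Complex.ofReal_re] at hCS
  refine hCS.trans (mul_le_mul_of_nonneg_left ?_ (integral_nonneg fun x => by positivity))
  refine (Complex.re_le_norm _).trans ((φ.le_opNorm _).trans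
    (mul_le_of_le_one_right (norm_nonneg _) ?_))
  rw [CStarRing.norm_star_mul_self]
  exact mul_le_one₀ hk1 (norm_nonneg _) hk1

theorem exists_continuous_separating (X : Type*) [TopologicalSpace X] [LocallyCompactSpace X]
    [T2Space X] [SecondCountableTopology X] :
    ∃ h : ℕ → C(X, ℝ), ∀ x y, (∀ j, h j x = h j y) → x = y := by
  rcases isEmpty_or_nonempty X with hX | hX
  · exact ⟨fun _ => 0, fun x => isEmptyElim x⟩
  let _ := TopologicalSpace.metrizableSpaceMetric X
  refine ⟨fun j => ⟨fun x => dist x (TopologicalSpace.denseSeq X j), by fun_prop⟩,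
    fun x y hxy => ?_⟩
  have h : ∀ z, dist x z = dist y z := by
    intro z
    have hcl : IsClosed {z | dist x z = dist y z} := isClosed_eq (by fun_prop) (by fun_prop)
    refine closure_minimal ?_ hcl (TopologicalSpace.denseRange_denseSeq X z)
    rintro _ ⟨j, rfl⟩
    exact hxy j
  simpa using h y

variable [MeasurableSpace X] [BorelSpace X]

/-- The measure defined by a KMS state scales as `m (g Z) = N(g)^{-β} m Z`, as long as `Z` and
`g Z` are contained in `Y`. This is the KMS condition for `a = (r ∘ g⁻¹) u_g` and `b = r u_{g⁻¹}`,
since `b a = r²` and `a b = r² ∘ g⁻¹`. -/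
theorem IsKMSState.measure_smul [SecondCountableTopology X] (hY : IsClopen Y)
    (hφ : IsKMSState N β φ) {m : Measure X} [IsFiniteMeasure m]
    (hm : ∀ (f : C₀(X, ℂ)) (h : SupportedInCorner Y (1 : G) f), HasCompactSupport f →
      φ (cornerMonomial f 1 h) = ∫ x, f x ∂m) {g : G} {Z : Set X} (hZ : MeasurableSet Z)
    (hZY : Z ⊆ Y) (hgZ : g • Z ⊆ Y) :
    m (g • Z) = ENNReal.ofReal ((N g : ℝ) ^ (-β)) * m Z := by
  have hgm : Measurable fun x : X => g⁻¹ • x := (continuous_const_smul g⁻¹).measurable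
  set W : Set X := Y ∩ (fun x => g • x) ⁻¹' Y with hWdef
  have hW : IsClopen W := hY.inter (hY.preimage (continuous_const_smul g))
  have hWm : MeasurableSet W := hW.1.measurableSet
  have key : ENNReal.ofReal ((N g : ℝ) ^ β) • (m.map fun x => g⁻¹ • x).restrict W =
      m.restrict W := by
    have : IsFiniteMeasure (ENNReal.ofReal ((N g : ℝ) ^ β) •
        (m.map fun x => g⁻¹ • x).restrict W) := Measure.smul_finite _ ENNReal.ofReal_ne_top
    refine Measure.ext_of_integral_eq_on_compactlySupported_nnreal fun k => ?_
    have hsc : HasCompactSupport fun x => ((Real.sqrt (k x) : ℝ) : ℂ) :=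
      k.hasCompactSupport.comp_left (g := fun r : ℝ≥0 => ((Real.sqrt r : ℝ) : ℂ)) (by simp)
    let s : C₀(X, ℂ) := ofCompactSupport (fun x => ((Real.sqrt (k x) : ℝ) : ℂ)) (by fun_prop) hsc
    let r : C₀(X, ℂ) := cutoff hW s
    have hrr : ∀ x, r x * r x = ((W.indicator (fun x => (k x : ℝ)) x : ℝ) : ℂ) := by
      intro x
      by_cases hx : x ∈ W
      · have : r x = ((Real.sqrt (k x) : ℝ) : ℂ) := indicator_of_mem hx _
        rw [this, indicator_of_mem hx, ← Complex.ofReal_mul]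
        exact congrArg Complex.ofReal (Real.mul_self_sqrt (k x).2)
      · have : r x = 0 := indicator_of_notMem hx _
        rw [this, indicator_of_notMem hx]
        simp
    have hrW : ∀ x, r x ≠ 0 → x ∈ W := fun x hx => mem_of_indicator_ne_zero hx
    have hrc : HasCompactSupport r := by
      refine hsc.mono fun x hx => ?_
      exact fun h0 => hx (by
        change W.indicator s x = 0
        rw [indicator_apply_eq_zero]
        exact fun _ => h0)
    have ha : SupportedInCorner Y g (translate g r) := fun x hx =>
      ⟨by simpa using (hrW _ hx).2, (hrW _ hx).1⟩
    have hb : SupportedInCorner Y g⁻¹ r := fun x hx =>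
      ⟨(hrW _ hx).1, by simpa using (hrW _ hx).2⟩
    clear_value r
    have hba : SupportedInCorner Y (1 : G) ⇑(r * r : C₀(X, ℂ)) := fun x hx => by
      have := (hrW x fun h0 => hx (by simp [h0])).1
      simpa using this
    have hab : SupportedInCorner Y (1 : G) (translate g (r * r)) := fun x hx => by
      have := (hrW (g⁻¹ • x) fun h0 => hx (by simp [h0])).2
      simpa using this
    have hrc2 : HasCompactSupport (r * r : C₀(X, ℂ)) := HasCompactSupport.mul_left hrc
    have h1 := hφ.map_mul_cornerMonomial (translate g r) g ha (cornerMonomial r g⁻¹ hb)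
    rw [cornerMonomial_mul _ _ hba (by simp) (by simp),
      cornerMonomial_mul _ _ hab (by simp) (by simp), hm _ _ hrc2,
      hm _ _ (hasCompactSupport_translate g hrc2)] at h1
    simp only [translate_apply, ZeroAtInftyContinuousMap.mul_apply, hrr] at h1
    rw [integral_complex_ofReal, integral_complex_ofReal, ← Complex.ofReal_mul,
      Complex.ofReal_inj] at h1
    have hmeas : Measurable (W.indicator fun x => (k x : ℝ)) :=
      Measurable.indicator (NNReal.continuous_coe.comp k.continuous).measurable hWm
    rw [integral_smul_measure, ← integral_indicator hWm, ← integral_indicator hWm,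
      integral_map hgm.aemeasurable hmeas.aestronglyMeasurable, h1,
      ENNReal.toReal_ofReal (Real.rpow_pos_of_pos (N g).2 _).le, smul_eq_mul]
  have hZW : Z ⊆ W := fun z hz => ⟨hZY hz, hgZ (smul_mem_smul_set hz)⟩
  have h2 := congrArg (fun μ : Measure X => μ Z) key
  have hpre : (fun x : X => g⁻¹ • x) ⁻¹' Z = g • Z := by
    rw [preimage_smul_inv]
  simp only [Measure.smul_apply, Measure.restrict_apply hZ, inter_eq_self_of_subset_left hZW,
    Measure.map_apply hgm hZ, hpre, smul_eq_mul] at h2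
  rw [← h2, ← mul_assoc, ← ENNReal.ofReal_mul (Real.rpow_pos_of_pos (N g).2 _).le,
    ← Real.rpow_add (N g).2]
  simp

/-- A KMS state vanishes on `f u_g` if the fixed points of `g` are a null set. For functions `w` on
`X`, the number `φ(f u (w - w ∘ g⁻¹) u_g)` vanishes, so that nothing changes when `f` is replaced by
`f / (1 + n q_n)`, where `q_n` is the sum of `(w - w ∘ g⁻¹)²` over the first `n` members `w` of a
separating sequence. These functions tend to `0` outside the fixed points of `g`. -/
theorem IsKMSState.map_cornerMonomial_eq_zero [SecondCountableTopology X] (hY : IsClopen Y)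
    (hφ : IsKMSState N β φ) {m : Measure X} [IsFiniteMeasure m]
    (hm : ∀ (f : C₀(X, ℂ)) (h : SupportedInCorner Y (1 : G) f), HasCompactSupport f →
      φ (cornerMonomial f 1 h) = ∫ x, f x ∂m) {f : C₀(X, ℂ)} {g : G}
    (hfix : ∀ᵐ x ∂m, g⁻¹ • x ≠ x)
    (h : SupportedInCorner Y g f) (hc : HasCompactSupport f) :
    φ (cornerMonomial f g h) = 0 := by
  obtain ⟨w, hw⟩ := exists_continuous_separating X
  set L := coefficientFunctional φ h hc with hL
  have hL1 : φ (cornerMonomial f g h) = L 1 := by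
    have e : mulContinuous f hc 1 = f := ZeroAtInftyContinuousMap.ext fun x => mul_one (f x)
    change _ = φ (cornerMonomial (mulContinuous f hc 1) g _)
    simp only [e]
  let d : ℕ → C(X, ℝ) := fun j => w j - (w j).comp (Homeomorph.smul g⁻¹ : X ≃ₜ X)
  have hd : ∀ j x, d j x = w j x - w j (g⁻¹ • x) := fun _ _ => rfl
  let q : ℕ → X → ℝ := fun n x => ∑ j ∈ Finset.range n, d j x ^ 2
  have hq0 : ∀ n x, 0 ≤ q n x := fun n x => Finset.sum_nonneg fun j _ => sq_nonneg _
  have hqc : ∀ n, Continuous (q n) := fun n => by fun_prop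
  have hpos : ∀ (n : ℕ) x, 0 < 1 + n * q n x := fun n x => by have := hq0 n x; positivity
  let v : ℕ → C(X, ℝ) := fun n => ⟨fun x => (1 + n * q n x)⁻¹,
    (continuous_const.add (continuous_const.mul (hqc n))).inv₀ fun x => (hpos n x).ne'⟩
  let toC : C(X, ℝ) → C(X, ℂ) := fun u => ⟨fun x => (u x : ℂ), by fun_prop⟩
  have hLd : ∀ (u : C(X, ℂ)) j, L (u * toC (d j)) = 0 := fun u j => by
    have h1 := hφ.coefficientFunctional_translate hY h hc u (toC (w j))
    have e : u * toC (d j) =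
        u * toC (w j) - u * (toC (w j)).comp (Homeomorph.smul g⁻¹ : X ≃ₜ X) := by
      ext x
      change u x * ((d j x : ℝ) : ℂ) = u x * (w j x : ℂ) - u x * (w j (g⁻¹ • x) : ℂ)
      rw [hd]
      push_cast
      ring
    rw [e, map_sub, h1, sub_self]
  -- `1 = v n + ∑_{j < n} n (v n) (d j)²`, and `L` vanishes on the multiples of every `d j`
  have hLv : ∀ n, L 1 = L (toC (v n)) := fun n => by
    have e : (1 : C(X, ℂ)) = toC (v n) +
        ∑ j ∈ Finset.range n, ((n : ℂ) • (toC (v n) * toC (d j))) * toC (d j) := by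
      ext x
      have h1 : (v n x) * (1 + n * q n x) = 1 := inv_mul_cancel₀ (hpos n x).ne'
      have h2 : ((v n x : ℝ) : ℂ) * (1 + n * ∑ j ∈ Finset.range n, ((d j x : ℝ) : ℂ) ^ 2) = 1 := by
        have := congrArg (fun r : ℝ => (r : ℂ)) h1
        simp only [q] at this
        push_cast at this
        exact this
      rw [ContinuousMap.add_apply, ContinuousMap.sum_apply]
      change (1 : ℂ) = (v n x : ℂ) +
        ∑ j ∈ Finset.range n, ((n : ℂ) * ((v n x : ℂ) * (d j x : ℂ))) * (d j x : ℂ)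
      rw [← h2, mul_add, mul_one, Finset.mul_sum, Finset.mul_sum]
      congr 1
      exact Finset.sum_congr rfl fun j _ => by ring
    rw [e, map_add, map_sum, Finset.sum_eq_zero fun j _ => hLd _ j, add_zero]
  have hv01 : ∀ n x, 0 ≤ v n x ∧ v n x ≤ 1 := fun n x =>
    ⟨(inv_pos.2 (hpos n x)).le, inv_le_one_of_one_le₀ (by
      linarith [mul_nonneg (Nat.cast_nonneg (α := ℝ) n) (hq0 n x)])⟩
  have hbound : ∀ n, ‖L 1‖ ^ 2 ≤ (∫ x, ‖f x * (v n x : ℂ)‖ ^ 2 ∂m) * ‖φ‖ := fun n => by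
    rw [hLv n]
    exact norm_sq_map_cornerMonomial_le hY hφ.1.2 hm (h.mulContinuous hc (toC (v n)))
      (f := mulContinuous f hc (toC (v n))) hc.mul_right
  have hlim : Filter.Tendsto (fun n => ∫ x, ‖f x * (v n x : ℂ)‖ ^ 2 ∂m) Filter.atTop
      (nhds (∫ x, (0 : ℝ) ∂m)) := by
    refine tendsto_integral_of_dominated_convergence (fun x => ‖f x‖ ^ 2) (fun n => ?_) ?_ ?_ ?_
    · exact Continuous.aestronglyMeasurable (by fun_prop)
    · refine Continuous.integrable_of_hasCompactSupport (by fun_prop) ?_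
      exact hc.comp_left (g := fun z : ℂ => ‖z‖ ^ 2) (by simp)
    · refine fun n => Filter.Eventually.of_forall fun x => ?_
      rw [Real.norm_of_nonneg (by positivity), norm_mul, mul_pow, Complex.norm_real,
        Real.norm_of_nonneg (hv01 n x).1]
      exact mul_le_of_le_one_right (by positivity) (pow_le_one₀ (hv01 n x).1 (hv01 n x).2)
    · filter_upwards [hfix] with x hx
      obtain ⟨j, hj⟩ : ∃ j, w j x ≠ w j (g⁻¹ • x) := by
        by_contra! hcon
        exact hx (hw _ _ hcon).symm
      have hdj : 0 < d j x ^ 2 := by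
        have : d j x ≠ 0 := sub_ne_zero.2 hj
        positivity
      have hv0 : Filter.Tendsto (fun n => v n x) Filter.atTop (nhds 0) := by
        refine Filter.Tendsto.inv_tendsto_atTop ?_
        refine Filter.tendsto_atTop_mono' _ ?_
          (tendsto_natCast_atTop_atTop.atTop_mul_const hdj)
        filter_upwards [Filter.eventually_gt_atTop j] with n hn
        have h1 : d j x ^ 2 ≤ q n x := Finset.single_le_sum (f := fun j => d j x ^ 2)
          (fun _ _ => sq_nonneg _) (Finset.mem_range.2 hn)
        have h2 := mul_le_mul_of_nonneg_left h1 (Nat.cast_nonneg (α := ℝ) n)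
        linarith
      have : Filter.Tendsto (fun n => ‖f x * (v n x : ℂ)‖ ^ 2) Filter.atTop
          (nhds (‖f x * ((0 : ℝ) : ℂ)‖ ^ 2)) :=
        ((((Complex.continuous_ofReal.tendsto 0).comp hv0).const_mul (f x)).norm).pow 2
      simpa using this
  rw [integral_zero] at hlim
  have h0 : ‖L 1‖ ^ 2 ≤ 0 := by
    simpa using ge_of_tendsto' (hlim.mul_const ‖φ‖) hbound
  rw [hL1]
  simpa using le_antisymm h0 (sq_nonneg _)

end KMSMeasure

/-! ### The weights and the zeta function -/

section Zeta

variable {G : Type*} [Group G] (N : G →* {r : ℝ // 0 < r}) (β : ℝ)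

/-- The scaling factor `N(g)^{-β}`. -/
noncomputable def weight (g : G) : ℝ≥0∞ := ENNReal.ofReal ((N g : ℝ) ^ (-β))

theorem weight_ne_top (g : G) : weight N β g ≠ ∞ := ENNReal.ofReal_ne_top

theorem weight_ne_zero (g : G) : weight N β g ≠ 0 :=
  (ENNReal.ofReal_pos.2 (Real.rpow_pos_of_pos (N g).2 _)).ne'

theorem weight_one : weight N β 1 = 1 := by simp [weight]

theorem weight_mul (g k : G) : weight N β (g * k) = weight N β g * weight N β k := by
  rw [weight, weight, weight, ← ENNReal.ofReal_mul (Real.rpow_pos_of_pos (N g).2 _).le,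
    ← Real.mul_rpow (N g).2.le (N k).2.le, map_mul]
  rfl

theorem zeta_eq_tsum_weight (S : Set G) : zeta N S β = ∑' s : S, weight N β s := rfl

variable {N β}

theorem zeta_ne_zero {S : Set G} (h1 : (1 : G) ∈ S) : zeta N S β ≠ 0 := by
  rw [zeta_eq_tsum_weight]
  exact ENNReal.summable.tsum_ne_zero_iff.2 ⟨⟨1, h1⟩, weight_ne_zero N β 1⟩

theorem weight_ne_one {g : G} (hβ : β ≠ 0) (hg : N g ≠ 1) : weight N β g ≠ 1 := by
  intro h
  rw [weight, ENNReal.ofReal_eq_one, ← Real.one_rpow (-β)] at h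
  exact hg (Subtype.ext (Real.rpow_left_injOn (neg_ne_zero.2 hβ) (N g).2.le
    (zero_le_one (α := ℝ)) h))

end Zeta

/-! ### Translates of the fundamental set -/

section Translates

variable {G X : Type*} [Group G] [MulAction G X] {Y₀ Y : Set X} {S : Set G}

theorem one_mem_of_nonempty (hne : Y₀.Nonempty) (hY₀ : Y₀ ⊆ Y)
    (h_iii : ∀ g : G, ((g • Y₀) ∩ Y).Nonempty → g ∈ S) : (1 : G) ∈ S :=
  h_iii 1 (by obtain ⟨y, hy⟩ := hne; exact ⟨y, by simpa using hy, hY₀ hy⟩)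

theorem eq_of_smul_eq_smul (h_i : ∀ g : G, g ≠ 1 → (g • Y₀) ∩ Y₀ = ∅) {s t : G} {y z : X}
    (hy : y ∈ Y₀) (hz : z ∈ Y₀) (h : s • y = t • z) : s = t := by
  by_contra hne
  have h1 : t⁻¹ * s ≠ 1 := fun h1 => hne (inv_mul_eq_one.1 h1).symm
  have h2 : z ∈ ((t⁻¹ * s) • Y₀) ∩ Y₀ := ⟨⟨y, hy, by
    change (t⁻¹ * s) • y = z
    rw [mul_smul, h, inv_smul_smul]⟩, hz⟩
  rw [h_i _ h1] at h2
  exact h2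

theorem pairwise_disjoint_smul (h_i : ∀ g : G, g ≠ 1 → (g • Y₀) ∩ Y₀ = ∅) :
    Pairwise fun s t : S => Disjoint ((s : G) • Y₀) ((t : G) • Y₀) := by
  intro s t hst
  refine Set.disjoint_left.2 ?_
  rintro _ ⟨y, hy, rfl⟩ ⟨z, hz, hyz⟩
  exact hst (Subtype.ext (eq_of_smul_eq_smul h_i hy hz hyz.symm))

end Translates

/-! ### Scaling measures -/

section Measures

variable {G X : Type*} [Group G] [TopologicalSpace X] [MulAction G X] [MeasurableSpace X]
  [BorelSpace X] [ContinuousConstSMul G X] {N : G →* {r : ℝ // 0 < r}} {β : ℝ} {S : Set G}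
  {Y₀ Y : Set X}

theorem measurableSet_smul (g : G) {Z : Set X} (hZ : MeasurableSet Z) : MeasurableSet (g • Z) := by
  rw [← preimage_smul_inv]
  exact (continuous_const_smul g⁻¹).measurable hZ

theorem measurable_orbitMap (h_ii : S • Y₀ ⊆ Y) (s : S) : Measurable (orbitMap h_ii s) :=
  ((continuous_subtype_val.const_smul (s : G)).subtype_mk _).measurable

theorem measurable_smul_val (g : G) : Measurable fun y : Y₀ => g • (y : X) :=
  (continuous_subtype_val.const_smul g).measurable

theorem extendMeasure_univ (h_ii : S • Y₀ ⊆ Y) (h0 : zeta N S β ≠ 0) (h_v : zeta N S β < ∞)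
    (ν : Measure Y₀) : extendMeasure N β h_ii ν univ = ν univ := by
  rw [extendMeasure_apply N β h_ii ν MeasurableSet.univ]
  change (zeta N S β)⁻¹ * ∑' s : S, weight N β s * ν univ = _
  rw [ENNReal.tsum_mul_right, ← zeta_eq_tsum_weight, ← mul_assoc, ENNReal.inv_mul_cancel h0 h_v.ne,
    one_mul]

theorem map_val_extendMeasure_apply (h_ii : S • Y₀ ⊆ Y) (ν : Measure Y₀)
    {Z : Set X} (hZ : MeasurableSet Z) :
    (extendMeasure N β h_ii ν).map Subtype.val Z =
      (zeta N S β)⁻¹ * ∑' s : S, weight N β s * ν {y : Y₀ | (s : G) • (y : X) ∈ Z} := by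
  rw [Measure.map_apply measurable_subtype_coe hZ,
    extendMeasure_apply N β h_ii ν (measurable_subtype_coe hZ)]
  rfl

/-- The measure `ν` on `Y₀` is recovered from its extension to `Y`, since the translates of `Y₀` by
the elements of `S` other than the identity do not meet `Y₀`. -/
theorem comap_extendMeasure (hY₀m : MeasurableSet Y₀)
    (h_i : ∀ g : G, g ≠ 1 → (g • Y₀) ∩ Y₀ = ∅) (h_ii : S • Y₀ ⊆ Y) (h1 : (1 : G) ∈ S)
    (h0 : zeta N S β ≠ 0) (h_v : zeta N S β < ∞) (ν : Measure Y₀) :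
    zeta N S β • ((extendMeasure N β h_ii ν).map Subtype.val).comap (Subtype.val : Y₀ → X) = ν := by
  ext Z hZ
  have hZ' : MeasurableSet ((Subtype.val : Y₀ → X) '' Z) := hY₀m.subtype_image hZ
  rw [Measure.smul_apply, (MeasurableEmbedding.subtype_coe hY₀m).comap_apply,
    map_val_extendMeasure_apply h_ii ν hZ', smul_eq_mul, ← mul_assoc,
    ENNReal.mul_inv_cancel h0 h_v.ne, one_mul, tsum_eq_single ⟨1, h1⟩]
  · simp only [weight_one, one_mul, one_smul]
    congr 1
    ext y
    simp
  · intro s hs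
    have : {y : Y₀ | (s : G) • (y : X) ∈ (Subtype.val : Y₀ → X) '' Z} = ∅ := by
      refine eq_empty_of_forall_notMem ?_
      rintro y ⟨z, -, hz⟩
      refine hs (Subtype.ext (eq_of_smul_eq_smul h_i y.2 z.2 ?_))
      rw [one_smul, hz]
    rw [this, measure_empty, mul_zero]

variable (N β S) in
/-- The measure `ζ_S(β)⁻¹ ∑_{g ∈ G} N(g)^{-β} g_* ν` on `X`. -/
noncomputable def globalMeasure (ν : Measure Y₀) : Measure X :=
  (zeta N S β)⁻¹ • Measure.sum fun g : G => weight N β g • ν.map fun y : Y₀ => g • (y : X)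

theorem globalMeasure_apply (ν : Measure Y₀) {Z : Set X} (hZ : MeasurableSet Z) :
    globalMeasure N β S ν Z =
      (zeta N S β)⁻¹ * ∑' g : G, weight N β g * ν {y : Y₀ | g • (y : X) ∈ Z} := by
  simp only [globalMeasure, Measure.smul_apply, Measure.sum_apply _ hZ,
    Measure.map_apply (measurable_smul_val _) hZ, smul_eq_mul]
  rfl

theorem globalMeasure_restrict (hYm : MeasurableSet Y) (h_ii : S • Y₀ ⊆ Y)
    (h_iii : ∀ g : G, ((g • Y₀) ∩ Y).Nonempty → g ∈ S) (ν : Measure Y₀) :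
    (globalMeasure N β S ν).restrict Y = (extendMeasure N β h_ii ν).map Subtype.val := by
  ext Z hZ
  rw [Measure.restrict_apply hZ, globalMeasure_apply ν (hZ.inter hYm),
    map_val_extendMeasure_apply h_ii ν hZ]
  congr 1
  rw [← tsum_subtype_eq_of_support_subset (s := S)]
  · refine tsum_congr fun s => ?_
    congr 2
    ext y
    exact and_iff_left (h_ii (smul_mem_smul s.2 y.2))
  · intro g hg
    by_contra hgS
    refine hg ?_
    have : {y : Y₀ | g • (y : X) ∈ Z ∩ Y} = ∅ := by
      refine eq_empty_of_forall_notMem fun y hy => hgS (h_iii g ?_)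
      exact ⟨g • (y : X), smul_mem_smul_set y.2, hy.2⟩
    simp only [this, measure_empty, mul_zero]

theorem globalMeasure_smul (ν : Measure Y₀) (g : G) {Z : Set X} (hZ : MeasurableSet Z) :
    globalMeasure N β S ν (g • Z) = weight N β g * globalMeasure N β S ν Z := by
  have h : ∑' k : G, weight N β k * ν {y : Y₀ | k • (y : X) ∈ g • Z} =
      ∑' k : G, weight N β g * (weight N β k * ν {y : Y₀ | k • (y : X) ∈ Z}) := by
    refine ((Equiv.mulLeft g).tsum_eq _).symm.trans (tsum_congr fun k => ?_)
    rw [Equiv.coe_mulLeft, weight_mul, mul_assoc]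
    congr 3
    ext y
    simp [mul_smul]
  rw [globalMeasure_apply ν (measurableSet_smul g hZ), globalMeasure_apply ν hZ, h,
    ENNReal.tsum_mul_left, mul_left_comm]

/-- A measure scaling by `N^{-β}` is determined by its restriction to `Y`, as the countably many
translates of `Y` cover `X`. -/
theorem IsScalingMeasure.eq_of_restrict_eq [Countable G] (hYm : MeasurableSet Y)
    (hGY : ⋃ g : G, g • Y = univ) {μ μ' : Measure X} (hμ : IsScalingMeasure N β Y μ)
    (hμ' : IsScalingMeasure N β Y μ') (h : μ.restrict Y = μ'.restrict Y) : μ = μ' := by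
  refine (Measure.ext_iff_of_iUnion_eq_univ hGY).2 fun g => ?_
  ext Z hZ
  have hpre : MeasurableSet (g⁻¹ • Z) := measurableSet_smul _ hZ
  have e : Z ∩ g • Y = g • (g⁻¹ • Z ∩ Y) := by rw [smul_set_inter, smul_inv_smul]
  have hr := congrArg (fun m : Measure X => m (g⁻¹ • Z)) h
  simp only [Measure.restrict_apply hpre] at hr
  rw [Measure.restrict_apply hZ, Measure.restrict_apply hZ, e, hμ.2.2 g _ (hpre.inter hYm),
    hμ'.2.2 g _ (hpre.inter hYm), hr]

theorem isScalingMeasure_globalMeasure [LocallyCompactSpace X] [T2Space X]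
    [SecondCountableTopology X] (hY : IsClopen Y) (hGY : ⋃ g : G, g • Y = univ)
    (h_ii : S • Y₀ ⊆ Y) (h_iii : ∀ g : G, ((g • Y₀) ∩ Y).Nonempty → g ∈ S)
    (h0 : zeta N S β ≠ 0) (h_v : zeta N S β < ∞) (ν : Measure Y₀) [IsProbabilityMeasure ν] :
    IsScalingMeasure N β Y (globalMeasure N β S ν) := by
  have hYm : MeasurableSet Y := hY.1.measurableSet
  have hone : globalMeasure N β S ν Y = 1 := by
    rw [← Measure.restrict_apply_self _ Y, globalMeasure_restrict hYm h_ii h_iii,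
      Measure.map_apply measurable_subtype_coe hYm, Subtype.coe_preimage_self,
      extendMeasure_univ h_ii h0 h_v, measure_univ]
  have hloc : IsLocallyFiniteMeasure (globalMeasure N β S ν : Measure X) := ⟨fun x => by
    obtain ⟨g, hg⟩ := mem_iUnion.1 (hGY.ge (mem_univ x))
    refine ⟨g • Y, (hY.2.smul g).mem_nhds hg, ?_⟩
    rw [globalMeasure_smul ν g hYm, hone, mul_one]
    exact (weight_ne_top N β g).lt_top⟩
  exact ⟨inferInstance, hone, fun g Z hZ => globalMeasure_smul ν g hZ⟩

/-- A finite measure on `Y` that scales by `N^{-β}` and vanishes on `⋃ Y_n` is concentrated on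
`S Y₀`: for an open neighbourhood `U` of `Y₀` in `Y`, the measure of `(S U ∩ Y) \ S Y₀` is at most
`ζ_S(β)` times the measure of `U \ Y₀`, which is small by outer regularity. -/
theorem measure_diff_smul_eq_zero [Countable G] [LocallyCompactSpace X] [T2Space X]
    [SecondCountableTopology X] {m : Measure X} [IsFiniteMeasure m] (hY : IsClopen Y)
    (hscale : ∀ (g : G) (Z : Set X), MeasurableSet Z → Z ⊆ Y → g • Z ⊆ Y →
      m (g • Z) = weight N β g * m Z) {Yn : ℕ → Set X} (hYn : m (⋃ n, Yn n) = 0)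
    (hY₀m : MeasurableSet Y₀) (hY₀ : Y₀ ⊆ Y)
    (h_iv : ∀ U : Set X, IsOpen U → Y₀ ⊆ U → Y \ (S • U) ⊆ ⋃ n, Yn n)
    (h0 : zeta N S β ≠ 0) (h_v : zeta N S β < ∞) : m (Y \ S • Y₀) = 0 := by
  refine le_antisymm (ENNReal.le_of_forall_pos_le_add fun δ hδ _ => ?_) zero_le
  obtain ⟨U₁, hU₁, hU₁o, -, hU₁m⟩ := hY₀m.exists_isOpen_sdiff_lt (measure_ne_top m Y₀)
    (ε := δ / zeta N S β) (ENNReal.div_pos (by exact_mod_cast hδ.ne') h_v.ne).ne'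
  set U := U₁ ∩ Y with hU
  have hUo : IsOpen U := hU₁o.inter hY.2
  have hsub : Y \ S • Y₀ ⊆ (⋃ n, Yn n) ∪ ⋃ s : S, (s : G) • ((U \ Y₀) ∩ (s : G)⁻¹ • Y) := by
    rintro x ⟨hxY, hx⟩
    by_cases hxU : x ∈ S • U
    · right
      obtain ⟨s, hs, u, hu, rfl⟩ := mem_smul.1 hxU
      refine mem_iUnion.2 ⟨⟨s, hs⟩, smul_mem_smul_set ⟨⟨hu, fun hu0 => hx ?_⟩, ?_⟩⟩
      · exact smul_mem_smul hs hu0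
      · exact mem_inv_smul_set_iff.2 hxY
    · exact Or.inl (h_iv U hUo (subset_inter hU₁ hY₀) ⟨hxY, hxU⟩)
  calc m (Y \ S • Y₀)
      ≤ m (⋃ n, Yn n) + m (⋃ s : S, (s : G) • ((U \ Y₀) ∩ (s : G)⁻¹ • Y)) :=
        (measure_mono hsub).trans (measure_union_le _ _)
    _ ≤ 0 + ∑' s : S, weight N β s * m (U₁ \ Y₀) := by
        rw [hYn]
        gcongr
        refine (measure_iUnion_le _).trans (ENNReal.tsum_le_tsum fun s => ?_)
        rw [hscale s _ ((hUo.measurableSet.diff hY₀m).inter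
          (measurableSet_smul _ hY.1.measurableSet))]
        · gcongr
          exact fun x hx => ⟨hx.1.1.1, hx.1.2⟩
        · exact fun x hx => hx.1.1.2
        · rintro _ ⟨x, hx, rfl⟩
          exact mem_inv_smul_set_iff.1 hx.2
    _ = zeta N S β * m (U₁ \ Y₀) := by
        rw [zero_add, ENNReal.tsum_mul_right, zeta_eq_tsum_weight]
    _ ≤ zeta N S β * (δ / zeta N S β) := by gcongr
    _ = 0 + δ := by rw [ENNReal.mul_div_cancel h0 h_v.ne, zero_add]

/-- A measure that scales by `N^{-β}` and is concentrated on `S Y₀` is the extension of its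
restriction to `Y₀`, up to the factor `ζ_S(β)`. -/
theorem map_extendMeasure_comap [Countable G] {m : Measure X} (hmY : m Yᶜ = 0)
    (hscale : ∀ (g : G) (Z : Set X), MeasurableSet Z → Z ⊆ Y → g • Z ⊆ Y →
      m (g • Z) = weight N β g * m Z)
    (hY₀m : MeasurableSet Y₀) (hY₀ : Y₀ ⊆ Y) (h_i : ∀ g : G, g ≠ 1 → (g • Y₀) ∩ Y₀ = ∅)
    (h_ii : S • Y₀ ⊆ Y) (h0 : zeta N S β ≠ 0) (h_v : zeta N S β < ∞)
    (hnull : m (Y \ S • Y₀) = 0) :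
    (extendMeasure N β h_ii (zeta N S β • m.comap (Subtype.val : Y₀ → X))).map Subtype.val = m := by
  ext Z hZ
  have hcomp : m (⋃ s : S, (s : G) • Y₀)ᶜ = 0 := by
    refine measure_mono_null (t := Yᶜ ∪ (Y \ S • Y₀)) (fun x hx => ?_)
      (measure_union_null hmY hnull)
    by_cases hxY : x ∈ Y
    · refine Or.inr ⟨hxY, fun hxS => hx ?_⟩
      obtain ⟨s, hs, y, hy, rfl⟩ := mem_smul.1 hxS
      exact mem_iUnion.2 ⟨⟨s, hs⟩, smul_mem_smul_set hy⟩
    · exact Or.inl hxY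
  have hmZ : m Z = ∑' s : S, m (Z ∩ (s : G) • Y₀) := by
    rw [← measure_inter_add_sdiff Z (MeasurableSet.iUnion fun s : S => measurableSet_smul (s : G)
      hY₀m), measure_mono_null (s := Z \ _) (fun x hx => hx.2) hcomp, add_zero, inter_iUnion]
    refine measure_iUnion (fun s t hst => ?_) fun s => hZ.inter (measurableSet_smul _ hY₀m)
    exact (pairwise_disjoint_smul h_i hst).mono inter_subset_right inter_subset_right
  rw [map_val_extendMeasure_apply h_ii _ hZ, hmZ, ← ENNReal.tsum_mul_left]
  refine tsum_congr fun s => ?_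
  have himg : (Subtype.val : Y₀ → X) '' {y : Y₀ | (s : G) • (y : X) ∈ Z} = (s : G)⁻¹ • Z ∩ Y₀ := by
    ext x
    simp [mem_inv_smul_set_iff, and_comm]
  have e : Z ∩ (s : G) • Y₀ = (s : G) • ((s : G)⁻¹ • Z ∩ Y₀) := by
    rw [smul_set_inter, smul_inv_smul]
  rw [Measure.smul_apply, (MeasurableEmbedding.subtype_coe hY₀m).comap_apply, himg, e,
    hscale s _ ((measurableSet_smul _ hZ).inter hY₀m) (inter_subset_right.trans hY₀), smul_eq_mul,
    mul_left_comm (weight N β s), ← mul_assoc, ENNReal.inv_mul_cancel h0 h_v.ne, one_mul]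
  rintro _ ⟨y, hy, rfl⟩
  exact h_ii (smul_mem_smul s.2 hy.2)

end Measures

/-! ### Restriction and extension of measures -/

section ExtendMeasure

theorem map_extendMeasure_compl {G X : Type*} [Group G] [MulAction G X] [MeasurableSpace X]
    {Y Y₀ : Set X} {S : Set G} {N : G →* {r : ℝ // 0 < r}} {β : ℝ}
    (hYm : MeasurableSet Y) (h_ii : S • Y₀ ⊆ Y) (ν : Measure Y₀) :
    (extendMeasure N β h_ii ν).map Subtype.val Yᶜ = 0 := by
  rw [Measure.map_apply measurable_subtype_coe hYm.compl]
  have : (Subtype.val : Y → X) ⁻¹' Yᶜ = ∅ := eq_empty_of_forall_notMem fun y hy => hy y.2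
  rw [this, measure_empty]

variable {G X : Type*} [Group G] [TopologicalSpace X] [MulAction G X] [MeasurableSpace X]
  [BorelSpace X] [ContinuousConstSMul G X] {Y Y₀ : Set X} {S : Set G} {N : G →* {r : ℝ // 0 < r}}
  {β : ℝ}

theorem isProbabilityMeasure_map_extendMeasure (h_ii : S • Y₀ ⊆ Y) (h0 : zeta N S β ≠ 0)
    (h_v : zeta N S β < ∞) (ν : Measure Y₀) [IsProbabilityMeasure ν] :
    IsProbabilityMeasure ((extendMeasure N β h_ii ν).map Subtype.val) :=
  ⟨by rw [Measure.map_apply measurable_subtype_coe MeasurableSet.univ, preimage_univ,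
    extendMeasure_univ h_ii h0 h_v, measure_univ]⟩

theorem comap_eq_of_restrict_eq (hY₀m : MeasurableSet Y₀) (hY₀ : Y₀ ⊆ Y)
    (h_i : ∀ g : G, g ≠ 1 → (g • Y₀) ∩ Y₀ = ∅) (h_ii : S • Y₀ ⊆ Y) (h1 : (1 : G) ∈ S)
    (h0 : zeta N S β ≠ 0) (h_v : zeta N S β < ∞) (ν : Measure Y₀) {μ : Measure X}
    (hμ : μ.restrict Y = (extendMeasure N β h_ii ν).map Subtype.val) :
    zeta N S β • μ.comap (Subtype.val : Y₀ → X) = ν := by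
  rw [← comap_extendMeasure hY₀m h_i h_ii h1 h0 h_v ν, ← hμ]
  congr 1
  ext Z hZ
  rw [(MeasurableEmbedding.subtype_coe hY₀m).comap_apply,
    (MeasurableEmbedding.subtype_coe hY₀m).comap_apply,
    Measure.restrict_apply (hY₀m.subtype_image hZ), inter_eq_self_of_subset_left]
  rintro _ ⟨y, -, rfl⟩
  exact hY₀ y.2

theorem map_extendMeasure_add_smul (h_ii : S • Y₀ ⊆ Y) (ν ν' : Measure Y₀) (c c' : ℝ≥0∞) :
    (extendMeasure N β h_ii (c • ν + c' • ν')).map Subtype.val =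
      c • (extendMeasure N β h_ii ν).map Subtype.val +
        c' • (extendMeasure N β h_ii ν').map (Subtype.val : Y → X) := by
  ext Z hZ
  simp only [Measure.add_apply, Measure.smul_apply, map_val_extendMeasure_apply h_ii _ hZ,
    smul_eq_mul]
  rw [mul_left_comm c, mul_left_comm c', ← mul_add,
    ← ENNReal.tsum_mul_left (a := c), ← ENNReal.tsum_mul_left (a := c'), ← ENNReal.tsum_add]
  congr 1
  refine tsum_congr fun s => ?_
  ring

end ExtendMeasure

/-! ### From scaling measures to KMS states -/

section ScalingToKMS

variable {G X : Type*} [Group G] [TopologicalSpace X] [MulAction G X] [MeasurableSpace X]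
  [BorelSpace X] [ContinuousConstSMul G X] {Y : Set X} {N : G →* {r : ℝ // 0 < r}} {β : ℝ}

theorem expectationFunctional_diagonalElement (hY : IsClopen Y) {m : Measure X}
    [IsFiniteMeasure m] (hmY : m Yᶜ = 0) (f : CompactlySupportedContinuousMap X ℝ) :
    expectationFunctional G Y m (diagonalElement G hY f) = ((∫ x, f x ∂m : ℝ) : ℂ) := by
  classical
  rw [diagonalElement, expectationFunctional_cornerMonomial, if_pos rfl, ← integral_complex_ofReal]
  refine integral_congr_ae ?_
  filter_upwards [measure_eq_zero_iff_ae_notMem.1 hmY] with x hx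
  rw [restrictReal_apply, indicator_of_mem (not_not.1 hx)]

theorem IsScalingMeasure.integral_translate {μ : Measure X} (hμ : IsScalingMeasure N β Y μ) (g : G)
    {H : X → ℂ} (hH : Continuous H) :
    ∫ x, H (g⁻¹ • x) ∂μ = (((N g : ℝ) ^ (-β) : ℝ) : ℂ) * ∫ x, H x ∂μ := by
  have hgm : Measurable fun x : X => g⁻¹ • x := (continuous_const_smul g⁻¹).measurable
  have hmap : μ.map (fun x => g⁻¹ • x) = ENNReal.ofReal ((N g : ℝ) ^ (-β)) • μ := by
    ext Z hZ
    rw [Measure.map_apply hgm hZ, preimage_smul_inv, hμ.2.2 g Z hZ]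
    rfl
  rw [← integral_map hgm.aemeasurable (hH.measurable.aestronglyMeasurable), hmap,
    integral_smul_measure, ENNReal.toReal_ofReal (Real.rpow_pos_of_pos (N g).2 _).le,
    Complex.real_smul]

variable [LocallyCompactSpace X] [T2Space X]

variable (G) in
theorem measure_eq_of_expectationFunctional_eq [SecondCountableTopology X] (hY : IsClopen Y)
    {m m' : Measure X} [IsFiniteMeasure m] [IsFiniteMeasure m'] (hmY : m Yᶜ = 0)
    (hmY' : m' Yᶜ = 0)
    (h : expectationFunctional G Y m = expectationFunctional G Y m') : m = m' := by
  refine Measure.ext_of_integral_eq_on_compactlySupported fun f => ?_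
  have := congrArg (fun φ => φ (diagonalElement G hY f)) h
  simp only [expectationFunctional_diagonalElement hY hmY,
    expectationFunctional_diagonalElement hY hmY'] at this
  exact_mod_cast this

variable (G) in
theorem norm_expectationFunctional [SecondCountableTopology X] (hY : IsClopen Y) {m : Measure X}
    [IsProbabilityMeasure m] (hmY : m Yᶜ = 0) : ‖expectationFunctional G Y m‖ = 1 := by
  refine le_antisymm ((norm_expectationFunctional_le Y m).trans (by simp)) ?_
  refine le_of_forall_lt fun r hr => ?_
  have hlt : ENNReal.ofReal r < m univ := by
    rw [measure_univ]
    exact ENNReal.ofReal_lt_one.2 hr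
  obtain ⟨K, -, hK, hrK⟩ := isOpen_univ.exists_lt_isCompact hlt
  obtain ⟨e, he1, -, hec, he01⟩ := exists_continuous_one_zero_of_isCompact hK isClosed_empty
    (disjoint_empty _)
  set a := diagonalElement G hY ⟨e, hec⟩
  have ha : ‖a‖ ≤ 1 := by
    refine norm_cornerMonomial_le _ zero_le_one fun x => ?_
    rw [restrictReal_apply]
    refine (norm_indicator_le_norm_self _ _).trans ?_
    rw [Complex.norm_real]
    exact (Real.norm_of_nonneg (he01 x).1).trans_le (he01 x).2
  have hKe : m.real K ≤ ∫ x, e x ∂m := by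
    rw [← integral_indicator_one hK.measurableSet]
    refine integral_mono ((integrable_const (1 : ℝ)).indicator hK.measurableSet)
      (e.continuous.integrable_of_hasCompactSupport hec) fun x => ?_
    by_cases hx : x ∈ K
    · simp [hx, he1 hx]
    · simp [hx, (he01 x).1]
  calc r < m.real K := by
        by_contra! hcon
        refine hrK.not_ge ?_
        rw [← ENNReal.ofReal_toReal (measure_ne_top m K)]
        exact ENNReal.ofReal_le_ofReal hcon
    _ ≤ ∫ x, e x ∂m := hKe
    _ ≤ ‖expectationFunctional G Y m a‖ := by
        rw [expectationFunctional_diagonalElement hY hmY, Complex.norm_real]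
        exact le_abs_self _
    _ ≤ ‖expectationFunctional G Y m‖ * ‖a‖ := ContinuousLinearMap.le_opNorm _ _
    _ ≤ ‖expectationFunctional G Y m‖ := mul_le_of_le_one_right (norm_nonneg _) ha

/-- A scaling measure defines a KMS state; the KMS condition is checked on the monomials `f u_g`
with `f` of compact support. -/
theorem IsScalingMeasure.isKMSState [SecondCountableTopology X] (hY : IsClopen Y) {μ : Measure X}
    (hμ : IsScalingMeasure N β Y μ) [IsProbabilityMeasure (μ.restrict Y)] :
    IsKMSState N β (expectationFunctional G Y (μ.restrict Y)) := by
  classical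
  set φ := expectationFunctional G Y (μ.restrict Y) with hφ
  have hYm : MeasurableSet Y := hY.1.measurableSet
  have hmY : (μ.restrict Y) Yᶜ = 0 := by
    rw [Measure.restrict_apply hYm.compl, compl_inter_self, measure_empty]
  refine ⟨⟨norm_expectationFunctional G hY hmY, fun a => ?_⟩, fun t a => ?_,
    compactMonomials G Y, dense_span_compactMonomials hY, ?_⟩
  · choose r hr0 hr using condExpect_star_mul_self (G := G) (X := X) a.1
    have e : φ (star a * a) = ((∫ x in Y, r x ∂μ : ℝ) : ℂ) := by
      rw [← integral_complex_ofReal]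
      exact integral_congr_ae (Filter.Eventually.of_forall hr)
    rw [e, Complex.ofReal_re, Complex.ofReal_im]
    exact ⟨integral_nonneg hr0, rfl⟩
  · have : φ.comp (dynamicsL N t) = φ := by
      refine eq_of_eqOn_compactMonomials hY ?_
      rintro _ ⟨f, g, h, -, rfl⟩
      rw [ContinuousLinearMap.comp_apply, dynamicsL_apply, dynamics_cornerMonomial, map_smul, hφ,
        expectationFunctional_cornerMonomial]
      by_cases hg : g = 1
      · subst hg
        simp
      · simp [hg]
    exact congrArg (fun ψ => ψ a) this
  · rintro _ ⟨f, g, h, hc, rfl⟩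
    refine ⟨fun z => Complex.exp (Real.log (N g) * z * Complex.I) • cornerMonomial f g h,
      ⟨Differentiable.smul_const (by fun_prop) _, fun t =>
        (dynamics_cornerMonomial N t f g h).symm⟩, ?_⟩
    rintro _ ⟨f', g', h', hc', rfl⟩
    have hexp : Complex.exp (Real.log (N g) * (β * Complex.I) * Complex.I) =
        (((N g : ℝ) ^ (-β) : ℝ) : ℂ) := by
      rw [Real.rpow_def_of_pos (N g).2, Complex.ofReal_exp]
      congr 1
      push_cast
      linear_combination (Real.log (N g) * β : ℂ) * Complex.I_sq
    have hab : SupportedInCorner Y (g * g') ⇑(f * translate g f' : C₀(X, ℂ)) := fun x hx =>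
      ⟨(h x fun h0 => hx (by simp [h0])).1, by
        have := (h' (g⁻¹ • x) fun h0 => hx (by simp [h0])).2
        rwa [mul_inv_rev, mul_smul]⟩
    have hba : SupportedInCorner Y (g' * g) ⇑(f' * translate g' f : C₀(X, ℂ)) := fun x hx =>
      ⟨(h' x fun h0 => hx (by simp [h0])).1, by
        have := (h (g'⁻¹ • x) fun h0 => hx (by simp [h0])).2
        rwa [mul_inv_rev, mul_smul]⟩
    beta_reduce
    rw [hexp, mul_smul_comm, map_smul, smul_eq_mul,
      cornerMonomial_mul h h' hab rfl fun x => by simp,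
      cornerMonomial_mul h' h hba rfl fun x => by simp, hφ,
      expectationFunctional_cornerMonomial, expectationFunctional_cornerMonomial]
    by_cases hg : g * g' = 1
    · have hg' : g' = g⁻¹ := (inv_eq_of_mul_eq_one_right hg).symm
      subst hg'
      rw [if_pos hg, if_pos (inv_mul_cancel g),
        setIntegral_eq_integral_of_forall_compl_eq_zero fun x hx => by
          by_contra hne
          exact hx (hab x hne).1,
        setIntegral_eq_integral_of_forall_compl_eq_zero fun x hx => by
          by_contra hne
          exact hx (hba x hne).1,
        ← hμ.integral_translate g (map_continuous (f' * translate g⁻¹ f : C₀(X, ℂ)))]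
      refine integral_congr_ae (Filter.Eventually.of_forall fun x => ?_)
      simp [mul_comm]
    · have hg' : ¬ g' * g = 1 := fun h1 => hg (mul_eq_one_comm.1 h1)
      rw [if_neg hg, if_neg hg', mul_zero]

end ScalingToKMS

/-! ### From KMS states to measures -/

section KMSToScaling

variable {G X : Type*} [Group G] [TopologicalSpace X] [MulAction G X]
  [LocallyCompactSpace X] [T2Space X] [SecondCountableTopology X] [MeasurableSpace X] [BorelSpace X]
  [ContinuousConstSMul G X] {Y Y₀ : Set X} {S : Set G} {N : G →* {r : ℝ // 0 < r}} {β : ℝ}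

/-- Every KMS state is of the form `a ↦ ∫ E(a) dm` for a probability measure `m` on `Y` that scales
by `N^{-β}` and vanishes on all the sets `Y_n`. -/
theorem IsKMSState.exists_measure (hY : IsClopen Y) {Yn : ℕ → Set X} {gn : ℕ → G}
    (hYn_meas : ∀ n, MeasurableSet (Yn n)) (hYn : ∀ n, Yn n ⊆ Y)
    (hiso : {x | x ∈ Y ∧ ∃ g : G, g ≠ 1 ∧ g • x = x} ⊆ ⋃ n, Yn n)
    (hNgn : ∀ n, N (gn n) ≠ 1) (hinv : ∀ n, gn n • Yn n = Yn n) (hβ : β ≠ 0)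
    {φ : GroupoidAlgebra G Y →L[ℂ] ℂ} (hφ : IsKMSState N β φ) :
    ∃ (m : Measure X) (_ : IsProbabilityMeasure m), m Yᶜ = 0 ∧ m (⋃ n, Yn n) = 0 ∧
      (∀ (g : G) (Z : Set X), MeasurableSet Z → Z ⊆ Y → g • Z ⊆ Y →
        m (g • Z) = weight N β g * m Z) ∧ φ = expectationFunctional G Y m := by
  classical
  obtain ⟨m, hfin, hmφ, hmY, hm⟩ := exists_measure_of_positive hY hφ.1.2
  have hscale : ∀ (g : G) (Z : Set X), MeasurableSet Z → Z ⊆ Y → g • Z ⊆ Y →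
      m (g • Z) = weight N β g * m Z := fun g Z hZ hZY hgZ => hφ.measure_smul hY hm hZ hZY hgZ
  -- `m (Y_n) = m (g_n Y_n) = N(g_n)^{-β} m (Y_n)`
  have hnull : m (⋃ n, Yn n) = 0 := by
    refine measure_iUnion_null fun n => ?_
    have h := hscale (gn n) (Yn n) (hYn_meas n) (hYn n) (by rw [hinv]; exact hYn n)
    rw [hinv] at h
    by_contra hne
    refine weight_ne_one hβ (hNgn n) ((ENNReal.mul_left_inj hne (measure_ne_top m _)).1 ?_)
    rw [← h, one_mul]
  have hE : φ = expectationFunctional G Y m := by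
    refine eq_of_eqOn_compactMonomials hY ?_
    rintro _ ⟨f, g, h, hc, rfl⟩
    rw [expectationFunctional_cornerMonomial]
    split_ifs with hg
    · subst hg
      exact hm f h hc
    · refine hφ.map_cornerMonomial_eq_zero hY hm ?_ h hc
      filter_upwards [measure_eq_zero_iff_ae_notMem.1 hmY,
        measure_eq_zero_iff_ae_notMem.1 hnull] with x hx1 hx2 hx3
      exact hx2 (hiso ⟨not_not.1 hx1, g⁻¹, inv_ne_one.2 hg, hx3⟩)
  have hone : m.real univ = 1 := by
    refine le_antisymm (hmφ.trans hφ.1.1.le) ?_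
    rw [← hφ.1.1, hE]
    exact norm_expectationFunctional_le Y m
  refine ⟨m, ⟨?_⟩, hmY, hnull, hscale, hE⟩
  rw [← ENNReal.toReal_eq_one_iff]
  exact hone

/-- The KMS state defined by a probability measure on `Y₀`. -/
noncomputable def kmsStateOfMeasure (hY : IsClopen Y) (hGY : ⋃ g : G, g • Y = univ)
    (h_ii : S • Y₀ ⊆ Y) (h_iii : ∀ g : G, ((g • Y₀) ∩ Y).Nonempty → g ∈ S)
    (h0 : zeta N S β ≠ 0) (h_v : zeta N S β < ∞) (ν : ProbabilityMeasure Y₀) : KMSState N β Y :=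
  have := isProbabilityMeasure_map_extendMeasure h_ii h0 h_v (ν : Measure Y₀)
  ⟨expectationFunctional G Y ((extendMeasure N β h_ii (ν : Measure Y₀)).map Subtype.val), by
    have e := globalMeasure_restrict (N := N) (β := β) hY.1.measurableSet h_ii h_iii
      (ν : Measure Y₀)
    have hp : IsProbabilityMeasure ((globalMeasure N β S (ν : Measure Y₀)).restrict Y) := by
      rw [e]; exact this
    have h := (isScalingMeasure_globalMeasure hY hGY h_ii h_iii h0 h_v (ν : Measure Y₀)).isKMSState
      hY
    simpa only [e] using h⟩

theorem kmsStateOfMeasure_apply (hY : IsClopen Y) (hGY : ⋃ g : G, g • Y = univ)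
    (h_ii : S • Y₀ ⊆ Y) (h_iii : ∀ g : G, ((g • Y₀) ∩ Y).Nonempty → g ∈ S)
    (h0 : zeta N S β ≠ 0) (h_v : zeta N S β < ∞) (ν : ProbabilityMeasure Y₀)
    (a : GroupoidAlgebra G Y) :
    (kmsStateOfMeasure hY hGY h_ii h_iii h0 h_v ν).1 a =
      ∫ x, condExpect a.1 x ∂((extendMeasure N β h_ii (ν : Measure Y₀)).map Subtype.val) := rfl

/-- If `μ` represents the KMS state defined by `ν`, then `μ` restricts to the extension of `ν`. -/
theorem restrict_eq_of_isRepresentedBy (hY : IsClopen Y) (hGY : ⋃ g : G, g • Y = univ)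
    (h_ii : S • Y₀ ⊆ Y) (h_iii : ∀ g : G, ((g • Y₀) ∩ Y).Nonempty → g ∈ S)
    (h0 : zeta N S β ≠ 0) (h_v : zeta N S β < ∞) (ν : ProbabilityMeasure Y₀) {μ : Measure X}
    (hμY : μ Y = 1)
    (hμ : IsRepresentedBy (kmsStateOfMeasure hY hGY h_ii h_iii h0 h_v ν).1 μ) :
    μ.restrict Y = (extendMeasure N β h_ii (ν : Measure Y₀)).map Subtype.val := by
  have := isProbabilityMeasure_map_extendMeasure h_ii h0 h_v (ν : Measure Y₀)
  have hfin : IsFiniteMeasure (μ.restrict Y) := ⟨by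
    rw [Measure.restrict_apply_univ, hμY]; exact ENNReal.one_lt_top⟩
  refine measure_eq_of_expectationFunctional_eq G hY ?_
    (map_extendMeasure_compl hY.1.measurableSet h_ii _) ?_
  · rw [Measure.restrict_apply hY.1.measurableSet.compl, compl_inter_self, measure_empty]
  · ext a
    exact (hμ a).symm

end KMSToScaling

/-! ### Averages over a probability space -/

section Averages

variable {A I : Type*} [MeasurableSpace A] [MeasurableSpace I] {ν : Measure A} {κ : Measure I}
  [IsProbabilityMeasure κ]

theorem memLp_two_integral [SFinite ν] {F : A × I → ℂ} (hF : MemLp F 2 (ν.prod κ)) :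
    MemLp (fun y => ∫ s, F (y, s) ∂κ) 2 ν := by
  refine ⟨hF.1.integral_prod_right', ?_⟩
  have hF2 := hF.2
  rw [eLpNorm_lt_top_iff_lintegral_rpow_enorm_lt_top two_ne_zero ENNReal.ofNat_ne_top] at hF2 ⊢
  refine lt_of_le_of_lt ?_ hF2
  rw [lintegral_prod _ (hF.1.enorm.pow_const _)]
  refine lintegral_mono_ae ?_
  filter_upwards [hF.1.prodMk_left] with y hy
  have h1 := eLpNorm_le_eLpNorm_of_exponent_le (μ := κ) (p := 1) (q := 2) (by norm_num) hy
  have h2 : ‖∫ s, F (y, s) ∂κ‖ₑ ≤ eLpNorm (fun s => F (y, s)) 2 κ := by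
    refine (enorm_integral_le_lintegral_enorm _).trans ?_
    rwa [← eLpNorm_one_eq_lintegral_enorm]
  have h3 := ENNReal.rpow_le_rpow h2 (z := (2 : ℝ≥0∞).toReal) (by norm_num)
  rwa [eLpNorm_eq_lintegral_rpow_enorm_toReal two_ne_zero ENNReal.ofNat_ne_top,
    ← ENNReal.rpow_mul, one_div, inv_mul_cancel₀ (by norm_num), ENNReal.rpow_one] at h3

/-- The deviation of `F` from its average over `I` is orthogonal to the functions on `A`. -/
theorem integral_inner_sub_integral [SFinite ν] {F : A × I → ℂ}
    (hF : Integrable F (ν.prod κ)) {k : A → ℂ}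
    (hk : Integrable (fun p : A × I => inner ℂ (k p.1) (F p - ∫ s, F (p.1, s) ∂κ)) (ν.prod κ)) :
    ∫ p : A × I, inner ℂ (k p.1) (F p - ∫ s, F (p.1, s) ∂κ) ∂(ν.prod κ) = 0 := by
  rw [integral_prod _ hk]
  refine integral_eq_zero_of_ae ?_
  filter_upwards [hF.prod_right_ae] with y hy
  change ∫ s, inner ℂ (k y) (F (y, s) - ∫ s, F (y, s) ∂κ) ∂κ = 0
  have hsub : Integrable (fun s => F (y, s) - ∫ s, F (y, s) ∂κ) κ := hy.sub (integrable_const _)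
  rw [integral_inner hsub, integral_sub hy (integrable_const _)]
  simp

end Averages

/-! ### The fibration of the orbit of the fundamental set -/

section OrbitFibration

variable {G X : Type*} [Group G] [MulAction G X] {S : Set G} {Y₀ Y : Set X}

open Classical in
/-- The map `S Y₀ → Y₀`, `s y ↦ y`, extended by a constant to `Y`. -/
noncomputable def orbitBase (h_ii : S • Y₀ ⊆ Y) (y₀ : Y₀) (z : Y) : Y₀ :=
  if h : ∃ p : S × Y₀, orbitMap h_ii p.1 p.2 = z then h.choose.2 else y₀

theorem orbitBase_orbitMap (h_i : ∀ g : G, g ≠ 1 → (g • Y₀) ∩ Y₀ = ∅) (h_ii : S • Y₀ ⊆ Y)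
    (y₀ : Y₀) (s : S) (y : Y₀) : orbitBase h_ii y₀ (orbitMap h_ii s y) = y := by
  have h : ∃ p : S × Y₀, orbitMap h_ii p.1 p.2 = orbitMap h_ii s y := ⟨(s, y), rfl⟩
  rw [orbitBase, dif_pos h]
  have hc : (h.choose.1 : G) • (h.choose.2 : X) = (s : G) • (y : X) :=
    congrArg Subtype.val h.choose_spec
  have hs := eq_of_smul_eq_smul h_i h.choose.2.2 y.2 hc
  rw [hs] at hc
  exact Subtype.ext (smul_left_cancel _ hc)

variable [TopologicalSpace X] [MeasurableSpace X] [BorelSpace X] [ContinuousConstSMul G X]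

theorem measurable_orbitBase [Countable G] (hY₀m : MeasurableSet Y₀)
    (h_i : ∀ g : G, g ≠ 1 → (g • Y₀) ∩ Y₀ = ∅) (h_ii : S • Y₀ ⊆ Y) (y₀ : Y₀) :
    Measurable (orbitBase h_ii y₀) := by
  classical
  have himg : ∀ (s : S) (Z : Set Y₀), MeasurableSet Z → MeasurableSet (orbitMap h_ii s '' Z) := by
    intro s Z hZ
    have e : orbitMap h_ii s '' Z =
        (fun z : Y => (s : G)⁻¹ • (z : X)) ⁻¹' ((Subtype.val : Y₀ → X) '' Z) := by
      ext z
      constructor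
      · rintro ⟨y, hy, rfl⟩
        exact ⟨y, hy, (inv_smul_smul (s : G) (y : X)).symm⟩
      · rintro ⟨y, hy, hyz⟩
        refine ⟨y, hy, Subtype.ext ?_⟩
        change (s : G) • (y : X) = z
        rw [hyz, smul_inv_smul]
    rw [e]
    exact (continuous_subtype_val.const_smul (s : G)⁻¹).measurable (hY₀m.subtype_image hZ)
  intro Z hZ
  have e : orbitBase h_ii y₀ ⁻¹' Z = (⋃ s : S, orbitMap h_ii s '' Z) ∪
      ((⋃ s : S, orbitMap h_ii s '' univ)ᶜ ∩ {_z | y₀ ∈ Z}) := by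
    ext z
    by_cases hz : ∃ p : S × Y₀, orbitMap h_ii p.1 p.2 = z
    · obtain ⟨⟨s, y⟩, rfl⟩ := hz
      rw [mem_preimage, orbitBase_orbitMap h_i]
      constructor
      · exact fun hy => Or.inl (mem_iUnion.2 ⟨s, y, hy, rfl⟩)
      · rintro (h | h)
        · obtain ⟨t, y', hy', h⟩ := mem_iUnion.1 h
          have := congrArg (orbitBase h_ii y₀) h
          rw [orbitBase_orbitMap h_i, orbitBase_orbitMap h_i] at this
          exact this ▸ hy'
        · exact absurd (mem_iUnion.2 ⟨s, mem_image_of_mem _ (mem_univ y)⟩) h.1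
    · rw [mem_preimage, orbitBase, dif_neg hz]
      constructor
      · refine fun h => Or.inr ⟨fun h' => ?_, h⟩
        obtain ⟨s, y, -, h'⟩ := mem_iUnion.1 h'
        exact hz ⟨(s, y), h'⟩
      · rintro (h | h)
        · obtain ⟨s, y, -, h'⟩ := mem_iUnion.1 h
          exact absurd ⟨(s, y), h'⟩ hz
        · exact h.2
  rw [e]
  exact (MeasurableSet.iUnion fun s => himg s Z hZ).union
    ((MeasurableSet.iUnion fun s => himg s univ MeasurableSet.univ).compl.inter
      (MeasurableSet.const _))

variable (N : G →* {r : ℝ // 0 < r}) (β : ℝ)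

/-- The probability measure on `S` with weights `ζ_S(β)⁻¹ N(s)^{-β}`. -/
noncomputable def weightMeasure (S : Set G) [MeasurableSpace S] : Measure S :=
  Measure.sum fun s : S => ((zeta N S β)⁻¹ * weight N β s) • Measure.dirac s

variable {N β}

theorem isProbabilityMeasure_weightMeasure [MeasurableSpace S] (h0 : zeta N S β ≠ 0)
    (h_v : zeta N S β < ∞) : IsProbabilityMeasure (weightMeasure N β S) := ⟨by
  simp only [weightMeasure, Measure.sum_apply _ MeasurableSet.univ, Measure.smul_apply,
    measure_univ, smul_eq_mul, mul_one]
  rw [ENNReal.tsum_mul_left, ← zeta_eq_tsum_weight, ENNReal.inv_mul_cancel h0 h_v.ne]⟩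

theorem hasSum_integral_weightMeasure [MeasurableSpace S] [MeasurableSingletonClass S]
    (h0 : zeta N S β ≠ 0) (h_v : zeta N S β < ∞) {f : S → ℂ}
    (hf : Integrable f (weightMeasure N β S)) :
    HasSum (fun s : S => (((N s : ℝ) ^ (-β) : ℝ) : ℂ) * f s)
      ((zeta N S β).toReal * ∫ s, f s ∂(weightMeasure N β S)) := by
  have h := (hasSum_integral_measure hf).mul_left ((zeta N S β).toReal : ℂ)
  have e : (fun s : S => (((N s : ℝ) ^ (-β) : ℝ) : ℂ) * f s) = fun s : S => (zeta N S β).toReal *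
      ∫ x, f x ∂(((zeta N S β)⁻¹ * weight N β s) • Measure.dirac s) := by
    funext s
    rw [integral_smul_measure, integral_dirac, ENNReal.toReal_mul, ENNReal.toReal_inv, weight,
      ENNReal.toReal_ofReal (Real.rpow_pos_of_pos (N s).2 _).le, Complex.real_smul,
      Complex.ofReal_mul, ← mul_assoc, ← mul_assoc, ← Complex.ofReal_mul,
      mul_inv_cancel₀ (ENNReal.toReal_pos h0 h_v.ne).ne', Complex.ofReal_one, one_mul]
  rw [e]
  exact h

theorem measurable_orbitMap_prod [MeasurableSpace S] [MeasurableSingletonClass S] [Countable G]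
    (h_ii : S • Y₀ ⊆ Y) : Measurable fun p : Y₀ × S => orbitMap h_ii p.2 p.1 :=
  measurable_from_prod_countable_left fun s => measurable_orbitMap h_ii s

/-- The extension of `ν` to `Y` is the image of a product measure under `(y, s) ↦ s y`. -/
theorem extendMeasure_eq_map_prod [MeasurableSpace S] [MeasurableSingletonClass S] [Countable G]
    (h_ii : S • Y₀ ⊆ Y) (h0 : zeta N S β ≠ 0) (h_v : zeta N S β < ∞) (ν : Measure Y₀) [SFinite ν] :
    extendMeasure N β h_ii ν =
      (ν.prod (weightMeasure N β S)).map fun p : Y₀ × S => orbitMap h_ii p.2 p.1 := by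
  have := isProbabilityMeasure_weightMeasure (N := N) (β := β) (S := S) h0 h_v
  ext Z hZ
  have hT := measurable_orbitMap_prod (S := S) h_ii
  rw [Measure.map_apply hT hZ, Measure.prod_apply_symm (hT hZ), weightMeasure,
    lintegral_sum_measure, extendMeasure_apply N β h_ii ν hZ, ← ENNReal.tsum_mul_left]
  refine tsum_congr fun s => ?_
  rw [lintegral_smul_measure, lintegral_dirac, smul_eq_mul, mul_assoc]
  rfl

/-- On `Y₀`, the extension of `ν` is `ζ_S(β)⁻¹ ν`. -/
theorem extendMeasure_restrict (hY₀m : MeasurableSet Y₀)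
    (h_i : ∀ g : G, g ≠ 1 → (g • Y₀) ∩ Y₀ = ∅) (h_ii : S • Y₀ ⊆ Y) (h1 : (1 : G) ∈ S)
    (ν : Measure Y₀) :
    (extendMeasure N β h_ii ν).restrict {y : Y | (y : X) ∈ Y₀} =
      (zeta N S β)⁻¹ • ν.map (orbitMap h_ii ⟨1, h1⟩) := by
  ext Z hZ
  have hm : MeasurableSet {y : Y | (y : X) ∈ Y₀} := measurable_subtype_coe hY₀m
  rw [Measure.restrict_apply hZ, extendMeasure_apply N β h_ii ν (hZ.inter hm), Measure.smul_apply,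
    Measure.map_apply (measurable_orbitMap h_ii _) hZ, smul_eq_mul, tsum_eq_single ⟨1, h1⟩]
  · change _ * (weight N β 1 * _) = _
    rw [weight_one, one_mul]
    congr 2
    ext y
    refine and_iff_left ?_
    change (1 : G) • (y : X) ∈ Y₀
    rw [one_smul]
    exact y.2
  · intro s hs
    have : {y : Y₀ | orbitMap h_ii s y ∈ Z ∩ {y : Y | (y : X) ∈ Y₀}} = ∅ := by
      refine eq_empty_of_forall_notMem fun y hy => hs (Subtype.ext ?_)
      have hy2 : (s : G) • (y : X) ∈ Y₀ := hy.2
      exact eq_of_smul_eq_smul h_i y.2 hy2 (one_smul G _).symm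
    rw [this, measure_empty, mul_zero]

theorem ae_ae_of_ae_extendMeasure [Countable G] (h_ii : S • Y₀ ⊆ Y) (h_v : zeta N S β < ∞)
    (ν : Measure Y₀) {p : Y → Prop} (h : ∀ᵐ z ∂(extendMeasure N β h_ii ν), p z) :
    ∀ᵐ y ∂ν, ∀ s : S, p (orbitMap h_ii s y) := by
  rw [ae_all_iff]
  intro s
  rw [extendMeasure, Measure.ae_ennreal_smul_measure_iff (ENNReal.inv_ne_zero.2 h_v.ne),
    Measure.ae_sum_iff] at h
  have h1 : ∀ᵐ z ∂(weight N β s • ν.map (orbitMap h_ii s)), p z := h s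
  rw [Measure.ae_ennreal_smul_measure_iff (weight_ne_zero N β s)] at h1
  exact ae_of_ae_map (measurable_orbitMap h_ii s).aemeasurable h1

theorem map_orbitBase_extendMeasure [Countable G] (hY₀m : MeasurableSet Y₀)
    (h_i : ∀ g : G, g ≠ 1 → (g • Y₀) ∩ Y₀ = ∅) (h_ii : S • Y₀ ⊆ Y) (y₀ : Y₀)
    (h0 : zeta N S β ≠ 0) (h_v : zeta N S β < ∞) (ν : Measure Y₀) :
    (extendMeasure N β h_ii ν).map (orbitBase h_ii y₀) = ν := by
  have hπ := measurable_orbitBase hY₀m h_i h_ii y₀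
  ext Z hZ
  rw [Measure.map_apply hπ hZ, extendMeasure_apply N β h_ii ν (hπ hZ)]
  simp only [mem_preimage, orbitBase_orbitMap h_i]
  change _ * ∑' s : S, weight N β s * ν Z = ν Z
  rw [ENNReal.tsum_mul_right, ← zeta_eq_tsum_weight, ← mul_assoc, ENNReal.inv_mul_cancel h0 h_v.ne,
    one_mul]

theorem ae_extendMeasure_of_forall_orbitMap [Countable G]
    (hY₀m : MeasurableSet Y₀) (h_ii : S • Y₀ ⊆ Y) (ν : Measure Y₀) {p : Y → Prop}
    (h : ∀ s y, p (orbitMap h_ii s y)) : ∀ᵐ z ∂(extendMeasure N β h_ii ν), p z := by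
  have hm : MeasurableSet ((Subtype.val : Y → X) ⁻¹' ⋃ s : S, (s : G) • Y₀) :=
    measurable_subtype_coe (MeasurableSet.iUnion fun s => measurableSet_smul _ hY₀m)
  have h0 : extendMeasure N β h_ii ν ((Subtype.val : Y → X) ⁻¹' ⋃ s : S, (s : G) • Y₀)ᶜ = 0 := by
    rw [extendMeasure_apply N β h_ii ν hm.compl]
    refine mul_eq_zero_of_right _ (ENNReal.tsum_eq_zero.2 fun s => mul_eq_zero_of_right _ ?_)
    have : {y : Y₀ | orbitMap h_ii s y ∈ ((Subtype.val : Y → X) ⁻¹' ⋃ s : S, (s : G) • Y₀)ᶜ} = ∅ :=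
      eq_empty_of_forall_notMem fun y hy => hy (mem_iUnion.2 ⟨s, smul_mem_smul_set y.2⟩)
    rw [this, measure_empty]
  filter_upwards [measure_eq_zero_iff_ae_notMem.1 h0] with z hz
  obtain ⟨s, y, hy, hyz⟩ := mem_iUnion.1 (not_not.1 hz)
  have : orbitMap h_ii s ⟨y, hy⟩ = z := Subtype.ext hyz
  exact this ▸ h s ⟨y, hy⟩

end OrbitFibration

/-! ### Invariant functions and the projection onto them -/

section InvariantSubspace

theorem integral_comp_of_measurePreserving {A B E : Type*}
    [MeasurableSpace A] [MeasurableSpace B] [NormedAddCommGroup E] [NormedSpace ℝ E]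
    {κ : Measure A} {μ : Measure B} {T : A → B} (hT : MeasurePreserving T κ μ) {f : B → E}
    (hf : AEStronglyMeasurable f μ) : ∫ z, f z ∂μ = ∫ p, f (T p) ∂κ := by
  rw [← hT.map_eq] at hf ⊢
  exact integral_map hT.measurable.aemeasurable hf

variable {G X : Type*} [Group G] [Countable G] [MulAction G X] [TopologicalSpace X]
  [MeasurableSpace X] [BorelSpace X] [ContinuousConstSMul G X] {S : Set G} {Y₀ Y : Set X}
  {N : G →* {r : ℝ // 0 < r}} {β : ℝ}

/-- The invariant functions are those that factor through `S Y₀ → Y₀`. -/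
theorem mem_invariantSubspace_iff (hY₀m : MeasurableSet Y₀) (hY₀ : Y₀ ⊆ Y)
    (h_i : ∀ g : G, g ≠ 1 → (g • Y₀) ∩ Y₀ = ∅) (h_ii : S • Y₀ ⊆ Y) (h1 : (1 : G) ∈ S) (y₀ : Y₀)
    (ν : Measure Y₀) (f : Lp ℂ 2 (extendMeasure N β h_ii ν)) :
    f ∈ invariantSubspace h_ii hY₀ (extendMeasure N β h_ii ν) ↔
      ∃ h : Y₀ → ℂ, f =ᵐ[extendMeasure N β h_ii ν] h ∘ orbitBase h_ii y₀ := by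
  constructor
  · rintro ⟨f', hf, hf'⟩
    refine ⟨fun y => f' (inclusion hY₀ y), hf.trans ?_⟩
    refine ae_extendMeasure_of_forall_orbitMap hY₀m h_ii ν fun s y => ?_
    rw [hf', Function.comp_apply, orbitBase_orbitMap h_i]
  · rintro ⟨h, hf⟩
    refine ⟨h ∘ orbitBase h_ii y₀, hf, fun s y => ?_⟩
    have e : inclusion hY₀ y = orbitMap h_ii ⟨1, h1⟩ y := Subtype.ext (one_smul G (y : X)).symm
    simp only [e, Function.comp_apply, orbitBase_orbitMap h_i]

theorem norm_sq_of_mem_invariantSubspace (hY₀m : MeasurableSet Y₀) (hY₀ : Y₀ ⊆ Y)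
    (h_i : ∀ g : G, g ≠ 1 → (g • Y₀) ∩ Y₀ = ∅) (h_ii : S • Y₀ ⊆ Y) (h1 : (1 : G) ∈ S)
    (y₀ : Y₀) (h0 : zeta N S β ≠ 0) (h_v : zeta N S β < ∞) (ν : Measure Y₀)
    {f : Lp ℂ 2 (extendMeasure N β h_ii ν)}
    (hf : f ∈ invariantSubspace h_ii hY₀ (extendMeasure N β h_ii ν)) :
    ‖f‖ ^ 2 = (zeta N S β).toReal *
      ∫ y in {y : Y | (y : X) ∈ Y₀}, ‖f y‖ ^ 2 ∂(extendMeasure N β h_ii ν) := by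
  obtain ⟨h, hh⟩ := (mem_invariantSubspace_iff hY₀m hY₀ h_i h_ii h1 y₀ ν f).1 hf
  have hπ : MeasurePreserving (orbitBase h_ii y₀) (extendMeasure N β h_ii ν) ν :=
    ⟨measurable_orbitBase hY₀m h_i h_ii y₀,
      map_orbitBase_extendMeasure hY₀m h_i h_ii y₀ h0 h_v ν⟩
  have hT := measurable_orbitMap h_ii ⟨1, h1⟩
  have hfm : StronglyMeasurable fun z => ‖f z‖ ^ 2 := (Lp.stronglyMeasurable f).norm.pow 2
  have hk : h =ᵐ[ν] fun y => f (orbitMap h_ii ⟨1, h1⟩ y) := by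
    filter_upwards [ae_ae_of_ae_extendMeasure h_ii h_v ν hh] with y hy
    rw [hy, Function.comp_apply, orbitBase_orbitMap h_i]
  have hfk : ∀ᵐ z ∂(extendMeasure N β h_ii ν),
      f z = f (orbitMap h_ii ⟨1, h1⟩ (orbitBase h_ii y₀ z)) := by
    filter_upwards [hh, hπ.quasiMeasurePreserving.ae hk] with z hz hz'
    rw [hz, Function.comp_apply, hz']
  have hL : ‖f‖ ^ 2 = ∫ z, ‖f z‖ ^ 2 ∂(extendMeasure N β h_ii ν) := by
    rw [← inner_self_eq_norm_sq (𝕜 := ℂ), L2.inner_def, ← integral_re (L2.integrable_inner f f)]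
    simp only [inner_self_eq_norm_sq]
  have hZ : (zeta N S β).toReal ≠ 0 := (ENNReal.toReal_pos h0 h_v.ne).ne'
  rw [extendMeasure_restrict hY₀m h_i h_ii h1, integral_smul_measure,
    integral_map hT.aemeasurable hfm.aestronglyMeasurable, ENNReal.toReal_inv, smul_eq_mul,
    mul_inv_cancel_left₀ hZ, hL]
  calc ∫ z, ‖f z‖ ^ 2 ∂(extendMeasure N β h_ii ν)
      = ∫ z, ‖f (orbitMap h_ii ⟨1, h1⟩ (orbitBase h_ii y₀ z))‖ ^ 2 ∂(extendMeasure N β h_ii ν) := by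
        refine integral_congr_ae ?_
        filter_upwards [hfk] with z hz
        rw [← hz]
    _ = ∫ y, ‖f (orbitMap h_ii ⟨1, h1⟩ y)‖ ^ 2 ∂ν :=
        (integral_comp_of_measurePreserving hπ
          (hfm.comp_measurable hT).aestronglyMeasurable).symm

/-- The orthogonal projection onto the invariant functions is averaging over `S`. -/
theorem exists_projection_invariantSubspace [MeasurableSpace S] [MeasurableSingletonClass S]
    (hY₀m : MeasurableSet Y₀) (hY₀ : Y₀ ⊆ Y)
    (h_i : ∀ g : G, g ≠ 1 → (g • Y₀) ∩ Y₀ = ∅) (h_ii : S • Y₀ ⊆ Y) (h1 : (1 : G) ∈ S)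
    (y₀ : Y₀) (h0 : zeta N S β ≠ 0) (h_v : zeta N S β < ∞) (ν : Measure Y₀) [IsFiniteMeasure ν]
    (f : Lp ℂ 2 (extendMeasure N β h_ii ν)) :
    ∃ w ∈ invariantSubspace h_ii hY₀ (extendMeasure N β h_ii ν),
      f - w ∈ (invariantSubspace h_ii hY₀ (extendMeasure N β h_ii ν))ᗮ ∧
      ∀ᵐ z ∂(extendMeasure N β h_ii ν),
        w z = ∫ s, f (orbitMap h_ii s (orbitBase h_ii y₀ z)) ∂(weightMeasure N β S) := by
  have := isProbabilityMeasure_weightMeasure (N := N) (β := β) (S := S) h0 h_v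
  have hT := measurable_orbitMap_prod (S := S) h_ii
  have hmapT := extendMeasure_eq_map_prod (N := N) (β := β) h_ii h0 h_v ν
  have hpT : MeasurePreserving (fun p : Y₀ × S => orbitMap h_ii p.2 p.1)
      (ν.prod (weightMeasure N β S)) (extendMeasure N β h_ii ν) := ⟨hT, hmapT.symm⟩
  have hpπ : MeasurePreserving (orbitBase h_ii y₀) (extendMeasure N β h_ii ν) ν :=
    ⟨measurable_orbitBase hY₀m h_i h_ii y₀,
      map_orbitBase_extendMeasure hY₀m h_i h_ii y₀ h0 h_v ν⟩
  have hF : MemLp (fun p : Y₀ × S => f (orbitMap h_ii p.2 p.1)) 2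
      (ν.prod (weightMeasure N β S)) := (Lp.memLp f).comp_measurePreserving hpT
  have hW := (memLp_two_integral hF).comp_measurePreserving hpπ
  have hw := hW.coeFn_toLp
  refine ⟨hW.toLp _, (mem_invariantSubspace_iff hY₀m hY₀ h_i h_ii h1 y₀ ν _).2 ⟨_, hw⟩, ?_, hw⟩
  rw [Submodule.mem_orthogonal]
  intro u hu
  obtain ⟨k, hk⟩ := (mem_invariantSubspace_iff hY₀m hY₀ h_i h_ii h1 y₀ ν u).1 hu
  have hint := L2.integrable_inner (𝕜 := ℂ) u (f - hW.toLp _)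
  have hae : (fun p : Y₀ × S => inner ℂ (u (orbitMap h_ii p.2 p.1))
      ((f - hW.toLp _ : Lp ℂ 2 (extendMeasure N β h_ii ν)) (orbitMap h_ii p.2 p.1))) =ᵐ[
        ν.prod (weightMeasure N β S)] fun p => inner ℂ (k p.1)
          (f (orbitMap h_ii p.2 p.1) - ∫ s, f (orbitMap h_ii s p.1) ∂(weightMeasure N β S)) := by
    filter_upwards [hpT.quasiMeasurePreserving.ae hk, hpT.quasiMeasurePreserving.ae hw,
      hpT.quasiMeasurePreserving.ae (Lp.coeFn_sub f (hW.toLp _))] with p hp1 hp2 hp3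
    rw [hp1, hp3, Pi.sub_apply, hp2]
    simp only [Function.comp_apply, orbitBase_orbitMap h_i]
  rw [L2.inner_def, integral_comp_of_measurePreserving hpT hint.1, integral_congr_ae hae]
  exact integral_inner_sub_integral (hF.integrable one_le_two)
    ((hpT.integrable_comp_of_integrable hint).congr hae)

theorem hasOrthogonalProjection_invariantSubspace (hY₀m : MeasurableSet Y₀) (hY₀ : Y₀ ⊆ Y)
    (h_i : ∀ g : G, g ≠ 1 → (g • Y₀) ∩ Y₀ = ∅) (h_ii : S • Y₀ ⊆ Y) (h1 : (1 : G) ∈ S)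
    (y₀ : Y₀) (h0 : zeta N S β ≠ 0) (h_v : zeta N S β < ∞) (ν : Measure Y₀) [IsFiniteMeasure ν] :
    (invariantSubspace h_ii hY₀ (extendMeasure N β h_ii ν)).HasOrthogonalProjection := by
  let _ : MeasurableSpace S := ⊤
  refine ⟨fun f => ?_⟩
  obtain ⟨w, hw, hfw, -⟩ :=
    exists_projection_invariantSubspace hY₀m hY₀ h_i h_ii h1 y₀ h0 h_v ν f
  exact ⟨w, hw, hfw⟩

theorem ae_starProjection_invariantSubspace (hY₀m : MeasurableSet Y₀) (hY₀ : Y₀ ⊆ Y)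
    (h_i : ∀ g : G, g ≠ 1 → (g • Y₀) ∩ Y₀ = ∅) (h_ii : S • Y₀ ⊆ Y) (h1 : (1 : G) ∈ S)
    (y₀ : Y₀) (h0 : zeta N S β ≠ 0) (h_v : zeta N S β < ∞) (ν : Measure Y₀) [IsFiniteMeasure ν]
    [(invariantSubspace h_ii hY₀ (extendMeasure N β h_ii ν)).HasOrthogonalProjection]
    (f : Lp ℂ 2 (extendMeasure N β h_ii ν)) :
    ∀ᵐ y ∂ν, Summable (fun s : S => (((N s : ℝ) ^ (-β) : ℝ) : ℂ) * f (orbitMap h_ii s y)) ∧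
      ∀ t : S, (invariantSubspace h_ii hY₀ (extendMeasure N β h_ii ν)).starProjection f
          (orbitMap h_ii t y) = ((zeta N S β).toReal : ℂ)⁻¹ *
        ∑' s : S, (((N s : ℝ) ^ (-β) : ℝ) : ℂ) * f (orbitMap h_ii s y) := by
  let _ : MeasurableSpace S := ⊤
  have := isProbabilityMeasure_weightMeasure (N := N) (β := β) (S := S) h0 h_v
  obtain ⟨w, hw, hfw, hwz⟩ :=
    exists_projection_invariantSubspace hY₀m hY₀ h_i h_ii h1 y₀ h0 h_v ν f
  have hT : MeasurePreserving (fun p : Y₀ × S => orbitMap h_ii p.2 p.1)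
      (ν.prod (weightMeasure N β S)) (extendMeasure N β h_ii ν) :=
    ⟨measurable_orbitMap_prod h_ii, (extendMeasure_eq_map_prod h_ii h0 h_v ν).symm⟩
  have hF := ((Lp.memLp f).comp_measurePreserving hT).integrable one_le_two
  rw [Submodule.eq_starProjection_of_mem_orthogonal hw hfw]
  filter_upwards [ae_ae_of_ae_extendMeasure h_ii h_v ν hwz, hF.prod_right_ae] with y hy hFy
  have hs := hasSum_integral_weightMeasure h0 h_v hFy
  refine ⟨hs.summable, fun t => ?_⟩
  have hZ : ((zeta N S β).toReal : ℂ) ≠ 0 :=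
    Complex.ofReal_ne_zero.2 (ENNReal.toReal_pos h0 h_v.ne).ne'
  rw [hy, orbitBase_orbitMap h_i]
  exact (eq_inv_mul_iff_mul_eq₀ hZ).2 hs.tsum_eq.symm

end InvariantSubspace

/-! ### The parametrization of KMS states -/

section Parametrization

variable {G X : Type*} [Group G] [TopologicalSpace X] [MulAction G X]
  [LocallyCompactSpace X] [T2Space X] [SecondCountableTopology X] [MeasurableSpace X] [BorelSpace X]
  [ContinuousConstSMul G X] {Y Y₀ : Set X} {S : Set G} {N : G →* {r : ℝ // 0 < r}} {β : ℝ}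

theorem injective_kmsStateOfMeasure (hY : IsClopen Y) (hGY : ⋃ g : G, g • Y = univ)
    (hY₀m : MeasurableSet Y₀) (h_i : ∀ g : G, g ≠ 1 → (g • Y₀) ∩ Y₀ = ∅) (h_ii : S • Y₀ ⊆ Y)
    (h_iii : ∀ g : G, ((g • Y₀) ∩ Y).Nonempty → g ∈ S) (h1 : (1 : G) ∈ S)
    (h0 : zeta N S β ≠ 0) (h_v : zeta N S β < ∞) :
    Function.Injective (kmsStateOfMeasure (Y₀ := Y₀) hY hGY h_ii h_iii h0 h_v) := by
  intro ν ν' h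
  have := isProbabilityMeasure_map_extendMeasure h_ii h0 h_v (ν : Measure Y₀)
  have := isProbabilityMeasure_map_extendMeasure h_ii h0 h_v (ν' : Measure Y₀)
  have e := measure_eq_of_expectationFunctional_eq G hY
    (map_extendMeasure_compl hY.1.measurableSet h_ii _)
    (map_extendMeasure_compl hY.1.measurableSet h_ii _) (congrArg Subtype.val h)
  refine Subtype.ext ?_
  change (ν : Measure Y₀) = ν'
  rw [← comap_extendMeasure hY₀m h_i h_ii h1 h0 h_v (ν : Measure Y₀), e,
    comap_extendMeasure hY₀m h_i h_ii h1 h0 h_v]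

theorem surjective_kmsStateOfMeasure [Countable G] (hY : IsClopen Y) (hGY : ⋃ g : G, g • Y = univ)
    {Yn : ℕ → Set X} {gn : ℕ → G}
    (hYn_meas : ∀ n, MeasurableSet (Yn n)) (hYn : ∀ n, Yn n ⊆ Y)
    (hiso : {x | x ∈ Y ∧ ∃ g : G, g ≠ 1 ∧ g • x = x} ⊆ ⋃ n, Yn n)
    (hNgn : ∀ n, N (gn n) ≠ 1) (hinv : ∀ n, gn n • Yn n = Yn n) (hβ : β ≠ 0)
    (hY₀m : MeasurableSet Y₀) (hY₀ : Y₀ ⊆ Y)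
    (h_i : ∀ g : G, g ≠ 1 → (g • Y₀) ∩ Y₀ = ∅) (h_ii : S • Y₀ ⊆ Y)
    (h_iii : ∀ g : G, ((g • Y₀) ∩ Y).Nonempty → g ∈ S)
    (h_iv : ∀ U : Set X, IsOpen U → Y₀ ⊆ U → Y \ (S • U) ⊆ ⋃ n, Yn n)
    (h0 : zeta N S β ≠ 0) (h_v : zeta N S β < ∞) :
    Function.Surjective (kmsStateOfMeasure (Y₀ := Y₀) hY hGY h_ii h_iii h0 h_v) := by
  rintro ⟨φ, hφ⟩
  obtain ⟨m, hm, hmY, hnull, hscale, hE⟩ :=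
    hφ.exists_measure hY hYn_meas hYn hiso hNgn hinv hβ
  have e := map_extendMeasure_comap hmY hscale hY₀m hY₀ h_i h_ii h0 h_v
    (measure_diff_smul_eq_zero hY hscale hnull hY₀m hY₀ h_iv h0 h_v)
  have hp : IsProbabilityMeasure (zeta N S β • m.comap (Subtype.val : Y₀ → X)) := ⟨by
    rw [← extendMeasure_univ h_ii h0 h_v, ← measure_univ (μ := m)]
    conv_rhs => rw [← e, Measure.map_apply measurable_subtype_coe MeasurableSet.univ]
    rw [preimage_univ]⟩
  obtain ⟨ν, hν⟩ : ∃ ν : ProbabilityMeasure Y₀,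
      (ν : Measure Y₀) = zeta N S β • m.comap (Subtype.val : Y₀ → X) := ⟨⟨_, hp⟩, rfl⟩
  refine ⟨ν, Subtype.ext (ContinuousLinearMap.ext fun a => ?_)⟩
  rw [kmsStateOfMeasure_apply, hν, e]
  exact congrArg (fun ψ => ψ a) hE.symm

/-- The parametrization by probability measures on `Y₀` is affine. -/
theorem kmsStateOfMeasure_convexCombination (hY : IsClopen Y) (hGY : ⋃ g : G, g • Y = univ)
    (h_ii : S • Y₀ ⊆ Y) (h_iii : ∀ g : G, ((g • Y₀) ∩ Y).Nonempty → g ∈ S)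
    (h0 : zeta N S β ≠ 0) (h_v : zeta N S β < ∞) {ν ν' ρ : ProbabilityMeasure Y₀} {r : ℝ}
    (hr0 : 0 ≤ r) (hr1 : r ≤ 1)
    (hρ : (ρ : Measure Y₀) =
      ENNReal.ofReal r • (ν : Measure Y₀) + ENNReal.ofReal (1 - r) • (ν' : Measure Y₀)) :
    (kmsStateOfMeasure hY hGY h_ii h_iii h0 h_v ρ).1 =
      (r : ℂ) • (kmsStateOfMeasure hY hGY h_ii h_iii h0 h_v ν).1 +
        ((1 - r : ℝ) : ℂ) • (kmsStateOfMeasure hY hGY h_ii h_iii h0 h_v ν').1 := by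
  have := isProbabilityMeasure_map_extendMeasure h_ii h0 h_v (ν : Measure Y₀)
  have := isProbabilityMeasure_map_extendMeasure h_ii h0 h_v (ν' : Measure Y₀)
  ext a
  rw [add_apply, smul_apply, smul_apply, kmsStateOfMeasure_apply, kmsStateOfMeasure_apply,
    kmsStateOfMeasure_apply, hρ, map_extendMeasure_add_smul,
    integral_add_measure ((integrable_condExpect _ a).smul_measure ENNReal.ofReal_ne_top)
      ((integrable_condExpect _ a).smul_measure ENNReal.ofReal_ne_top),
    integral_smul_measure, integral_smul_measure, ENNReal.toReal_ofReal hr0,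
    ENNReal.toReal_ofReal (sub_nonneg.2 hr1)]
  simp only [Complex.real_smul, smul_eq_mul]

theorem existsUnique_isScalingMeasure_isRepresentedBy [Countable G] (hY : IsClopen Y)
    (hGY : ⋃ g : G, g • Y = univ) (h_ii : S • Y₀ ⊆ Y)
    (h_iii : ∀ g : G, ((g • Y₀) ∩ Y).Nonempty → g ∈ S)
    (h0 : zeta N S β ≠ 0) (h_v : zeta N S β < ∞) (ν : ProbabilityMeasure Y₀) :
    ∃! μ : Measure X, IsScalingMeasure N β Y μ ∧
      IsRepresentedBy (kmsStateOfMeasure hY hGY h_ii h_iii h0 h_v ν).1 μ := by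
  have hsc := isScalingMeasure_globalMeasure hY hGY h_ii h_iii h0 h_v (ν : Measure Y₀)
  have hre := globalMeasure_restrict (N := N) (β := β) hY.1.measurableSet h_ii h_iii
    (ν : Measure Y₀)
  refine ⟨globalMeasure N β S (ν : Measure Y₀), ⟨hsc, fun a => ?_⟩, fun μ hμ => ?_⟩
  · rw [hre, kmsStateOfMeasure_apply]
  · refine hμ.1.eq_of_restrict_eq hY.1.measurableSet hGY hsc ?_
    rw [hre, restrict_eq_of_isRepresentedBy hY hGY h_ii h_iii h0 h_v ν hμ.1.2.1 hμ.2]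

end Parametrization

end PhaseTransition

theorem proposition1p2 {G X : Type*} [Group G] [Countable G]
    [TopologicalSpace X] [SecondCountableTopology X] [LocallyCompactSpace X] [T2Space X]
    [MeasurableSpace X] [BorelSpace X] [MulAction G X] [ContinuousConstSMul G X]
    (N : G →* {r : ℝ // 0 < r})
    (Y : Set X) (hY : IsClopen Y) (hGY : ⋃ g : G, g • Y = univ)
    -- the sets `Y_n` and the group elements `g_n`
    (Yn : ℕ → Set X) (gn : ℕ → G)
    (hYn_meas : ∀ n, MeasurableSet (Yn n)) (hYn : ∀ n, Yn n ⊆ Y)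
    (hiso : {x | x ∈ Y ∧ ∃ g : G, g ≠ 1 ∧ g • x = x} ⊆ ⋃ n, Yn n)
    (hNgn : ∀ n, N (gn n) ≠ 1) (hinv : ∀ n, gn n • Yn n = Yn n)
    -- the data `β`, `S`, `Y₀`
    (β : ℝ) (hβ : β ≠ 0) (S : Set G) (Y₀ : Set X)
    (hY₀_ne : Y₀.Nonempty) (hY₀_meas : MeasurableSet Y₀) (hY₀ : Y₀ ⊆ Y)
    (h_i : ∀ g : G, g ≠ 1 → (g • Y₀) ∩ Y₀ = ∅)
    (h_ii : S • Y₀ ⊆ Y)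
    (h_iii : ∀ g : G, ((g • Y₀) ∩ Y).Nonempty → g ∈ S)
    (h_iv : ∀ U : Set X, IsOpen U → Y₀ ⊆ U → Y \ (S • U) ⊆ ⋃ n, Yn n)
    (h_v : zeta N S β < ∞) :
    -- part (1)
    (∃ Φ : KMSState N β Y ≃ ProbabilityMeasure Y₀,
      (∀ φ : KMSState N β Y, ∃! μ : Measure X, IsScalingMeasure N β Y μ ∧ IsRepresentedBy φ.1 μ) ∧
      (∀ (φ : KMSState N β Y) (μ : Measure X), μ Y = 1 → IsRepresentedBy φ.1 μ →
        (Φ φ : Measure Y₀) = zeta N S β • μ.comap Subtype.val) ∧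
      (∀ (ν : ProbabilityMeasure Y₀) (a : GroupoidAlgebra G Y),
        (Φ.symm ν).1 a = ∫ y : Y, condExpect a.1 y ∂(extendMeasure N β h_ii (ν : Measure Y₀))) ∧
      (∀ (φ ψ : KMSState N β Y) (r : ℝ), 0 ≤ r → r ≤ 1 → ∃ θ : KMSState N β Y,
        θ.1 = (r : ℂ) • φ.1 + ((1 - r : ℝ) : ℂ) • ψ.1 ∧
        (Φ θ : Measure Y₀) =
          ENNReal.ofReal r • (Φ φ : Measure Y₀) + ENNReal.ofReal (1 - r) • (Φ ψ : Measure Y₀))) ∧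
    -- part (2)
    (∀ ν : ProbabilityMeasure Y₀, ∀ μ : Measure Y, μ = extendMeasure N β h_ii (ν : Measure Y₀) →
      (∀ f ∈ invariantSubspace h_ii hY₀ μ,
        ‖f‖ ^ 2 = (zeta N S β).toReal * ∫ y in {y : Y | (y : X) ∈ Y₀}, ‖f y‖ ^ 2 ∂μ) ∧
      ∃ _ : (invariantSubspace h_ii hY₀ μ).HasOrthogonalProjection,
        ∀ f : Lp ℂ 2 μ, ∀ᵐ y ∂(ν : Measure Y₀),
          Summable (fun s : S => (((N s : ℝ) ^ (-β) : ℝ) : ℂ) * f (orbitMap h_ii s y)) ∧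
          ∀ t : S, (invariantSubspace h_ii hY₀ μ).starProjection f (orbitMap h_ii t y) =
            ((zeta N S β).toReal : ℂ)⁻¹ *
              ∑' s : S, (((N s : ℝ) ^ (-β) : ℝ) : ℂ) * f (orbitMap h_ii s y)) := by
  have h1 : (1 : G) ∈ S := one_mem_of_nonempty hY₀_ne hY₀ h_iii
  have h0 : zeta N S β ≠ 0 := zeta_ne_zero h1
  have hYm : MeasurableSet Y := hY.1.measurableSet
  obtain ⟨y₀, hy₀⟩ := hY₀_ne
  refine ⟨?_, ?_⟩
  · obtain ⟨Ψ, hΨ⟩ : ∃ Ψ : ProbabilityMeasure Y₀ ≃ KMSState N β Y,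
        ∀ ν, Ψ ν = kmsStateOfMeasure hY hGY h_ii h_iii h0 h_v ν :=
      ⟨Equiv.ofBijective _
        ⟨injective_kmsStateOfMeasure hY hGY hY₀_meas h_i h_ii h_iii h1 h0 h_v,
          surjective_kmsStateOfMeasure hY hGY hYn_meas hYn hiso hNgn hinv hβ hY₀_meas hY₀ h_i h_ii
            h_iii h_iv h0 h_v⟩, fun _ => rfl⟩
    refine ⟨Ψ.symm, fun φ => ?_, fun φ μ hμY hμ => ?_, fun ν a => ?_, fun φ ψ r hr0 hr1 => ?_⟩
    · obtain ⟨ν, rfl⟩ := Ψ.surjective φ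
      rw [hΨ]
      exact existsUnique_isScalingMeasure_isRepresentedBy hY hGY h_ii h_iii h0 h_v ν
    · obtain ⟨ν, rfl⟩ := Ψ.surjective φ
      rw [hΨ] at hμ
      rw [Equiv.symm_apply_apply]
      exact (comap_eq_of_restrict_eq hY₀_meas hY₀ h_i h_ii h1 h0 h_v (ν : Measure Y₀)
        (restrict_eq_of_isRepresentedBy hY hGY h_ii h_iii h0 h_v ν hμY hμ)).symm
    · rw [Equiv.symm_symm, hΨ, kmsStateOfMeasure_apply,
        (MeasurableEmbedding.subtype_coe hYm).integral_map]
    · obtain ⟨ν, rfl⟩ := Ψ.surjective φ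
      obtain ⟨ν', rfl⟩ := Ψ.surjective ψ
      have hp : IsProbabilityMeasure
          (ENNReal.ofReal r • (ν : Measure Y₀) + ENNReal.ofReal (1 - r) • (ν' : Measure Y₀)) := ⟨by
        rw [Measure.add_apply, Measure.smul_apply, Measure.smul_apply, measure_univ, measure_univ,
          smul_eq_mul, smul_eq_mul, mul_one, mul_one,
          ← ENNReal.ofReal_add hr0 (sub_nonneg.2 hr1), add_sub_cancel, ENNReal.ofReal_one]⟩
      obtain ⟨ρ, hρ⟩ : ∃ ρ : ProbabilityMeasure Y₀, (ρ : Measure Y₀) =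
          ENNReal.ofReal r • (ν : Measure Y₀) + ENNReal.ofReal (1 - r) • (ν' : Measure Y₀) :=
        ⟨⟨_, hp⟩, rfl⟩
      refine ⟨Ψ ρ, ?_, ?_⟩
      · rw [hΨ, hΨ, hΨ]
        exact kmsStateOfMeasure_convexCombination hY hGY h_ii h_iii h0 h_v hr0 hr1 hρ
      · simp only [Equiv.symm_apply_apply, hρ]
  · rintro ν _ rfl
    have hP := hasOrthogonalProjection_invariantSubspace hY₀_meas hY₀ h_i h_ii h1 ⟨y₀, hy₀⟩ h0 h_v
      (ν : Measure Y₀)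
    exact ⟨fun f hf => norm_sq_of_mem_invariantSubspace hY₀_meas hY₀ h_i h_ii h1 ⟨y₀, hy₀⟩ h0 h_v
        (ν : Measure Y₀) hf, hP,
      ae_starProjection_invariantSubspace hY₀_meas hY₀ h_i h_ii h1 ⟨y₀, hy₀⟩ h0 h_v
        (ν : Measure Y₀)⟩
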